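/- **Theorem (Area law for gapped spin chains).** Consider a chain $L=\{1,\dots,N\}$, $N\ge 1$, with open or periodic boundary conditions, each site carrying a $d$-dimensional quantum system, and a Hamiltonian $H=\sum_{j\in L}H_{j,j+1}$, where each $H_{j,j+1}$ is Hermitian, is supported on the sites $j$ and $j+1$ (site $N+1$ is site $1$; $H_{N,N+1}=0$ for open boundary conditions), and has operator norm $\|H_{j,j+1}\|\le J$, with $J>0$. Let $\mathrm{dist}$ be the graph distance on the chain (a path, respectively a cycle), and let $A(t)=e^{iHt}Ae^{-iHt}$. Call $v$ a *velocity of sound of $H$ with constants $\mu,c>0$* if $$\|[A(t),B]\|\le c\,\|A\|\,\|B\|\,e^{-\mu(\mathrm{dist}(X,Y)-v|t|)}$$ for all $t\in\mathbb R$, every block $X$ of consecutive sites, every set of sites $Y$ disjoint from $X$, and all operators $A$, $B$ supported on $X$, $Y$ respectively. Then: 1. Velocities of sound of order $J$ exist: there are numerical constants $\kappa,\mu,c>0$ such that for all $N$, $d$, $J$ and every $H$ as above, $v=\kappa J$ is a velocity of sound of $H$ with constants $\mu,c$. 2. There is a numerical constant $c_0>0$ such that for all $\kappa,\mu,c>0$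 there is a constant $\xi_C>0$, depending only on $\kappa,\mu,c$, with the following property. Let $H$ be as above, for any $N$, $d$ and $J$, and let $v\ge\kappa J$ be a velocity of sound of $H$ with constants $\mu,c$. Suppose that $H$ has a unique ground state $\psi$ and that $\Delta E>0$ is the difference between its second lowest and its lowest energy level. Then for every block $I\subseteq L$ of consecutive sites (in particular for $I=\{1,\dots,n\}$), the reduced state $\rho_I=\mathrm{tr}_{L\setminus I}|\psi\rangle\langle\psi|$ has entropy $S(\rho_I)=-\mathrm{tr}[\rho_I\log_2\rho_I]$ bounded by $$S(\rho_I)\le c_0\,\xi\,\ln(6\xi)\,\ln(d)\,2^{6\xi\ln d},\qquad \xi=\max\Big(\frac{2v}{\Delta E},\,\xi_C\Big).$$ In particular the bound depends neither on the block nor on the length of the chain. -/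

import Mathlib

open scoped Matrix.Norms.L2Operator

/-!
Finite chains of `d`-level systems with `N` sites. The basis configurations are the functions
`Fin N → Fin d`, the Hilbert space is `EuclideanSpace ℂ (Fin N → Fin d)`, and observables are
matrices indexed by configurations. The norm of a matrix is the operator norm induced by the
Euclidean norm.
-/

namespace SpinChain

/-- Basis configurations of the sites in `s`; the Hilbert space of `s` is spanned by them. -/
abbrev Config (ι : Type) (d : ℕ) : Type := ι → Fin d

/-- Observables on the whole chain. -/
abbrev Obs (N d : ℕ) : Type := Matrix (Config (Fin N) d) (Config (Fin N) d) ℂ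

/-- State vectors of the whole chain. -/
abbrev State (N d : ℕ) : Type := EuclideanSpace ℂ (Config (Fin N) d)

/-- Boundary conditions of a chain. -/
inductive Boundary : Type
  | openEnds
  | periodic

/-- Graph distance of two sites: on a path for open ends, on a cycle for periodic boundary
conditions. -/
def siteDist (bc : Boundary) {N : ℕ} (i j : Fin N) : ℕ :=
  match bc with
  | Boundary.openEnds => Nat.dist i j
  | Boundary.periodic => min (Nat.dist i j) (N - Nat.dist i j)

/-- `min {dist(i, j) | i ∈ X, j ∈ Y}`. -/
noncomputable def setDist (bc : Boundary) {N : ℕ} (X Y : Finset (Fin N)) : ℕ :=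
  sInf {k : ℕ | ∃ i ∈ X, ∃ j ∈ Y, k = siteDist bc i j}

/-- The contiguous block of `n` sites that starts with site number `a` (counted from `0`),
cut off at the end of the chain. -/
def block (N a n : ℕ) : Finset (Fin N) :=
  Finset.univ.filter fun j => a ≤ (j : ℕ) ∧ (j : ℕ) < a + n

/-- `A` acts only on the sites in `X`: it is `a ⊗ 1` for a matrix `a` on the configurations
of `X`. -/
def SupportedOn {N d : ℕ} (A : Obs N d) (X : Finset (Fin N)) : Prop :=
  ∃ a : Matrix (Config X d) (Config X d) ℂ, ∀ s t : Config (Fin N) d,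
    ((∀ i ∉ X, s i = t i) → A s t = a (fun i => s i) (fun i => t i)) ∧
    ((∃ i ∉ X, s i ≠ t i) → A s t = 0)

/-- Nearest-neighbour terms `h j = H_{j,j+1}` with norm at most `J`. The site after the last one
is the first one; for open ends the term on that bond is absent. -/
structure IsNearestNeighbour (bc : Boundary) {N d : ℕ} [NeZero N] (J : ℝ)
    (h : Fin N → Obs N d) : Prop where
  pos : 0 < J
  isHermitian : ∀ j, (h j).IsHermitian
  supported : ∀ j, SupportedOn (h j) {j, j + 1}
  norm_le : ∀ j, ‖h j‖ ≤ J
  boundary : bc = Boundary.openEnds → ∀ j : Fin N, (j : ℕ) + 1 = N → h j = 0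

/-- The Hamiltonian `H = ∑ j, H_{j,j+1}`. -/
noncomputable def hamiltonian {N d : ℕ} (h : Fin N → Obs N d) : Obs N d := ∑ j, h j

/-- Heisenberg evolution `A(t) = e^{iHt} A e^{-iHt}`. -/
noncomputable def evolve {N d : ℕ} (H A : Obs N d) (t : ℝ) : Obs N d :=
  NormedSpace.exp ((Complex.I * (t : ℂ)) • H) * A * NormedSpace.exp (-(Complex.I * (t : ℂ)) • H)

/-- `v` is a velocity of sound (Lieb–Robinson velocity) of `H`, with constants `μ` and `c`:
`‖[A(t), B]‖ ≤ c ‖A‖ ‖B‖ exp (-μ (dist(X, Y) - v |t|))` whenever `A` is supported on a block `X`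
and `B` is supported on a set `Y` disjoint from it. -/
def IsSoundVelocity (bc : Boundary) {N d : ℕ} (H : Obs N d) (v μ c : ℝ) : Prop :=
  ∀ (a n : ℕ) (Y : Finset (Fin N)), Disjoint (block N a n) Y →
    ∀ A B : Obs N d, SupportedOn A (block N a n) → SupportedOn B Y → ∀ t : ℝ,
      ‖evolve H A t * B - B * evolve H A t‖ ≤
        c * ‖A‖ * ‖B‖ * Real.exp (-μ * ((setDist bc (block N a n) Y : ℝ) - v * |t|))

/-- `ψ` is a unit vector that spans the ground space of `H` (so the ground state is unique), and
`ΔE` is the difference between the second lowest and the lowest energy level. -/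
def IsGappedGroundState {N d : ℕ} (H : Obs N d) (ψ : State N d) (ΔE : ℝ) : Prop :=
  ‖ψ‖ = 1 ∧ ∃ E₀ : ℝ,
    IsLeast {E : ℝ | Module.End.HasEigenvalue (Matrix.toEuclideanLin H) (E : ℂ)} E₀ ∧
    Module.End.eigenspace (Matrix.toEuclideanLin H) (E₀ : ℂ) = Submodule.span ℂ {ψ} ∧
    IsLeast {E : ℝ | Module.End.HasEigenvalue (Matrix.toEuclideanLin H) (E : ℂ) ∧ E ≠ E₀}
      (E₀ + ΔE)

/-- The configuration of the chain which is `s` on `I` and `o` off `I`. -/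
def glue {N d : ℕ} (I : Finset (Fin N)) (s : Config I d) (o : Config {i // i ∉ I} d) :
    Config (Fin N) d :=
  fun i => if hi : i ∈ I then s ⟨i, hi⟩ else o ⟨i, hi⟩

/-- The reduced state `ρ_I = tr_{L ∖ I} |ψ⟩⟨ψ|`. -/
noncomputable def reducedState {N d : ℕ} (ψ : State N d) (I : Finset (Fin N)) :
    Matrix (Config I d) (Config I d) ℂ :=
  fun s t => ∑ o : Config {i // i ∉ I} d, ψ (glue I s o) * star (ψ (glue I t o))

/-- The von Neumann entropy `S(ρ) = - tr (ρ log₂ ρ)`. -/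
noncomputable def entropy {n : Type} [Fintype n] [DecidableEq n] (ρ : Matrix n n ℂ) : ℝ :=
  -(ρ * cfc (Real.logb 2) ρ).trace.re

end SpinChain

/-! ### Observables supported on sets of sites -/

namespace SpinChain

open scoped Kronecker

variable {N d : ℕ}

/-! Existence of a velocity of sound. Sort the sites into layers by their distance from the block.
Beyond the block a layer has at most two sites, so the terms that reach a new layer have norm at
most 4J. By Duhamel's formula and induction, adding the terms of layer n + 1 to the generator
changes A(t) by at most ‖A‖(8Jt)^(n+1)/(n+1)!. An observable at distance D commutes with the
evolution generated by the layers before D, and the tail of the exponential series yields the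
velocity 8eJ (`isSoundVelocity_hamiltonian`).

Area law. The proof gives a polynomial bound 200 y^9, with y of order 1 + J/ΔE + ln d
(`entropy_le_of_scale`). Since v ≥ κJ, the ratio J/ΔE is at most ξ/(2κ), and 2^(6ξ ln d) absorbs the
ninth power once ξ_C is large (`mul_pow_nine_le`). The bound rests on approximate ground state
projections: operators T of small operator Schmidt rank r across the boundary of the block that fix
a unit vector u₀ close to ψ and shrink its orthogonal complement by a small factor θ.

To build T, keep S bonds next to the boundary and cut off the energies of the two ends (the block,
and the sites far outside it) at a height t above their minima. Low-lying eigenvectors have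
exponentially small weight at high energies of an end, because the single term coupling that end
stays bounded under conjugation by exp(A/(4g)), A being the Hamiltonian of the end and g = 4J
(`norm_exp_conj_le`, `sum_exp_mul_le`). So the truncated operator still has a gap, its ground state
u₀ is close to ψ (`exists_truncation`), and the width of its spectrum above the gap is of order t +
Sg, independent of N. A Chebyshev polynomial of degree l in it is 1 at the ground energy and decays
like exp(-l√(ε/width)) on the other levels. Its rank is small because in each term of a power n ≤ l
some of the S bonds occurs at most about l/S times, and cutting at that bond costs rank only for
those occurrences (`opRank_pow`). With S = y^8 and l = S² the decay beats the rank, and rθ² is tiny.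

If 2rθ² ≤ 1, the product state with the largest overlap with u₀ has squared overlap at least 1/(2r):
otherwise T applied to it would be a state of Schmidt rank r with too large an overlap
(`exists_product_state_overlap`). From this one product state the projections at the scales y + k, k
= 0, 1, …, produce approximations of ψ with error exp(-165(y+k)^9) and Schmidt rank at most
exp(135(y+k)^9). So the spectrum of the reduced state is concentrated on few eigenvalues, and its
entropy is dominated by the logarithm of the first rank (`sum_negMulLog_le`). -/

theorem glue_of_mem {I : Finset (Fin N)} (s : Config I d) (o : Config {i // i ∉ I} d) {i : Fin N}
    (hi : i ∈ I) : glue I s o i = s ⟨i, hi⟩ := by simp [glue, hi]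

theorem glue_of_notMem {I : Finset (Fin N)} (s : Config I d) (o : Config {i // i ∉ I} d)
    {i : Fin N} (hi : i ∉ I) : glue I s o i = o ⟨i, hi⟩ := by simp [glue, hi]

theorem glue_restrict (I : Finset (Fin N)) (s : Config (Fin N) d) :
    glue I (fun i => s i) (fun i => s i) = s := by
  funext i; by_cases hi : i ∈ I <;> simp [glue, hi]

/-- Configurations of the chain as pairs of configurations on and off `X`. -/
def splitEquiv (X : Finset (Fin N)) : Config (Fin N) d ≃ Config X d × Config {i // i ∉ X} d where
  toFun s := (fun i => s i, fun i => s i)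
  invFun p := glue X p.1 p.2
  left_inv s := glue_restrict X s
  right_inv p := by
    ext i
    · simp [glue]
    · simp [glue, i.2]

@[simp] theorem splitEquiv_symm_apply (X : Finset (Fin N)) (p) :
    (splitEquiv (d := d) X).symm p = glue X p.1 p.2 := rfl

/-- The observable `a ⊗ b`, with `a` acting on the sites in `X` and `b` on the others. -/
def tensor (X : Finset (Fin N)) (a : Matrix (Config X d) (Config X d) ℂ)
    (b : Matrix (Config {i // i ∉ X} d) (Config {i // i ∉ X} d) ℂ) : Obs N d :=
  (a ⊗ₖ b).submatrix (splitEquiv X) (splitEquiv X)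

theorem tensor_apply (X : Finset (Fin N)) (a : Matrix (Config X d) (Config X d) ℂ)
    (b : Matrix (Config {i // i ∉ X} d) (Config {i // i ∉ X} d) ℂ) (s t : Config (Fin N) d) :
    tensor X a b s t = a (fun i => s i) (fun i => t i) * b (fun i => s i) (fun i => t i) := rfl

theorem tensor_mul (X : Finset (Fin N)) (a a' : Matrix (Config X d) (Config X d) ℂ)
    (b b' : Matrix (Config {i // i ∉ X} d) (Config {i // i ∉ X} d) ℂ) :
    tensor X a b * tensor X a' b' = tensor X (a * a') (b * b') := by
  simp only [tensor, Matrix.submatrix_mul_equiv, Matrix.mul_kronecker_mul]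

theorem tensor_one (X : Finset (Fin N)) : tensor (d := d) X 1 1 = 1 := by
  simp [tensor]

theorem supportedOn_iff_tensor {A : Obs N d} {X : Finset (Fin N)} :
    SupportedOn A X ↔ ∃ a, A = tensor X a 1 := by
  constructor
  · rintro ⟨a, ha⟩
    refine ⟨a, ?_⟩
    ext s t
    rw [tensor_apply]
    by_cases h : ∃ i ∉ X, s i ≠ t i
    · rw [(ha s t).2 h, Matrix.one_apply_ne, mul_zero]
      obtain ⟨i, hi, hne⟩ := h
      exact fun he => hne (congrFun he ⟨i, hi⟩)
    · push Not at h
      rw [(ha s t).1 h, show (fun i : {i // i ∉ X} => s i) = fun i : {i // i ∉ X} => t i from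
        funext fun i => h i i.2, Matrix.one_apply_eq, mul_one]
  · rintro ⟨a, rfl⟩
    refine ⟨a, fun s t => ⟨fun h => ?_, fun ⟨i, hi, hne⟩ => ?_⟩⟩
    · rw [tensor_apply, show (fun i : {i // i ∉ X} => s i) = fun i : {i // i ∉ X} => t i from
        funext fun i => h i i.2, Matrix.one_apply_eq, mul_one]
    · rw [tensor_apply, Matrix.one_apply_ne, mul_zero]
      exact fun he => hne (congrFun he ⟨i, hi⟩)

theorem supportedOn_iff_entries {A : Obs N d} {X : Finset (Fin N)} :
    SupportedOn A X ↔ (∀ s t, (∃ i ∉ X, s i ≠ t i) → A s t = 0) ∧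
      ∀ s t s' t', (∀ i ∈ X, s i = s' i) → (∀ i ∈ X, t i = t' i) → (∀ i ∉ X, s i = t i) →
        (∀ i ∉ X, s' i = t' i) → A s t = A s' t' := by
  constructor
  · rintro ⟨a, ha⟩
    refine ⟨fun s t => (ha s t).2, fun s t s' t' h1 h2 h3 h4 => ?_⟩
    rw [(ha s t).1 h3, (ha s' t').1 h4]
    congr 1 <;> funext i
    · exact h1 i i.2
    · exact h2 i i.2
  · rintro ⟨h0, h⟩
    by_cases hne : Nonempty (Config {i // i ∉ X} d)
    · obtain ⟨o⟩ := hne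
      refine ⟨fun p q => A (glue X p o) (glue X q o), fun s t => ⟨fun hst => ?_, h0 s t⟩⟩
      refine h _ _ _ _ (fun i hi => ?_) (fun i hi => ?_) hst fun i hi => ?_
      · rw [glue_of_mem _ _ hi]
      · rw [glue_of_mem _ _ hi]
      · rw [glue_of_notMem _ _ hi, glue_of_notMem _ _ hi]
    · exact ⟨0, fun s t => (hne ⟨fun i => s i⟩).elim⟩

theorem SupportedOn.mono {A : Obs N d} {X Y : Finset (Fin N)} (hXY : X ⊆ Y)
    (h : SupportedOn A X) : SupportedOn A Y := by
  rw [supportedOn_iff_entries] at h ⊢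
  refine ⟨fun s t ⟨i, hi, hne⟩ => h.1 s t ⟨i, fun hX => hi (hXY hX), hne⟩,
    fun s t s' t' h1 h2 h3 h4 => ?_⟩
  by_cases hc : ∃ i ∉ X, s i ≠ t i
  · obtain ⟨i, hi, hne⟩ := hc
    have hiY : i ∈ Y := by by_contra hiY; exact hne (h3 i hiY)
    rw [h.1 s t ⟨i, hi, hne⟩, h.1 s' t' ⟨i, hi, by rwa [← h1 i hiY, ← h2 i hiY]⟩]
  · push Not at hc
    refine h.2 s t s' t' (fun i hi => h1 i (hXY hi)) (fun i hi => h2 i (hXY hi)) hc fun i hi => ?_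
    by_cases hiY : i ∈ Y
    · rw [← h1 i hiY, ← h2 i hiY, hc i hi]
    · exact h4 i hiY

/-- The observables that are supported on `X`. -/
def supp (X : Finset (Fin N)) : Subalgebra ℂ (Obs N d) where
  carrier := {A | SupportedOn A X}
  mul_mem' {A B} hA hB := by
    obtain ⟨a, rfl⟩ := supportedOn_iff_tensor.1 hA
    obtain ⟨b, rfl⟩ := supportedOn_iff_tensor.1 hB
    exact supportedOn_iff_tensor.2 ⟨a * b, by rw [tensor_mul, one_mul]⟩
  add_mem' {A B} hA hB := by
    obtain ⟨a, rfl⟩ := supportedOn_iff_tensor.1 hA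
    obtain ⟨b, rfl⟩ := supportedOn_iff_tensor.1 hB
    exact supportedOn_iff_tensor.2 ⟨a + b, by ext s t; simp [tensor_apply, add_mul]⟩
  algebraMap_mem' c := supportedOn_iff_tensor.2 ⟨algebraMap ℂ _ c, by
    rw [Algebra.algebraMap_eq_smul_one, Algebra.algebraMap_eq_smul_one, ← tensor_one X]
    ext s t; simp [tensor_apply, mul_assoc]⟩

theorem mem_supp {A : Obs N d} {X : Finset (Fin N)} : A ∈ supp X ↔ SupportedOn A X := Iff.rfl

theorem supp_mono {X Y : Finset (Fin N)} (h : X ⊆ Y) : supp (d := d) X ≤ supp Y :=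
  fun _ hA => SupportedOn.mono h hA

/-- The complement enters through the subtype `{i // i ∉ X}`, so that `X` and `Xᶜ` are the two
factors of one and the same tensor splitting. -/
theorem mem_supp_compl_iff {A : Obs N d} {X : Finset (Fin N)} :
    A ∈ supp Xᶜ ↔ ∃ b, A = tensor X 1 b := by
  rw [mem_supp, supportedOn_iff_entries]
  constructor
  · rintro ⟨h0, h⟩
    by_cases hne : Nonempty (Config X d)
    · obtain ⟨p⟩ := hne
      refine ⟨Matrix.of fun o u => A (glue X p o) (glue X p u), Matrix.ext fun s t => ?_⟩
      rw [tensor_apply]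
      by_cases hc : (fun i : X => s i) = fun i : X => t i
      · rw [hc, Matrix.one_apply_eq, one_mul, Matrix.of_apply]
        refine h _ _ _ _ (fun i hi => ?_) (fun i hi => ?_) (fun i hi => ?_) fun i hi => ?_
        · rw [glue_of_notMem _ _ (by simpa using hi)]
        · rw [glue_of_notMem _ _ (by simpa using hi)]
        · exact congrFun hc ⟨i, by simpa using hi⟩
        · rw [glue_of_mem _ _ (by simpa using hi), glue_of_mem _ _ (by simpa using hi)]
      · rw [Matrix.one_apply_ne hc, zero_mul]
        obtain ⟨i, hi⟩ := Function.ne_iff.1 hc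
        exact h0 s t ⟨i, by simp, hi⟩
    · exact ⟨0, by ext s t; exact (hne ⟨fun i => s i⟩).elim⟩
  · rintro ⟨b, rfl⟩
    refine ⟨fun s t ⟨i, hi, hne⟩ => ?_, fun s t s' t' h1 h2 h3 h4 => ?_⟩
    · rw [tensor_apply, Matrix.one_apply_ne, zero_mul]
      exact fun he => hne (congrFun he ⟨i, by simpa using hi⟩)
    · simp only [tensor_apply]
      rw [show (fun i : X => s i) = fun i : X => t i from funext fun i => h3 i (by simp),
        show (fun i : X => s' i) = fun i : X => t' i from funext fun i => h4 i (by simp),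
        show (fun i : {i // i ∉ X} => s i) = fun i : {i // i ∉ X} => s' i from
          funext fun i => h1 i (by simp [i.2]),
        show (fun i : {i // i ∉ X} => t i) = fun i : {i // i ∉ X} => t' i from
          funext fun i => h2 i (by simp [i.2])]
      simp

theorem mem_supp_of_disjoint {B : Obs N d} {X Y : Finset (Fin N)} (h : Disjoint X Y)
    (hB : B ∈ supp Y) : ∃ b, B = tensor X 1 b :=
  mem_supp_compl_iff.1 (supp_mono (Finset.subset_compl_iff_disjoint_left.2 h) hB)

theorem commute_of_disjoint {A B : Obs N d} {X Y : Finset (Fin N)} (h : Disjoint X Y)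
    (hA : A ∈ supp X) (hB : B ∈ supp Y) : Commute A B := by
  obtain ⟨a, rfl⟩ := supportedOn_iff_tensor.1 hA
  obtain ⟨b, rfl⟩ := mem_supp_of_disjoint h hB
  simp [Commute, SemiconjBy, tensor_mul]

/-- An entry of a ⊗ b is a product of an entry of a and one of b. This makes a product of ground
projections of disjoint parts nonzero. -/
theorem mul_ne_zero_of_disjoint {A B : Obs N d} {X Y : Finset (Fin N)} (h : Disjoint X Y)
    (hA : A ∈ supp X) (hB : B ∈ supp Y) (hA0 : A ≠ 0) (hB0 : B ≠ 0) : A * B ≠ 0 := by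
  obtain ⟨a, rfl⟩ := supportedOn_iff_tensor.1 hA
  obtain ⟨b, rfl⟩ := mem_supp_of_disjoint h hB
  rw [tensor_mul, mul_one, one_mul]
  have ha : ∃ p q, a p q ≠ 0 := by
    by_contra! hc
    exact hA0 (by ext s t; simp [tensor_apply, hc])
  have hb : ∃ p q, b p q ≠ 0 := by
    by_contra! hc
    exact hB0 (by ext s t; simp [tensor_apply, hc])
  obtain ⟨p, q, hpq⟩ := ha
  obtain ⟨o, u, hou⟩ := hb
  intro h0
  have := congrFun (congrFun h0 ((splitEquiv X).symm (p, o))) ((splitEquiv X).symm (q, u))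
  simp only [tensor, Matrix.submatrix_apply, Equiv.apply_symm_apply, Matrix.kroneckerMap_apply,
    Matrix.zero_apply, mul_eq_zero] at this
  tauto

/-- An observable on `X ∪ Y` is a sum of products of observables on `X` and on `Y`, indexed by
pairs of configurations of `X`. -/
theorem exists_sum_mul_of_mem_supp_union {O : Obs N d} {X Y : Finset (Fin N)} (h : Disjoint X Y)
    (hO : O ∈ supp (X ∪ Y)) :
    ∃ P Q : Config X d × Config X d → Obs N d, (∀ k, P k ∈ supp X) ∧ (∀ k, Q k ∈ supp Y) ∧
      O = ∑ k, P k * Q k := by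
  classical
  obtain ⟨hO0, hO1⟩ := supportedOn_iff_entries.1 hO
  -- Expansion in matrix units on `X`: the coefficient of the k-th one is the block of `O` between
  -- the configurations `k.1` and `k.2`, made diagonal off `Y`.
  refine ⟨fun k => tensor X (Matrix.single k.1 k.2 1) 1,
    fun k => Matrix.of fun s t => if ∀ i ∉ Y, s i = t i then
      O (glue X k.1 fun i => s i) (glue X k.2 fun i => t i) else 0, fun k =>
    supportedOn_iff_tensor.2 ⟨_, rfl⟩, fun k => ?_, ?_⟩
  · rw [mem_supp, supportedOn_iff_entries]
    refine ⟨fun s t ⟨i, hi, hne⟩ => ?_, fun s t s' t' h1 h2 h3 h4 => ?_⟩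
    · simp only [Matrix.of_apply]
      rw [if_neg]
      exact fun hc => hne (hc i hi)
    · simp only [Matrix.of_apply]
      rw [if_pos h3, if_pos h4]
      refine hO1 _ _ _ _ (fun i hi => ?_) (fun i hi => ?_) (fun i hi => ?_) fun i hi => ?_
      · by_cases hX : i ∈ X
        · rw [glue_of_mem _ _ hX, glue_of_mem _ _ hX]
        · rw [glue_of_notMem _ _ hX, glue_of_notMem _ _ hX]
          exact h1 i ((Finset.mem_union.1 hi).resolve_left hX)
      · by_cases hX : i ∈ X
        · rw [glue_of_mem _ _ hX, glue_of_mem _ _ hX]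
        · rw [glue_of_notMem _ _ hX, glue_of_notMem _ _ hX]
          exact h2 i ((Finset.mem_union.1 hi).resolve_left hX)
      · rw [Finset.mem_union, not_or] at hi
        rw [glue_of_notMem _ _ hi.1, glue_of_notMem _ _ hi.1]
        exact h3 i hi.2
      · rw [Finset.mem_union, not_or] at hi
        rw [glue_of_notMem _ _ hi.1, glue_of_notMem _ _ hi.1]
        exact h4 i hi.2
  · refine Matrix.ext fun s t => ?_
    rw [Matrix.sum_apply]
    rw [Finset.sum_eq_single ((fun i => s i, fun i => t i) : Config X d × Config X d)]
    · rw [Matrix.mul_apply, Finset.sum_eq_single (glue X (fun i => t i) fun i => s i)]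
      · have e1 : tensor X (Matrix.single (fun i : X => s i) (fun i : X => t i) (1 : ℂ)) 1 s
            (glue X (fun i => t i) fun i => s i) = 1 := by
          rw [tensor_apply]
          rw [show (fun i : X => glue X (fun i => t i) (fun i => s i) (i : Fin N)) =
            fun i : X => t i from funext fun i => glue_of_mem _ _ i.2,
            show (fun i : {i // i ∉ X} => glue X (fun i => t i) (fun i => s i) (i : Fin N)) =
            fun i : {i // i ∉ X} => s i from funext fun i => glue_of_notMem _ _ i.2]
          simp
        beta_reduce
        rw [e1, one_mul, Matrix.of_apply]
        have e2 : glue X (fun i : X => s i) (fun i : {i // i ∉ X} =>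
            glue X (fun i => t i) (fun i => s i) (i : Fin N)) = s := by
          rw [show (fun i : {i // i ∉ X} => glue X (fun i => t i) (fun i => s i) (i : Fin N)) =
            fun i : {i // i ∉ X} => s i from funext fun i => glue_of_notMem _ _ i.2]
          exact glue_restrict X s
        rw [e2, glue_restrict]
        split_ifs with hc
        · rfl
        · push Not at hc
          obtain ⟨i, hi, hne⟩ := hc
          have hX : i ∉ X := fun hX => hne (glue_of_mem _ _ hX)
          rw [glue_of_notMem _ _ hX] at hne
          exact hO0 s t ⟨i, by simp [hX, hi], hne⟩
      · intro u _ hu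
        beta_reduce
        rw [tensor_apply]
        by_cases h1 : (fun i : X => t i) = fun i : X => u i
        · by_cases h2 : (fun i : {i // i ∉ X} => s i) = fun i : {i // i ∉ X} => u i
          · exact (hu (by rw [h1, h2, glue_restrict])).elim
          · rw [Matrix.one_apply_ne h2]; simp
        · rw [Matrix.single_apply_of_col_ne _ _ h1]; simp
      · simp
    · rintro ⟨p, q⟩ _ hpq
      rw [Matrix.mul_apply]
      refine Finset.sum_eq_zero fun u _ => ?_
      simp only [tensor_apply, Matrix.of_apply]
      by_cases h1 : p = fun i : X => s i
      · by_cases h2 : q = fun i : X => u i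
        · rw [if_neg, mul_zero]
          intro hc
          refine hpq ?_
          rw [h1, h2]
          congr 1
          funext i
          exact hc i fun hY => Finset.disjoint_left.1 h i.2 hY
        · rw [Matrix.single_apply_of_col_ne _ _ h2]; simp
      · rw [Matrix.single_apply_of_row_ne h1]; simp
    · simp

end SpinChain

/-! ### Layers of sites around a block -/

namespace SpinChain

variable {N d : ℕ}

theorem val_add_one_fin [NeZero N] (j : Fin N) :
    ((j + 1 : Fin N) : ℕ) = if (j : ℕ) + 1 = N then 0 else (j : ℕ) + 1 := by
  have hj := j.isLt
  rw [Fin.val_add, Fin.val_one', Nat.add_mod_mod]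
  split_ifs with h
  · rw [h, Nat.mod_self]
  · exact Nat.mod_eq_of_lt (by omega)

/-- Normal form of a possibly empty or cut-off block: on a nonempty chain the new start is a site
and the new block ends within the chain. -/
theorem block_eq (a n : ℕ) :
    block N a n = block N (min a (N - 1)) (if a < N then min n (N - a) else 0) := by
  ext j
  have := j.isLt
  simp only [block, Finset.mem_filter, Finset.mem_univ, true_and]
  split_ifs <;> omega

/-- Signed distance of a site of the ring to the boundary of a block. -/
def ringLayer (N a n : ℕ) (j : Fin N) : ℤ :=
  -- Position counted around the ring from the start of the block. Layers ≤ 0 form the block, with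
  -- its end sites in layer 0; the neighbours outside are in layer 1.
  let p : ℕ := if a ≤ (j : ℕ) then (j : ℕ) - a else (j : ℕ) + N - a
  if p < n then -min (p : ℤ) (n - 1 - p) else 1 + min ((p : ℤ) - n) (N - 1 - p)

theorem ringLayer_nonpos_iff {a n : ℕ} (ha : a < N) (hn : a + n ≤ N) (j : Fin N) :
    ringLayer N a n j ≤ 0 ↔ j ∈ block N a n := by
  have := j.isLt
  simp only [ringLayer, block, Finset.mem_filter, Finset.mem_univ, true_and]
  split_ifs <;> omega

theorem abs_ringLayer_sub_le [NeZero N] {a n : ℕ} (ha : a < N) (hn : a + n ≤ N) (j : Fin N) :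
    |ringLayer N a n (j + 1) - ringLayer N a n j| ≤ 1 := by
  have := j.isLt
  simp only [ringLayer, val_add_one_fin]
  rw [abs_le]
  constructor <;> split_ifs <;> omega

theorem card_fiber_le_two_of_injOn {lay : Fin N → ℤ} {k : ℤ} (p : Fin N → ℤ)
    (hp : Function.Injective p) (x y : ℤ) (h : ∀ j, lay j = k → p j = x ∨ p j = y) :
    (Finset.univ.filter fun j => lay j = k).card ≤ 2 := by
  calc (Finset.univ.filter fun j => lay j = k).card
      = ((Finset.univ.filter fun j => lay j = k).image p).card :=
        (Finset.card_image_of_injective _ hp).symm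
    _ ≤ ({x, y} : Finset ℤ).card := Finset.card_le_card fun z hz => by
        simp only [Finset.mem_image, Finset.mem_filter, Finset.mem_univ, true_and] at hz
        obtain ⟨j, hj, rfl⟩ := hz
        simpa using h j hj
    _ ≤ 2 := Finset.card_le_two

theorem card_ringLayer_fiber_le {a n : ℕ} (ha : a < N) (hn : a + n ≤ N) (k : ℤ) :
    (Finset.univ.filter fun j => ringLayer N a n j = k).card ≤ 2 := by
  refine card_fiber_le_two_of_injOn
    (fun j => if a ≤ (j : ℕ) then (j : ℤ) - a else (j : ℤ) + N - a) (fun i j hij => ?_)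
    (if k ≤ 0 then -k else n + k - 1) (if k ≤ 0 then n - 1 + k else N - k) fun j hj => ?_
  · have := i.isLt
    have := j.isLt
    apply Fin.ext
    dsimp only at hij
    split_ifs at hij <;> omega
  · have := j.isLt
    simp only [ringLayer] at hj
    split_ifs at hj ⊢ <;> omega

/-- Distance of a site of the path to a block. -/
def pathLayer (N a n : ℕ) (j : Fin N) : ℤ :=
  if (j : ℕ) < a then a - j else if (j : ℕ) < a + n then 0 else j - (a + n) + 1

/-- The layering behind the Lieb–Robinson bound. Layers must dominate the graph distance, so the
open chain needs its own layering: around the ring, sites would come too close. Inside the block a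
layer may be large, hence the cardinality bound only for k ≥ 1. -/
theorem exists_layering_block [NeZero N] (bc : Boundary) {a n : ℕ} (hX : (block N a n).Nonempty) :
    ∃ lay : Fin N → ℤ, (∀ j, lay j ≤ 0 ↔ j ∈ block N a n) ∧
      (∀ j : Fin N, (bc = Boundary.openEnds → (j : ℕ) + 1 ≠ N) → |lay (j + 1) - lay j| ≤ 1) ∧
      (∀ k, 1 ≤ k → (Finset.univ.filter fun j => lay j = k).card ≤ 2) ∧
      ∀ j, 1 ≤ lay j → ∃ i ∈ block N a n, (siteDist bc i j : ℤ) ≤ lay j := by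
  obtain ⟨x, hx⟩ := hX
  have hxN := x.isLt
  simp only [block, Finset.mem_filter, Finset.mem_univ, true_and] at hx
  cases bc with
  | openEnds =>
    refine ⟨pathLayer N a n, fun j => ?_, fun j hj => ?_, fun k hk => ?_, fun j hj => ?_⟩
    · simp only [pathLayer, block, Finset.mem_filter, Finset.mem_univ, true_and]
      split_ifs <;> omega
    · have := hj rfl
      simp only [pathLayer, val_add_one_fin, if_neg this]
      rw [abs_le]
      constructor <;> split_ifs <;> omega
    · refine card_fiber_le_two_of_injOn (fun j => (j : ℤ)) (fun i j hij => Fin.ext (by simpa using hij))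
        (a - k) (k + (a + n) - 1) fun j hj => ?_
      simp only [pathLayer] at hj
      split_ifs at hj <;> omega
    · have hjN := j.isLt
      by_cases hja : (j : ℕ) < a
      · refine ⟨⟨a, by omega⟩, by simp [block]; omega, ?_⟩
        simp only [siteDist, Nat.dist, pathLayer, if_pos hja]
        omega
      · have h2 : ¬ (j : ℕ) < a + n := fun h => by simp [pathLayer, hja, h] at hj
        refine ⟨⟨a + n - 1, by omega⟩, by simp [block]; omega, ?_⟩
        simp only [siteDist, Nat.dist, pathLayer, if_neg hja, if_neg h2]
        omega
  | periodic =>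
    -- The ring layering presupposes that the block does not run past the last site.
    obtain ⟨m, hm, hmN, hm1⟩ : ∃ m, block N a n = block N a m ∧ a + m ≤ N ∧ 1 ≤ m := by
      refine ⟨min n (N - a), ?_, by omega, by omega⟩
      ext j
      have := j.isLt
      simp only [block, Finset.mem_filter, Finset.mem_univ, true_and]
      omega
    rw [hm]
    have ha : a < N := by omega
    refine ⟨ringLayer N a m, ringLayer_nonpos_iff ha hmN, fun j _ => abs_ringLayer_sub_le ha hmN j,
      fun k _ => card_ringLayer_fiber_le ha hmN k, fun j hj => ?_⟩
    have hjN := j.isLt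
    by_cases hc : (siteDist Boundary.periodic (⟨a, ha⟩ : Fin N) j : ℤ) ≤ ringLayer N a m j
    · exact ⟨⟨a, ha⟩, by simp [block]; omega, hc⟩
    · refine ⟨⟨a + m - 1, by omega⟩, by simp [block]; omega, ?_⟩
      simp only [siteDist, Nat.dist, ringLayer] at hc hj ⊢
      split_ifs at hc hj ⊢ <;> omega

/-- The part of the Hamiltonian that connects the layers `k - 1` and `k`, including the terms
inside layer `k`. -/
def layerTerm [NeZero N] (lay : Fin N → ℤ) (h : Fin N → Obs N d) (k : ℤ) : Obs N d :=
  ∑ j with max (lay j) (lay (j + 1)) = k, h j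

theorem isHermitian_sum {ι : Type*} {s : Finset ι} {A : ι → Obs N d}
    (h : ∀ i ∈ s, (A i).IsHermitian) : (∑ i ∈ s, A i).IsHermitian := by
  rw [Matrix.IsHermitian, Matrix.conjTranspose_sum]
  exact Finset.sum_congr rfl fun i hi => h i hi

section

variable [NeZero N] {lay : Fin N → ℤ} {h : Fin N → Obs N d}

theorem layerTerm_isHermitian (hh : ∀ j, (h j).IsHermitian) (k : ℤ) :
    (layerTerm lay h k).IsHermitian := isHermitian_sum fun j _ => hh j

theorem layerTerm_mem_supp (hs : ∀ j, SupportedOn (h j) {j, j + 1})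
    (hadj : ∀ j, h j = 0 ∨ |lay (j + 1) - lay j| ≤ 1) (k : ℤ) :
    layerTerm lay h k ∈ supp (Finset.univ.filter fun j => lay j = k - 1 ∨ lay j = k) := by
  refine Subalgebra.sum_mem _ fun j hj => ?_
  rw [Finset.mem_filter] at hj
  rcases hadj j with h0 | h1
  · rw [h0]; exact Subalgebra.zero_mem _
  · refine supp_mono ?_ (mem_supp.2 (hs j))
    rw [abs_le] at h1
    intro i hi
    rw [Finset.mem_insert, Finset.mem_singleton] at hi
    rw [Finset.mem_filter]
    refine ⟨Finset.mem_univ _, ?_⟩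
    rcases hi with rfl | rfl <;> omega

/-- A bond whose larger layer is k has an endpoint in layer k. Each of the at most two sites there
is the left end of one bond and the right end of one, which leaves at most four bonds. -/
theorem norm_layerTerm_le {J : ℝ} (hJ : 0 ≤ J) (hn : ∀ j, ‖h j‖ ≤ J) {k : ℤ}
    (hcard : (Finset.univ.filter fun j => lay j = k).card ≤ 2) :
    ‖layerTerm lay h k‖ ≤ 4 * J := by
  have hinj : Function.Injective fun j : Fin N => j + 1 := add_left_injective 1
  have hc : (Finset.univ.filter fun j => max (lay j) (lay (j + 1)) = k).card ≤ 4 := by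
    calc _ ≤ ((Finset.univ.filter fun j => lay j = k) ∪
          (Finset.univ.filter fun j => lay (j + 1) = k)).card := Finset.card_le_card fun j hj => by
            simp only [Finset.mem_filter, Finset.mem_univ, true_and, Finset.mem_union] at hj ⊢
            omega
      _ ≤ _ := Finset.card_union_le _ _
      _ ≤ 2 + 2 := by
        refine add_le_add hcard (le_trans ?_ hcard)
        rw [← Finset.card_image_of_injective _ hinj]
        refine Finset.card_le_card fun j hj => ?_
        simp only [Finset.mem_image, Finset.mem_filter, Finset.mem_univ, true_and] at hj ⊢
        obtain ⟨i, hi, rfl⟩ := hj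
        exact hi
  calc ‖layerTerm lay h k‖ ≤ ∑ j with max (lay j) (lay (j + 1)) = k, ‖h j‖ := norm_sum_le _ _
    _ ≤ (Finset.univ.filter fun j => max (lay j) (lay (j + 1)) = k).card • J :=
      Finset.sum_le_card_nsmul _ _ _ fun j _ => hn j
    _ ≤ 4 * J := by
      rw [nsmul_eq_mul]
      exact mul_le_mul_of_nonneg_right (by exact_mod_cast hc) hJ

theorem sum_layerTerm {lo hi : ℤ} (hlo : ∀ j, lo ≤ lay j) (hhi : ∀ j, lay j ≤ hi) :
    ∑ k ∈ Finset.Icc lo hi, layerTerm lay h k = hamiltonian h := by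
  unfold layerTerm hamiltonian
  refine Finset.sum_fiberwise_of_maps_to (fun j _ => ?_) _
  rw [Finset.mem_Icc]
  have := hlo j; have := hhi j; have := hhi (j + 1)
  omega

end

theorem exists_layer_bounds [NeZero N] (lay : Fin N → ℤ) :
    ∃ M : ℕ, ∀ j, -(M : ℤ) ≤ lay j ∧ lay j ≤ M := by
  refine ⟨Finset.univ.sup fun j => (lay j).natAbs, fun j => ?_⟩
  have : (lay j).natAbs ≤ Finset.univ.sup fun j => (lay j).natAbs :=
    Finset.le_sup (f := fun j => (lay j).natAbs) (Finset.mem_univ j)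
  omega

end SpinChain

/-! ### Locality of Heisenberg evolution in a C⋆-algebra -/

namespace SpinChain

section Evolution

open NormedSpace

variable {𝔸 : Type*} [CStarAlgebra 𝔸] {H K A B : 𝔸}

/-- Heisenberg evolution in a C⋆-algebra. -/
noncomputable def heisenberg (H A : 𝔸) (t : ℝ) : 𝔸 :=
  exp ((Complex.I * (t : ℂ)) • H) * A * exp (-(Complex.I * (t : ℂ)) • H)

theorem exp_mem_unitary (hH : IsSelfAdjoint H) (t : ℝ) :
    exp ((Complex.I * (t : ℂ)) • H) ∈ unitary (𝔸) := by
  let := NormedAlgebra.restrictScalars ℚ ℂ 𝔸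
  refine exp_mem_unitary_of_mem_skewAdjoint ?_
  rw [skewAdjoint.mem_iff, star_smul, hH.star_eq]
  simp

theorem neg_smul_eq_smul_neg_cast (H : 𝔸) (t : ℝ) :
    -(Complex.I * (t : ℂ)) • H = (Complex.I * ((-t : ℝ) : ℂ)) • H := by
  push_cast; rw [mul_neg]

theorem norm_exp_mul_mul_exp (hH : IsSelfAdjoint H) (A : 𝔸) (s t : ℝ) :
    ‖exp ((Complex.I * (s : ℂ)) • H) * A * exp ((Complex.I * (t : ℂ)) • H)‖ = ‖A‖ := by
  rw [CStarRing.norm_mul_mem_unitary _ (exp_mem_unitary hH t),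
    CStarRing.norm_mem_unitary_mul _ (exp_mem_unitary hH s)]

theorem norm_heisenberg (hH : IsSelfAdjoint H) (A : 𝔸) (t : ℝ) : ‖heisenberg H A t‖ = ‖A‖ := by
  rw [heisenberg, neg_smul_eq_smul_neg_cast, norm_exp_mul_mul_exp hH]

theorem hasDerivAt_exp_I_smul (H : 𝔸) (t : ℝ) :
    HasDerivAt (fun t : ℝ => exp ((Complex.I * (t : ℂ)) • H))
      (exp ((Complex.I * (t : ℂ)) • H) * (Complex.I • H)) t := by
  have h := hasDerivAt_exp_smul_const (𝕂 := ℝ) (Complex.I • H) t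
  have e : ∀ t : ℝ, (Complex.I * (t : ℂ)) • H = t • (Complex.I • H) := fun t => by
    rw [← Complex.coe_smul t, smul_smul, mul_comm]
  simp only [e]
  exact h

theorem heisenberg_commute (hBH : Commute B H) (hBA : Commute B A) (t : ℝ) :
    Commute B (heisenberg H A t) :=
  ((hBH.smul_right _).exp_right.mul_right hBA).mul_right (hBH.smul_right _).exp_right

theorem heisenberg_neg (H A : 𝔸) (t : ℝ) : heisenberg H A (-t) = heisenberg (-H) A t := by
  simp [heisenberg]

/-- Duhamel's formula as a norm bound. -/
theorem norm_heisenberg_sub_heisenberg_le (hK : IsSelfAdjoint K) {t : ℝ} (ht : 0 ≤ t)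
    {f f' : ℝ → ℝ} (hf : ∀ r, HasDerivAt f (f' r) r) (hf0 : f 0 = 0)
    (hb : ∀ r, 0 ≤ r → ‖(K - H) * heisenberg H A r - heisenberg H A r * (K - H)‖ ≤ f' r) :
    ‖heisenberg H A t - heisenberg K A t‖ ≤ f t := by
  set E : ℝ → 𝔸 := fun r => exp ((Complex.I * (r : ℂ)) • K) with hE
  set F : ℝ → 𝔸 := fun r => exp ((Complex.I * (r : ℂ)) • H) with hF
  have hEd : ∀ r, HasDerivAt E (E r * (Complex.I • K)) r := hasDerivAt_exp_I_smul K
  have hFd : ∀ r, HasDerivAt F (F r * (Complex.I • H)) r := hasDerivAt_exp_I_smul H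
  have hEc : ∀ r, Commute K (E r) := fun r => ((Commute.refl K).smul_right _).exp_right
  have hFc : ∀ r, Commute H (F r) := fun r => ((Commute.refl H).smul_right _).exp_right
  have hevH : ∀ r, heisenberg H A r = F r * A * F (-r) := fun r => by
    rw [heisenberg, neg_smul_eq_smul_neg_cast]
  have hevK : ∀ r, heisenberg K A r = E r * A * E (-r) := fun r => by
    rw [heisenberg, neg_smul_eq_smul_neg_cast]
  have hE0 : E 0 = 1 := by simp [hE]
  have hF0 : F 0 = 1 := by simp [hF]
  -- Evolution with `H` up to time r and with `K` for the remaining t - r, minus the evolution with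
  -- `K`: zero at r = 0, the wanted difference at r = t.
  set u : ℝ → 𝔸 := fun r => E (t - r) * (F r * A * F (-r)) * E (r - t) - heisenberg K A t with hu
  have hud : ∀ r, HasDerivAt u (-Complex.I • (E (t - r) *
      ((K - H) * heisenberg H A r - heisenberg H A r * (K - H)) * E (r - t))) r := by
    intro r
    have h1 : HasDerivAt (fun r => E (t - r)) (-(E (t - r) * (Complex.I • K))) r := by
      exact (hEd (t - r)).comp_const_sub t r
    have h2 : HasDerivAt (fun r => E (r - t)) (E (r - t) * (Complex.I • K)) r := by
      exact (hEd (r - t)).comp_sub_const r t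
    have h3 : HasDerivAt (fun r => F (-r)) (-(F (-r) * (Complex.I • H))) r := by
      simpa using HasDerivAt.comp_const_sub (f := F) 0 r (by simpa using hFd (-r))
    have h4 := (((h1.mul (((hFd r).mul_const A).mul h3)).mul h2).sub_const (heisenberg K A t))
    refine h4.congr_deriv ?_
    rw [hevH]
    have c1 := (hEc (t - r)).eq
    have c2 := (hEc (r - t)).eq
    have c3 := (hFc r).eq
    have c4 := (hFc (-r)).eq
    simp only [Pi.mul_apply, mul_smul_comm, smul_mul_assoc, ← c2, ← c3, ← c4, neg_smul, mul_neg,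
      neg_mul, mul_add, add_mul, mul_sub, sub_mul, smul_sub, mul_assoc]
    abel
  have hmain := image_norm_le_of_norm_deriv_right_le_deriv_boundary (f := u) (a := 0) (b := t)
    (B := f) (B' := f') (f' := fun r => -Complex.I • (E (t - r) *
      ((K - H) * heisenberg H A r - heisenberg H A r * (K - H)) * E (r - t)))
    (fun r _ => (hud r).continuousAt.continuousWithinAt)
    (fun r _ => (hud r).hasDerivWithinAt)
    (by simp [hu, hF0, hf0, hevK]) hf
    (fun r hr => by
      rw [norm_smul, norm_neg, Complex.norm_I, one_mul]
      have := norm_exp_mul_mul_exp hK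
        ((K - H) * heisenberg H A r - heisenberg H A r * (K - H)) (t - r) (r - t)
      exact this.le.trans (hb r hr.1))
  have := hmain (Set.right_mem_Icc.2 ht)
  simpa [hu, hE0, hevH] using this

/-- Growing the region whose terms generate the evolution changes the heisenbergd observable little. -/
theorem norm_heisenberg_succ_sub_le (b : ℕ → 𝔸) (A : 𝔸) {g : ℝ} (hg : 0 ≤ g)
    (hb : ∀ k, IsSelfAdjoint (b k)) (hbn : ∀ k, 1 ≤ k → ‖b k‖ ≤ g)
    (hbb : ∀ j k, j + 2 ≤ k → Commute (b k) (b j)) (hbA : ∀ k, 2 ≤ k → Commute (b k) A)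
    (n : ℕ) : ∀ t : ℝ, 0 ≤ t →
    ‖heisenberg (∑ k ∈ Finset.range (n + 1), b k) A t -
      heisenberg (∑ k ∈ Finset.range (n + 2), b k) A t‖ ≤
      ‖A‖ * ((2 * g * t) ^ (n + 1) / (n + 1).factorial) := by
  have hH : ∀ n, IsSelfAdjoint (∑ k ∈ Finset.range n, b k) := fun n =>
    isSelfAdjoint_sum _ fun k _ => hb k
  have hcomm : ∀ X Y : 𝔸, ‖X * Y - Y * X‖ ≤ 2 * ‖X‖ * ‖Y‖ := fun X Y => by
    calc _ ≤ ‖X * Y‖ + ‖Y * X‖ := norm_sub_le _ _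
      _ ≤ ‖X‖ * ‖Y‖ + ‖Y‖ * ‖X‖ := add_le_add (norm_mul_le _ _) (norm_mul_le _ _)
      _ = _ := by ring
  have hder : ∀ (n : ℕ) (r : ℝ), HasDerivAt
      (fun t : ℝ => ‖A‖ * ((2 * g * t) ^ (n + 1) / (n + 1).factorial))
      (2 * g * (‖A‖ * ((2 * g * r) ^ n / n.factorial))) r := by
    intro n r
    have h1 := ((((hasDerivAt_id r).const_mul (2 * g)).pow (n + 1)).div_const
      ((n + 1).factorial : ℝ)).const_mul ‖A‖
    refine h1.congr_deriv ?_
    have : (n.factorial : ℝ) ≠ 0 := by positivity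
    have : (n : ℝ) + 1 ≠ 0 := by positivity
    simp only [Nat.factorial_succ, id_eq]
    push_cast
    field_simp
  induction n with
  | zero =>
    intro t ht
    refine norm_heisenberg_sub_heisenberg_le (hH _) ht (hder 0) (by simp) fun r _ => ?_
    rw [Finset.sum_range_succ b 1, add_sub_cancel_left]
    refine (hcomm _ _).trans ?_
    rw [norm_heisenberg (hH _)]
    have := hbn 1 le_rfl
    simp
    gcongr
  | succ n ih =>
    intro t ht
    refine norm_heisenberg_sub_heisenberg_le (hH _) ht (hder (n + 1)) (by simp) fun r hr => ?_
    rw [Finset.sum_range_succ b (n + 2), add_sub_cancel_left]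
    -- The new term does not see the evolution generated by the terms up to n. Subtracting that
    -- evolution inside the commutator brings in the induction hypothesis, and integration supplies
    -- one more power of t and the next factor of the factorial.
    have hc : Commute (b (n + 2)) (heisenberg (∑ k ∈ Finset.range (n + 1), b k) A r) :=
      heisenberg_commute (Commute.sum_right _ _ _ fun j hj => hbb _ _ (by
        have := Finset.mem_range.1 hj; omega)) (hbA _ (by omega)) r
    have e : b (n + 2) * heisenberg (∑ k ∈ Finset.range (n + 2), b k) A r -
        heisenberg (∑ k ∈ Finset.range (n + 2), b k) A r * b (n + 2) =
        -(b (n + 2) * (heisenberg (∑ k ∈ Finset.range (n + 1), b k) A r -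
            heisenberg (∑ k ∈ Finset.range (n + 2), b k) A r) -
          (heisenberg (∑ k ∈ Finset.range (n + 1), b k) A r -
            heisenberg (∑ k ∈ Finset.range (n + 2), b k) A r) * b (n + 2)) := by
      rw [mul_sub, sub_mul, hc.eq]; abel
    rw [e, norm_neg]
    refine (hcomm _ _).trans ?_
    have h1 := hbn (n + 2) (by omega)
    have h2 := ih r hr
    gcongr

/-- Telescoping gives the part of the exponential series of x = 2gt from order n + 1 on. There x^k ≤
e^(-(n+1)) (ex)^k, so the tail is at most exp(ex - (n+1)): this is where the factor e in the
velocity comes from. -/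
theorem norm_heisenberg_sub_le (b : ℕ → 𝔸) (A : 𝔸) {g : ℝ} (hg : 0 ≤ g)
    (hb : ∀ k, IsSelfAdjoint (b k)) (hbn : ∀ k, 1 ≤ k → ‖b k‖ ≤ g)
    (hbb : ∀ j k, j + 2 ≤ k → Commute (b k) (b j)) (hbA : ∀ k, 2 ≤ k → Commute (b k) A)
    (n m : ℕ) {t : ℝ} (ht : 0 ≤ t) :
    ‖heisenberg (∑ k ∈ Finset.range (n + 1), b k) A t -
      heisenberg (∑ k ∈ Finset.range (n + 1 + m), b k) A t‖ ≤
      ‖A‖ * Real.exp (2 * g * Real.exp 1 * t - (n + 1)) := by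
  set x := 2 * g * t with hx
  have hx0 : 0 ≤ x := by positivity
  have h1 : ‖heisenberg (∑ k ∈ Finset.range (n + 1), b k) A t -
      heisenberg (∑ k ∈ Finset.range (n + 1 + m), b k) A t‖ ≤
      ∑ k ∈ Finset.range m, ‖A‖ * (x ^ (n + k + 1) / (n + k + 1).factorial) := by
    induction m with
    | zero => simp
    | succ m ih =>
      rw [Finset.sum_range_succ _ m]
      refine (norm_sub_le_norm_sub_add_norm_sub _
        (heisenberg (∑ k ∈ Finset.range (n + 1 + m), b k) A t) _).trans (add_le_add ih ?_)
      have := norm_heisenberg_succ_sub_le b A hg hb hbn hbb hbA (n + m) t ht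
      rwa [show n + 1 + m = n + m + 1 by ring, show n + 1 + (m + 1) = n + m + 2 by ring]
  refine h1.trans ?_
  rw [← Finset.mul_sum]
  refine mul_le_mul_of_nonneg_left ?_ (norm_nonneg A)
  have h2 : ∀ k : ℕ, x ^ (n + k + 1) / ((n + k + 1).factorial : ℝ) ≤
      Real.exp (-((n : ℝ) + 1)) *
        ((Real.exp 1 * x) ^ (n + k + 1) / ((n + k + 1).factorial : ℝ)) := fun k => by
    have e : Real.exp (-((n : ℝ) + 1)) *
        ((Real.exp 1 * x) ^ (n + k + 1) / ((n + k + 1).factorial : ℝ)) =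
        Real.exp k * (x ^ (n + k + 1) / ((n + k + 1).factorial : ℝ)) := by
      rw [mul_pow, ← Real.exp_nat_mul, mul_div_assoc, ← mul_assoc, ← Real.exp_add]
      congr 2; push_cast; ring
    rw [e]
    exact le_mul_of_one_le_left (by positivity) (Real.one_le_exp (by positivity))
  calc ∑ k ∈ Finset.range m, x ^ (n + k + 1) / ((n + k + 1).factorial : ℝ)
      ≤ ∑ k ∈ Finset.range m, Real.exp (-((n : ℝ) + 1)) *
        ((Real.exp 1 * x) ^ (n + k + 1) / ((n + k + 1).factorial : ℝ)) :=
        Finset.sum_le_sum fun k _ => h2 k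
    _ = Real.exp (-((n : ℝ) + 1)) * ∑ k ∈ Finset.range m,
        ((Real.exp 1 * x) ^ (n + 1 + k) / ((n + 1 + k).factorial : ℝ)) := by
        rw [Finset.mul_sum]
        refine Finset.sum_congr rfl fun k _ => by rw [show n + k + 1 = n + 1 + k by ring]
    _ ≤ Real.exp (-((n : ℝ) + 1)) * ∑ k ∈ Finset.range (n + 1 + m),
        ((Real.exp 1 * x) ^ k / (k.factorial : ℝ)) := by
        rw [Finset.sum_range_add _ (n + 1) m]
        exact mul_le_mul_of_nonneg_left (le_add_of_nonneg_left
          (Finset.sum_nonneg fun k _ => by positivity)) (Real.exp_pos _).le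
    _ ≤ Real.exp (-((n : ℝ) + 1)) * Real.exp (Real.exp 1 * x) :=
        mul_le_mul_of_nonneg_left (Real.sum_le_exp_of_nonneg (by positivity) _) (Real.exp_pos _).le
    _ = _ := by rw [← Real.exp_add, hx]; congr 1; ring

end Evolution

end SpinChain

/-! ### The Lieb–Robinson bound -/

namespace SpinChain

section LiebRobinson

variable {N d : ℕ}

theorem evolve_eq_heisenberg (H A : Obs N d) (t : ℝ) : evolve H A t = heisenberg H A t := rfl

theorem norm_commutator_le (X Y : Obs N d) : ‖X * Y - Y * X‖ ≤ 2 * ‖X‖ * ‖Y‖ := by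
  calc _ ≤ ‖X * Y‖ + ‖Y * X‖ := norm_sub_le _ _
    _ ≤ ‖X‖ * ‖Y‖ + ‖Y‖ * ‖X‖ := add_le_add (norm_mul_le _ _) (norm_mul_le _ _)
    _ = _ := by ring

/-- Reversing time is the same as replacing H by -H, and the class of Hamiltonians is closed under
this. -/
theorem isSoundVelocity_of_nonneg_time {bc : Boundary} {H : Obs N d} {v μ c : ℝ}
    (h : ∀ (a n : ℕ) (Y : Finset (Fin N)), Disjoint (block N a n) Y →
      ∀ A B : Obs N d, SupportedOn A (block N a n) → SupportedOn B Y → ∀ t : ℝ, 0 ≤ t →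
        ‖evolve H A t * B - B * evolve H A t‖ ≤
          c * ‖A‖ * ‖B‖ * Real.exp (-μ * ((setDist bc (block N a n) Y : ℝ) - v * |t|)) ∧
        ‖evolve (-H) A t * B - B * evolve (-H) A t‖ ≤
          c * ‖A‖ * ‖B‖ * Real.exp (-μ * ((setDist bc (block N a n) Y : ℝ) - v * |t|))) :
    IsSoundVelocity bc H v μ c := by
  intro a n Y hd A B hA hB t
  rcases le_total 0 t with ht | ht
  · exact (h a n Y hd A B hA hB t ht).1
  · have := (h a n Y hd A B hA hB (-t) (by linarith)).2
    rwa [evolve_eq_heisenberg, ← heisenberg_neg, neg_neg, abs_neg] at this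

theorem isNearestNeighbour_neg {bc : Boundary} [NeZero N] {J : ℝ} {h : Fin N → Obs N d}
    (hh : IsNearestNeighbour bc J h) : IsNearestNeighbour bc J fun j => -h j where
  pos := hh.pos
  isHermitian j := (hh.isHermitian j).neg
  supported j := (supp _).neg_mem (hh.supported j)
  norm_le j := by rw [norm_neg]; exact hh.norm_le j
  boundary hb j hj := by rw [hh.boundary hb j hj, neg_zero]

/-- All terms within layers ≤ 0 are lumped into `b 0`, whose norm does not matter. `B` lives on
layers ≥ D, so it commutes with the evolution generated by `b 0, …, b (D-1)`, and only the
difference from the full evolution contributes. -/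
theorem norm_commutator_evolve_le {bc : Boundary} [NeZero N] {J : ℝ} {h : Fin N → Obs N d}
    (hh : IsNearestNeighbour bc J h) {a n : ℕ} {Y : Finset (Fin N)}
    (hd : Disjoint (block N a n) Y) {A B : Obs N d} (hA : SupportedOn A (block N a n))
    (hB : SupportedOn B Y) {t : ℝ} (ht : 0 ≤ t) :
    ‖evolve (hamiltonian h) A t * B - B * evolve (hamiltonian h) A t‖ ≤
      2 * ‖A‖ * ‖B‖ * Real.exp (-1 *
        ((setDist bc (block N a n) Y : ℝ) - 8 * Real.exp 1 * J * |t|)) := by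
  have hJ := hh.pos
  have hH : IsSelfAdjoint (hamiltonian h) := isHermitian_sum fun j _ => hh.isHermitian j
  rw [abs_of_nonneg ht]
  set D := setDist bc (block N a n) Y with hD
  rcases Nat.eq_zero_or_pos D with h0 | hpos
  · refine (norm_commutator_le _ _).trans ?_
    rw [evolve_eq_heisenberg, norm_heisenberg hH, h0]
    refine le_mul_of_one_le_right (by positivity) (Real.one_le_exp ?_)
    have : 0 ≤ 8 * Real.exp 1 * J * t := by positivity
    push_cast
    linarith
  -- `sInf ∅ = 0`, so a positive distance excludes the empty block.
  have hX : (block N a n).Nonempty := by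
    by_contra hc
    rw [Finset.not_nonempty_iff_eq_empty] at hc
    rw [hD, setDist, hc] at hpos
    simp at hpos
  obtain ⟨lay, hl0, hadj, hfib, hdist⟩ := exists_layering_block bc hX
  have hDY : ∀ j ∈ Y, (D : ℤ) ≤ lay j := fun j hj => by
    have h1 : ¬ lay j ≤ 0 := fun hc => Finset.disjoint_left.1 hd ((hl0 j).1 hc) hj
    obtain ⟨i, hi, hij⟩ := hdist j (by omega)
    have : D ≤ siteDist bc i j := Nat.sInf_le ⟨i, hi, j, hj, rfl⟩
    omega
  have hadj' : ∀ j, h j = 0 ∨ |lay (j + 1) - lay j| ≤ 1 := fun j => by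
    by_cases hc : bc = Boundary.openEnds ∧ (j : ℕ) + 1 = N
    · exact Or.inl (hh.boundary hc.1 j hc.2)
    · exact Or.inr (hadj j fun hb hj => hc ⟨hb, hj⟩)
  obtain ⟨M, hM⟩ := exists_layer_bounds lay
  set b : ℕ → Obs N d := fun k =>
    if k = 0 then ∑ l ∈ Finset.Icc (-(M : ℤ)) 0, layerTerm lay h l else layerTerm lay h k with hb
  have hlayer : ∀ k : ℤ, layerTerm lay h k ∈ supp (Finset.univ.filter fun j => lay j ≤ k) :=
    fun k => supp_mono (fun j hj => by
      simp only [Finset.mem_filter, Finset.mem_univ, true_and] at hj ⊢; omega)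
      (layerTerm_mem_supp hh.supported hadj' k)
  have hbsupp : ∀ k : ℕ, b k ∈ supp (Finset.univ.filter fun j => lay j ≤ k) := fun k => by
    rcases Nat.eq_zero_or_pos k with rfl | hk
    · refine Subalgebra.sum_mem _ fun l hl => supp_mono (fun j hj => ?_) (hlayer l)
      simp only [Finset.mem_filter, Finset.mem_univ, true_and, Finset.mem_Icc] at hj hl ⊢
      omega
    · simp only [hb, if_neg hk.ne']
      exact hlayer k
  have hbsupp' : ∀ k : ℕ, 1 ≤ k →
      b k ∈ supp (Finset.univ.filter fun j => lay j = k - 1 ∨ lay j = k) := fun k hk => by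
    simp only [hb, if_neg (show k ≠ 0 by omega)]
    exact layerTerm_mem_supp hh.supported hadj' k
  have hbsa : ∀ k, IsSelfAdjoint (b k) := fun k => by
    simp only [hb]
    split_ifs
    · exact isHermitian_sum fun l _ => layerTerm_isHermitian hh.isHermitian l
    · exact layerTerm_isHermitian hh.isHermitian _
  have hbn : ∀ k, 1 ≤ k → ‖b k‖ ≤ 4 * J := fun k hk => by
    simp only [hb, if_neg (show k ≠ 0 by omega)]
    exact norm_layerTerm_le hJ.le hh.norm_le (hfib k (by omega))
  have hbb : ∀ j k, j + 2 ≤ k → Commute (b k) (b j) := fun j k hjk =>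
    commute_of_disjoint (Finset.disjoint_left.2 fun i hi hi' => by
      simp only [Finset.mem_filter, Finset.mem_univ, true_and] at hi hi'
      omega) (hbsupp' k (by omega)) (hbsupp j)
  have hbA : ∀ k, 2 ≤ k → Commute (b k) A := fun k hk =>
    commute_of_disjoint (Finset.disjoint_left.2 fun i hi hi' => by
      simp only [Finset.mem_filter, Finset.mem_univ, true_and] at hi
      have := (hl0 i).2 hi'
      omega) (hbsupp' k (by omega)) hA
  -- `M` bounds all layer numbers, so the terms beyond it vanish; `D` more of them only make the
  -- range long enough to contain the first `D` terms.
  have hsum : ∑ k ∈ Finset.range (M + 1 + D), b k = hamiltonian h := by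
    rw [← sum_layerTerm (h := h) (lo := -(M : ℤ)) (hi := (M : ℤ) + D) (fun j => (hM j).1)
      (fun j => by have := (hM j).2; omega)]
    have e : Finset.Icc (-(M : ℤ)) (M + D) = Finset.Icc (-(M : ℤ)) 0 ∪
        (Finset.range (M + D)).image fun k : ℕ => (k : ℤ) + 1 := by
      ext k
      simp only [Finset.mem_Icc, Finset.mem_union, Finset.mem_image, Finset.mem_range]
      constructor
      · intro hk
        by_cases h0 : k ≤ 0
        · exact Or.inl ⟨hk.1, h0⟩
        · exact Or.inr ⟨(k - 1).toNat, by omega, by omega⟩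
      · rintro (hk | ⟨l, hl, rfl⟩) <;> omega
    rw [e, Finset.sum_union, Finset.sum_image, show M + 1 + D = M + D + 1 by ring,
      Finset.sum_range_succ', add_comm]
    · congr 1
    · intro x _ y _ hxy
      simpa using hxy
    · rw [Finset.disjoint_left]
      intro k hk hk'
      simp only [Finset.mem_Icc, Finset.mem_image, Finset.mem_range] at hk hk'
      obtain ⟨l, _, rfl⟩ := hk'
      omega
  have hBsub : Commute B (heisenberg (∑ k ∈ Finset.range (D - 1 + 1), b k) A t) := by
    refine heisenberg_commute (Commute.sum_right _ _ _ fun k hk => ?_) ?_ t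
    · refine (commute_of_disjoint ?_ (hbsupp k) hB).symm
      rw [Finset.disjoint_left]
      intro i hi hi'
      simp only [Finset.mem_filter, Finset.mem_univ, true_and, Finset.mem_range] at hi hk
      have := hDY i hi'
      omega
    · exact (commute_of_disjoint hd hA hB).symm
  have hmain := norm_heisenberg_sub_le b A (by positivity : 0 ≤ 4 * J) hbsa hbn hbb hbA (D - 1)
    (M + 1) ht
  rw [show D - 1 + 1 + (M + 1) = M + 1 + D by omega, hsum] at hmain
  set τ := heisenberg (∑ k ∈ Finset.range (D - 1 + 1), b k) A t
  have e : evolve (hamiltonian h) A t * B - B * evolve (hamiltonian h) A t =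
      -((τ - heisenberg (hamiltonian h) A t) * B - B * (τ - heisenberg (hamiltonian h) A t)) := by
    rw [evolve_eq_heisenberg, sub_mul, mul_sub, hBsub.eq]
    abel
  rw [e, norm_neg]
  refine (norm_commutator_le _ _).trans ?_
  have h3 : (2 * (4 * J) * Real.exp 1 * t - (((D - 1 : ℕ) : ℝ) + 1)) =
      -1 * ((D : ℝ) - 8 * Real.exp 1 * J * t) := by
    rw [Nat.cast_sub (by omega)]; push_cast; ring
  rw [h3] at hmain
  calc _ ≤ 2 * (‖A‖ * Real.exp (-1 * ((D : ℝ) - 8 * Real.exp 1 * J * t))) * ‖B‖ := by gcongr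
    _ = _ := by ring

/-- Lieb–Robinson bound with a velocity proportional to the interaction strength. -/
theorem isSoundVelocity_hamiltonian {bc : Boundary} [NeZero N] {J : ℝ} {h : Fin N → Obs N d}
    (hh : IsNearestNeighbour bc J h) :
    IsSoundVelocity bc (hamiltonian h) (8 * Real.exp 1 * J) 1 2 := by
  refine isSoundVelocity_of_nonneg_time fun a n Y hd A B hA hB t ht =>
    ⟨norm_commutator_evolve_le hh hd hA hB ht, ?_⟩
  have := norm_commutator_evolve_le (isNearestNeighbour_neg hh) hd hA hB ht
  rwa [show hamiltonian (fun j => -h j) = -hamiltonian h by simp [hamiltonian]] at this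

end LiebRobinson

end SpinChain

/-! ### Conjugation by exponentials -/

namespace SpinChain

section Conjugation

open NormedSpace

variable {𝔸 : Type*} [NormedRing 𝔸] [NormedAlgebra ℝ 𝔸]

/-- The commutator with `A`, as a continuous linear map. -/
noncomputable def adL (A : 𝔸) : 𝔸 →L[ℝ] 𝔸 :=
  ContinuousLinearMap.mul ℝ 𝔸 A - (ContinuousLinearMap.mul ℝ 𝔸).flip A

theorem adL_apply (A Y : 𝔸) : adL A Y = A * Y - Y * A := rfl

variable [CompleteSpace 𝔸]

/-- u(s) = exp(s ad A) b solves u' = [A, u], so exp(-sA) u(s) exp(sA) has derivative zero. -/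
theorem exp_mul_mul_exp_eq (A b : 𝔸) (s : ℝ) :
    exp (s • A) * b * exp (-(s • A)) = exp (s • adL A) b := by
  set u : ℝ → 𝔸 := fun s => exp (s • adL A) b with hu
  have hud : ∀ s, HasDerivAt u (adL A (u s)) s := fun s => by
    have h := hasDerivAt_exp_smul_const' (𝕂 := ℝ) (adL A) s
    exact h.clm_apply (hasDerivAt_const s b) |>.congr_deriv (by simp [hu])
  have hw : ∀ s, HasDerivAt (fun s : ℝ => exp (-(s • A)) * u s * exp (s • A)) 0 s := fun s => by
    have h1 : HasDerivAt (fun s : ℝ => exp (-(s • A))) (exp (s • -A) * -A) s := by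
      simpa only [smul_neg] using hasDerivAt_exp_smul_const (𝕂 := ℝ) (-A) s
    have h2 := hasDerivAt_exp_smul_const' (𝕂 := ℝ) A s
    refine ((h1.mul (hud s)).mul h2).congr_deriv ?_
    simp only [Pi.mul_apply, adL_apply, smul_neg]
    noncomm_ring
  have hc := is_const_of_deriv_eq_zero (fun s => (hw s).differentiableAt) (fun s => (hw s).deriv) s 0
  have h1 : exp (s • A) * exp (-(s • A)) = 1 := by
    let := NormedAlgebra.restrictScalars ℚ ℝ 𝔸
    rw [← exp_add_of_commute ((Commute.refl _).neg_right), add_neg_cancel, exp_zero]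
  simp only [zero_smul, neg_zero, exp_zero, one_mul, mul_one] at hc
  rw [show u 0 = b by
    have h0 : (0 : ℝ) • adL A = 0 := by ext; simp
    simp only [hu, h0, exp_zero]; rfl] at hc
  calc exp (s • A) * b * exp (-(s • A))
      = (exp (s • A) * exp (-(s • A))) * u s * (exp (s • A) * exp (-(s • A))) := by
        rw [← hc]; noncomm_ring
    _ = u s := by rw [h1, one_mul, mul_one]

/-- Nested commutators on a chain grow like n!, which the exponential series cancels. At the
parameter 1/(4g) what remains is a geometric series of ratio 1/2 with sum 2g. -/
theorem norm_exp_conj_le {A b : 𝔸} {g : ℝ} (hg : 0 < g)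
    (h : ∀ n : ℕ, ‖((adL A) ^ n) b‖ ≤ (2 * g) ^ n * n.factorial * g) :
    ‖exp ((4 * g)⁻¹ • A) * b * exp (-((4 * g)⁻¹ • A))‖ ≤ 2 * g := by
  rw [exp_mul_mul_exp_eq]
  have hs := (exp_series_hasSum_exp' (𝕂 := ℝ) ((4 * g)⁻¹ • adL A)).mapL
    (ContinuousLinearMap.apply ℝ 𝔸 b)
  have hgeo : HasSum (fun n : ℕ => (1 / 2 : ℝ) ^ n * g) (2 * g) := by
    simpa using (hasSum_geometric_two).mul_right g
  refine hs.norm_le_of_bounded hgeo fun n => ?_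
  have hp : (((4 * g)⁻¹ • adL A) ^ n) b = (4 * g)⁻¹ ^ n • ((adL A) ^ n) b := by
    induction n with
    | zero => simp
    | succ n ih =>
      rw [pow_succ', pow_succ' (adL A), pow_succ']
      change (4 * g)⁻¹ • adL A ((((4 * g)⁻¹ • adL A) ^ n) b) = _ • adL A (((adL A) ^ n) b)
      rw [ih, map_smul, smul_smul]
  change ‖(n.factorial : ℝ)⁻¹ • (((4 * g)⁻¹ • adL A) ^ n) b‖ ≤ _
  rw [hp, smul_smul, norm_smul, Real.norm_of_nonneg (by positivity), mul_assoc]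
  calc ((n.factorial : ℝ))⁻¹ * ((4 * g)⁻¹ ^ n * ‖((adL A) ^ n) b‖)
      ≤ ((n.factorial : ℝ))⁻¹ * ((4 * g)⁻¹ ^ n * ((2 * g) ^ n * n.factorial * g)) := by
        gcongr; exact h n
    _ = (1 / 2) ^ n * g := by
        have h1 : (n.factorial : ℝ) ≠ 0 := by positivity
        rw [show (1 / 2 : ℝ) = (4 * g)⁻¹ * (2 * g) by field_simp; norm_num,
          mul_comm ((n.factorial : ℝ)⁻¹)]
        calc _ = (4 * g)⁻¹ ^ n * (2 * g) ^ n * g * (n.factorial * (n.factorial : ℝ)⁻¹) := by ring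
          _ = _ := by rw [mul_inv_cancel₀ h1, mul_one, mul_pow (4 * g)⁻¹]

end Conjugation

/-! ### Functions of an operator on its eigenbasis -/

section Eigenbasis

open Polynomial

variable {E : Type*} [NormedAddCommGroup E] [InnerProductSpace ℂ E]

local notation "⟪" x ", " y "⟫" => inner ℂ x y

theorem exists_eigenbasis [FiniteDimensional ℂ E] [CompleteSpace E] {T : E →L[ℂ] E}
    (hT : IsSelfAdjoint T) :
    ∃ (b : OrthonormalBasis (Fin (Module.finrank ℂ E)) ℂ E) (x : Fin (Module.finrank ℂ E) → ℝ),
      ∀ i, T (b i) = (x i : ℂ) • b i := by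
  have h := ContinuousLinearMap.isSelfAdjoint_iff_isSymmetric.1 hT
  exact ⟨h.eigenvectorBasis rfl, h.eigenvalues rfl, fun i => h.apply_eigenvectorBasis rfl i⟩

theorem pow_apply_eigen {T : E →L[ℂ] E} {v : E} {x : ℝ} (h : T v = (x : ℂ) • v) (n : ℕ) :
    (T ^ n) v = ((x ^ n : ℝ) : ℂ) • v := by
  induction n with
  | zero => simp
  | succ n ih =>
    rw [pow_succ', mul_apply_eq_comp, ih, map_smul, h, smul_smul, pow_succ]
    push_cast; rfl

theorem aeval_apply_eigen {T : E →L[ℂ] E} {v : E} {x : ℝ} (h : T v = (x : ℂ) • v) (p : ℝ[X]) :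
    aeval T p v = ((p.eval x : ℝ) : ℂ) • v := by
  rw [aeval_eq_sum_range, eval_eq_sum_range, sum_apply, Complex.ofReal_sum, Finset.sum_smul]
  refine Finset.sum_congr rfl fun i _ => ?_
  change (p.coeff i) • (T ^ i) v = _
  rw [pow_apply_eigen h, ← Complex.coe_smul, smul_smul]
  push_cast; rfl

theorem exp_apply_eigen [CompleteSpace E] {T : E →L[ℂ] E} {v : E} {x : ℝ}
    (h : T v = (x : ℂ) • v) : NormedSpace.exp T v = ((Real.exp x : ℝ) : ℂ) • v := by
  have h1 := (NormedSpace.exp_series_hasSum_exp' (𝕂 := ℂ) T).mapL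
    (ContinuousLinearMap.apply ℂ E v)
  have h2 := (NormedSpace.exp_series_hasSum_exp' (𝕂 := ℝ) x).mapL Complex.ofRealCLM
  rw [← Real.exp_eq_exp_ℝ] at h2
  refine h1.unique ((h2.smul_const v).congr_fun fun n => ?_)
  change ((n.factorial : ℂ)⁻¹) • (T ^ n) v = _
  rw [pow_apply_eigen h, smul_smul]
  simp

theorem isSelfAdjoint_aeval [CompleteSpace E] {T : E →L[ℂ] E} (hT : IsSelfAdjoint T) (p : ℝ[X]) :
    IsSelfAdjoint (aeval T p) := by
  rw [aeval_eq_sum_range]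
  refine isSelfAdjoint_sum _ fun i _ => ?_
  rw [← Complex.coe_smul, IsSelfAdjoint, star_smul, (hT.pow i).star_eq, Complex.star_def,
    Complex.conj_ofReal]

theorem commute_aeval {T S : E →L[ℂ] E} (h : Commute T S) (p : ℝ[X]) : Commute (aeval T p) S := by
  rw [aeval_eq_sum_range]
  exact Commute.sum_left _ _ _ fun i _ => (h.pow_left i).smul_left _

variable {ι : Type*} [Fintype ι] (b : OrthonormalBasis ι ℂ E) {T : E →L[ℂ] E} {x : ι → ℝ}

theorem inner_apply_eigenbasis (hT : ∀ i, T (b i) = (x i : ℂ) • b i) (v : E) (i : ι) :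
    ⟪b i, T v⟫ = x i * ⟪b i, v⟫ := by
  classical
  conv_lhs => rw [← b.sum_repr v, map_sum, inner_sum]
  simp_rw [map_smul, hT, inner_smul_right, b.inner_eq_ite]
  simp [b.repr_apply_apply, mul_comm]

theorem re_inner_apply_eigenbasis (hT : ∀ i, T (b i) = (x i : ℂ) • b i) (v : E) :
    (⟪v, T v⟫).re = ∑ i, x i * ‖⟪b i, v⟫‖ ^ 2 := by
  rw [← b.sum_inner_mul_inner v (T v), Complex.re_sum]
  refine Finset.sum_congr rfl fun i _ => ?_
  rw [inner_apply_eigenbasis b hT, ← inner_conj_symm v (b i)]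
  rw [show (starRingEnd ℂ) ⟪b i, v⟫ * (x i * ⟪b i, v⟫) =
    x i * ((starRingEnd ℂ) ⟪b i, v⟫ * ⟪b i, v⟫) by ring, Complex.conj_mul', Complex.re_ofReal_mul]
  norm_cast

theorem norm_sq_apply_eigenbasis (hT : ∀ i, T (b i) = (x i : ℂ) • b i) (v : E) :
    ‖T v‖ ^ 2 = ∑ i, x i ^ 2 * ‖⟪b i, v⟫‖ ^ 2 := by
  rw [← b.sum_sq_norm_inner_right (T v)]
  refine Finset.sum_congr rfl fun i _ => ?_
  rw [inner_apply_eigenbasis b hT, norm_mul, mul_pow]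
  simp

/-- On a finite spectrum every function of an operator is a polynomial in it. Cutoffs and spectral
projections written this way keep the support of the observable. -/
theorem exists_polynomial_eval (x : ι → ℝ) (f : ℝ → ℝ) : ∃ p : ℝ[X], ∀ i, p.eval (x i) = f (x i) := by
  classical
  refine ⟨Lagrange.interpolate (Finset.univ.image x) id f, fun i => ?_⟩
  exact Lagrange.eval_interpolate_at_node f Function.injective_id.injOn
    (Finset.mem_image_of_mem x (Finset.mem_univ i))

end Eigenbasis

end SpinChain

/-! ### Truncating the energies of the two ends -/

namespace SpinChain

section Truncation

open Polynomial

variable {E : Type*} [NormedAddCommGroup E] [InnerProductSpace ℂ E]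

local notation "⟪" x ", " y "⟫" => inner ℂ x y

theorem re_inner_smul_self (x : ℝ) (v : E) : (⟪v, (x : ℂ) • v⟫).re = x * ‖v‖ ^ 2 := by
  rw [inner_smul_right, Complex.re_ofReal_mul]
  congr 1
  exact inner_self_eq_norm_sq (𝕜 := ℂ) v

theorem abs_re_inner_apply_le {T : E →L[ℂ] E} {c : ℝ} (h : ‖T‖ ≤ c) (v : E) :
    |(⟪v, T v⟫).re| ≤ c * ‖v‖ ^ 2 := by
  calc |(⟪v, T v⟫).re| ≤ ‖⟪v, T v⟫‖ := Complex.abs_re_le_norm _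
    _ ≤ ‖v‖ * ‖T v‖ := norm_inner_le_norm _ _
    _ ≤ ‖v‖ * (c * ‖v‖) := by
      gcongr; exact (T.le_opNorm v).trans (by gcongr)
    _ = _ := by ring

variable {ι : Type*} [Fintype ι] (b : OrthonormalBasis ι ℂ E)

theorem commute_of_eigenbasis {S T : E →L[ℂ] E} {x y : ι → ℝ}
    (hS : ∀ i, S (b i) = (x i : ℂ) • b i) (hT : ∀ i, T (b i) = (y i : ℂ) • b i) : Commute S T := by
  ext v
  refine b.toBasis.ext_elem_iff.2 fun i => ?_
  rw [b.coe_toBasis_repr_apply, b.coe_toBasis_repr_apply, b.repr_apply_apply, b.repr_apply_apply,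
    mul_apply_eq_comp, mul_apply_eq_comp, inner_apply_eigenbasis b hS, inner_apply_eigenbasis b hT,
    inner_apply_eigenbasis b hT, inner_apply_eigenbasis b hS]
  ring

/-- Exponential decay of the weight of a low-lying eigenvector at high energies of a part `A` of the
system, when `A` is coupled to the rest by a single term `B`. -/
theorem sum_exp_mul_le [CompleteSpace E] {A R B F : E →L[ℂ] E} {x f : ι → ℝ} {g e en : ℝ} {Φ : E}
    (hA : ∀ i, A (b i) = (x i : ℂ) • b i) (hF : ∀ i, F (b i) = (f i : ℂ) • b i)
    (hAR : Commute A R) (hg : 0 < g) (he : ∀ i, e ≤ x i)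
    (hf : ∀ i, min (x i) (e + 7 * g) ≤ f i)
    (hR : ∀ v, (en - e - 4 * g) * ‖v‖ ^ 2 ≤ (⟪v, R v⟫).re)
    (hB : ‖NormedSpace.exp ((4 * g)⁻¹ • A) * B * NormedSpace.exp (-((4 * g)⁻¹ • A))‖ ≤ 2 * g)
    (hΦ : ‖Φ‖ = 1) (hG : (F + R + B) Φ = (en : ℂ) • Φ) :
    ∑ i, Real.exp ((x i - e) / (2 * g)) * ‖⟪b i, Φ⟫‖ ^ 2 ≤ 7 * Real.exp (7 / 2) := by
  set W := NormedSpace.exp ((4 * g)⁻¹ • A) with hW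
  set V := NormedSpace.exp (-((4 * g)⁻¹ • A)) with hV
  have hWb : ∀ i, W (b i) = ((Real.exp ((4 * g)⁻¹ * x i) : ℝ) : ℂ) • b i := fun i =>
    exp_apply_eigen (by
      change (4 * g)⁻¹ • A (b i) = _
      rw [hA, ← Complex.coe_smul, smul_smul]; push_cast; rfl)
  have hVW : V * W = 1 := by
    let := NormedAlgebra.restrictScalars ℚ ℂ (E →L[ℂ] E)
    rw [hV, hW, ← NormedSpace.exp_add_of_commute ((Commute.refl _).neg_left), neg_add_cancel,
      NormedSpace.exp_zero]
  have hWR : Commute W R := (hAR.smul_left _).exp_left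
  have hWF : Commute W F := commute_of_eigenbasis b hWb hF
  set y := W Φ with hy
  -- Conjugation with `W` changes only the coupling `B`, whose conjugate has norm at most 2g. With
  -- the lower bound on `R`, the mean of `F` in y is then at most e + 6g.
  have h1 : F y + R y + (W * B * V) y = (en : ℂ) • y := by
    have h2 := congrArg W hG
    rw [map_smul] at h2
    rw [← h2]
    change F (W Φ) + R (W Φ) + (W * B * V) (W Φ) = W (F Φ + R Φ + B Φ)
    rw [map_add, map_add]
    have e1 : F (W Φ) = W (F Φ) := (congrArg (fun T : E →L[ℂ] E => T Φ) hWF.eq).symm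
    have e2 : R (W Φ) = W (R Φ) := (congrArg (fun T : E →L[ℂ] E => T Φ) hWR.eq).symm
    have e3 : (W * B * V) (W Φ) = W (B Φ) := by
      change W (B ((V * W) Φ)) = W (B Φ)
      rw [hVW]; rfl
    rw [e1, e2, e3]
  have h2 : (⟪y, F y⟫).re + (⟪y, R y⟫).re + (⟪y, (W * B * V) y⟫).re = en * ‖y‖ ^ 2 := by
    rw [← re_inner_smul_self, ← h1, inner_add_right, inner_add_right, Complex.add_re,
      Complex.add_re]
  have h3 : (⟪y, F y⟫).re ≤ (e + 6 * g) * ‖y‖ ^ 2 := by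
    have := hR y
    have := (abs_le.1 (abs_re_inner_apply_le hB y)).1
    linarith
  rw [re_inner_apply_eigenbasis b hF, ← b.sum_sq_norm_inner_right y, Finset.mul_sum] at h3
  have hyi : ∀ i, ‖⟪b i, y⟫‖ ^ 2 = Real.exp (e / (2 * g)) *
      (Real.exp ((x i - e) / (2 * g)) * ‖⟪b i, Φ⟫‖ ^ 2) := fun i => by
    rw [hy, inner_apply_eigenbasis b hWb, norm_mul, mul_pow, Complex.norm_real,
      Real.norm_of_nonneg (Real.exp_pos _).le, ← Real.exp_nat_mul,
      ← mul_assoc (Real.exp (e / (2 * g))), ← Real.exp_add]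
    congr 2
    field_simp
    push_cast
    ring
  set w : ι → ℝ := fun i => Real.exp ((x i - e) / (2 * g)) * ‖⟪b i, Φ⟫‖ ^ 2 with hw
  have h4 : ∑ i, (f i - e - 6 * g) * w i ≤ 0 := by
    have h5 : Real.exp (e / (2 * g)) * ∑ i, (f i - e - 6 * g) * w i ≤ 0 := by
      rw [Finset.mul_sum]
      rw [← sub_nonpos, ← Finset.sum_sub_distrib] at h3
      refine le_of_eq_of_le (Finset.sum_congr rfl fun i _ => ?_) h3
      rw [hyi]
      simp only [hw]
      ring
    by_contra! hc
    exact absurd h5 (not_le.2 (mul_pos (Real.exp_pos _) hc))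
  -- Above e + 7g the factor f - e - 6g is at least g. Below it the factor is at least -6g, and w is
  -- at most exp(7/2) times the bare weight, so adding 7g exp(7/2) times that weight suffices.
  have h6 : ∀ i, g * w i ≤ (f i - e - 6 * g) * w i + 7 * g * Real.exp (7 / 2) * ‖⟪b i, Φ⟫‖ ^ 2 := by
    intro i
    have hw0 : 0 ≤ w i := by positivity
    rcases le_total (e + 7 * g) (x i) with hx | hx
    · have := hf i
      rw [min_eq_right hx] at this
      have h7 : 0 ≤ 7 * g * Real.exp (7 / 2) * ‖⟪b i, Φ⟫‖ ^ 2 := by positivity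
      nlinarith
    · have := hf i
      rw [min_eq_left hx] at this
      have hexp : w i ≤ Real.exp (7 / 2) * ‖⟪b i, Φ⟫‖ ^ 2 := by
        refine mul_le_mul_of_nonneg_right (Real.exp_le_exp.2 ?_) (by positivity)
        rw [div_le_div_iff₀ (by positivity) (by positivity)]
        linarith
      have h8 : 0 ≤ (f i - e) * w i := mul_nonneg (by linarith [he i]) hw0
      nlinarith
  have h7 := Finset.sum_le_sum fun i (_ : i ∈ Finset.univ) => h6 i
  rw [Finset.sum_add_distrib, ← Finset.mul_sum, ← Finset.mul_sum, b.sum_sq_norm_inner_right,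
    hΦ] at h7
  have h9 : g * ∑ i, w i ≤ g * (7 * Real.exp (7 / 2)) := by linarith
  exact le_of_mul_le_mul_left h9 hg

/-- The cutoff removes 2gs with s = (x - e - t)/(2g) when s ≥ 0. Since s and s² are at most exp(s),
the exponential weights control the mean and the square of the error. -/
theorem truncation_error {A F : E →L[ℂ] E} {x f : ι → ℝ} {g e t C : ℝ} {Φ : E}
    (hA : ∀ i, A (b i) = (x i : ℂ) • b i) (hF : ∀ i, F (b i) = (f i : ℂ) • b i) (hg : 0 < g)
    (hf : ∀ i, f i = min (x i) (e + t))
    (hC : ∑ i, Real.exp ((x i - e) / (2 * g)) * ‖⟪b i, Φ⟫‖ ^ 2 ≤ C) :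
    (⟪Φ, (A - F) Φ⟫).re ≤ 2 * g * C * Real.exp (-t / (2 * g)) ∧
      ‖(A - F) Φ‖ ^ 2 ≤ 4 * g ^ 2 * C * Real.exp (-t / (2 * g)) := by
  have hD : ∀ i, (A - F) (b i) = ((x i - f i : ℝ) : ℂ) • b i := fun i => by
    change A (b i) - F (b i) = _
    rw [hA, hF, ← sub_smul]; push_cast; rfl
  have key : ∀ i, 0 ≤ x i - f i ∧ (x i - f i) ^ 2 ≤ 4 * g ^ 2 *
        (Real.exp (-t / (2 * g)) * Real.exp ((x i - e) / (2 * g))) ∧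
      x i - f i ≤ 2 * g * (Real.exp (-t / (2 * g)) * Real.exp ((x i - e) / (2 * g))) := by
    intro i
    rw [hf, ← Real.exp_add, ← add_div]
    rcases le_total (x i) (e + t) with h | h
    · rw [min_eq_left h, sub_self]
      refine ⟨le_rfl, ?_, by positivity⟩
      rw [zero_pow two_ne_zero]; positivity
    · rw [min_eq_right h]
      set s := (-t + (x i - e)) / (2 * g) with hs
      have hs0 : 0 ≤ s := div_nonneg (by linarith) (by positivity)
      have hxs : x i - (e + t) = 2 * g * s := by rw [hs]; field_simp; ring
      have h1 : s ≤ Real.exp (s / 2) := by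
        have := Real.quadratic_le_exp_of_nonneg (by linarith : 0 ≤ s / 2)
        nlinarith [sq_nonneg (s - 2)]
      have h2 : s ^ 2 ≤ Real.exp s := by
        calc s ^ 2 ≤ Real.exp (s / 2) ^ 2 := by gcongr
          _ = Real.exp s := by rw [← Real.exp_nat_mul]; congr 1; push_cast; ring
      have h3 : s ≤ Real.exp s := (Real.add_one_le_exp s).trans' (by linarith)
      rw [hxs]
      refine ⟨by positivity, ?_, by gcongr⟩
      calc (2 * g * s) ^ 2 = 4 * g ^ 2 * s ^ 2 := by ring
        _ ≤ _ := by gcongr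
  constructor
  · rw [re_inner_apply_eigenbasis b hD]
    calc _ ≤ ∑ i, 2 * g * Real.exp (-t / (2 * g)) *
          (Real.exp ((x i - e) / (2 * g)) * ‖⟪b i, Φ⟫‖ ^ 2) := Finset.sum_le_sum fun i _ => by
            calc _ ≤ _ := mul_le_mul_of_nonneg_right (key i).2.2 (sq_nonneg _)
              _ = _ := by ring
      _ = 2 * g * Real.exp (-t / (2 * g)) * _ := (Finset.mul_sum _ _ _).symm
      _ ≤ 2 * g * Real.exp (-t / (2 * g)) * C := by gcongr
      _ = _ := by ring
  · rw [norm_sq_apply_eigenbasis b hD]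
    calc _ ≤ ∑ i, 4 * g ^ 2 * Real.exp (-t / (2 * g)) *
          (Real.exp ((x i - e) / (2 * g)) * ‖⟪b i, Φ⟫‖ ^ 2) := Finset.sum_le_sum fun i _ => by
            calc _ ≤ _ := mul_le_mul_of_nonneg_right (key i).2.1 (sq_nonneg _)
              _ = _ := by ring
      _ = 4 * g ^ 2 * Real.exp (-t / (2 * g)) * _ := (Finset.mul_sum _ _ _).symm
      _ ≤ 4 * g ^ 2 * Real.exp (-t / (2 * g)) * C := by gcongr
      _ = _ := by ring

end Truncation

end SpinChain

namespace SpinChain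

section Truncation

open Polynomial

variable {E : Type*} [NormedAddCommGroup E] [InnerProductSpace ℂ E]

local notation "⟪" x ", " y "⟫" => inner ℂ x y

theorem le_re_inner_of_eigenvalues {ι : Type*} [Fintype ι] (b : OrthonormalBasis ι ℂ E)
    {T : E →L[ℂ] E} {x : ι → ℝ} (hT : ∀ i, T (b i) = (x i : ℂ) • b i) {c : ℝ} (h : ∀ i, c ≤ x i)
    (v : E) : c * ‖v‖ ^ 2 ≤ (⟪v, T v⟫).re := by
  rw [re_inner_apply_eigenbasis b hT, ← b.sum_sq_norm_inner_right v, Finset.mul_sum]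
  exact Finset.sum_le_sum fun i _ => mul_le_mul_of_nonneg_right (h i) (sq_nonneg _)

theorem re_inner_le_of_eigenvalues {ι : Type*} [Fintype ι] (b : OrthonormalBasis ι ℂ E)
    {T : E →L[ℂ] E} {x : ι → ℝ} (hT : ∀ i, T (b i) = (x i : ℂ) • b i) {c : ℝ} (h : ∀ i, x i ≤ c)
    (v : E) : (⟪v, T v⟫).re ≤ c * ‖v‖ ^ 2 := by
  rw [re_inner_apply_eigenbasis b hT, ← b.sum_sq_norm_inner_right v, Finset.mul_sum]
  exact Finset.sum_le_sum fun i _ => mul_le_mul_of_nonneg_right (h i) (sq_nonneg _)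

theorem eigenvalue_eq_re_inner {ι : Type*} [Fintype ι] (b : OrthonormalBasis ι ℂ E)
    {T : E →L[ℂ] E} {x : ι → ℝ} (hT : ∀ i, T (b i) = (x i : ℂ) • b i) (i : ι) :
    x i = (⟪b i, T (b i)⟫).re := by
  rw [hT, re_inner_smul_self, b.norm_eq_one]; ring

variable [CompleteSpace E]

/-- Seen from one end, the rest of the chain has energy at least eM - g + e', which with the bound
on `en` gives the 4g in `sum_exp_mul_le`. `F` and `F'` may be truncated or not, so the estimate
serves both Hamiltonians and, by reflection, both ends. -/
theorem sum_exp_mul_le_of_chain {ι : Type*} [Fintype ι] (b : OrthonormalBasis ι ℂ E)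
    {A F B M B' F' : E →L[ℂ] E} {x f : ι → ℝ} {g e eM e' en : ℝ} {Φ : E}
    (hA : ∀ i, A (b i) = (x i : ℂ) • b i) (hF : ∀ i, F (b i) = (f i : ℂ) • b i) (hg : 0 < g)
    (hAM : Commute A M) (hAB' : Commute A B') (hAF' : Commute A F') (he : ∀ i, e ≤ x i)
    (hf : ∀ i, min (x i) (e + 7 * g) ≤ f i) (hM : ∀ v, eM * ‖v‖ ^ 2 ≤ (⟪v, M v⟫).re)
    (hB' : ‖B'‖ ≤ g) (hF' : ∀ v, e' * ‖v‖ ^ 2 ≤ (⟪v, F' v⟫).re)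
    (hen : en ≤ e + eM + e' + 3 * g)
    (hB : ‖NormedSpace.exp ((4 * g)⁻¹ • A) * B * NormedSpace.exp (-((4 * g)⁻¹ • A))‖ ≤ 2 * g)
    (hΦ : ‖Φ‖ = 1) (hG : (F + B + M + B' + F') Φ = (en : ℂ) • Φ) :
    ∑ i, Real.exp ((x i - e) / (2 * g)) * ‖⟪b i, Φ⟫‖ ^ 2 ≤ 7 * Real.exp (7 / 2) := by
  refine sum_exp_mul_le b (R := M + B' + F') hA hF ((hAM.add_right hAB').add_right hAF') hg he hf
    (fun v => ?_) hB hΦ (by rw [← hG]; congr 1; abel)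
  have h1 := hM v
  have h2 := hF' v
  have h3 := (abs_le.1 (abs_re_inner_apply_le hB' v)).1
  change _ ≤ (⟪v, M v + B' v + F' v⟫).re
  rw [inner_add_right, inner_add_right, Complex.add_re, Complex.add_re]
  have : (en - e - 4 * g) * ‖v‖ ^ 2 ≤ (eM - g + e') * ‖v‖ ^ 2 :=
    mul_le_mul_of_nonneg_right (by linarith) (sq_nonneg _)
  linarith

/-- Cutting off the energies of the two ends of a gapped chain preserves the gap and hardly changes
the ground state. -/
theorem exists_truncation [FiniteDimensional ℂ E] {AL BL M BR AR : E →L[ℂ] E}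
    {g ε t eL eM eR m E₀ : ℝ} {Ω : E}
    (hAL : IsSelfAdjoint AL) (hBL : IsSelfAdjoint BL) (hM : IsSelfAdjoint M)
    (hBR : IsSelfAdjoint BR) (hAR : IsSelfAdjoint AR)
    (hg : 0 < g) (hε : 0 < ε) (hεg : ε ≤ g) (ht : 7 * g ≤ t)
    (hALM : Commute AL M) (hALBR : Commute AL BR) (hALAR : Commute AL AR)
    (hARM : Commute AR M) (hARBL : Commute AR BL)
    (hcL : ‖NormedSpace.exp ((4 * g)⁻¹ • AL) * BL * NormedSpace.exp (-((4 * g)⁻¹ • AL))‖ ≤ 2 * g)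
    (hcR : ‖NormedSpace.exp ((4 * g)⁻¹ • AR) * BR * NormedSpace.exp (-((4 * g)⁻¹ • AR))‖ ≤ 2 * g)
    (hnL : ‖BL‖ ≤ g) (hnR : ‖BR‖ ≤ g) (hnM : ‖M‖ ≤ m)
    (heL : ∀ v, eL * ‖v‖ ^ 2 ≤ (⟪v, AL v⟫).re) (heM : ∀ v, eM * ‖v‖ ^ 2 ≤ (⟪v, M v⟫).re)
    (heR : ∀ v, eR * ‖v‖ ^ 2 ≤ (⟪v, AR v⟫).re) (hE : E₀ ≤ eL + eM + eR + 2 * g)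
    (hΩ : ‖Ω‖ = 1) (hΩE : (AL + BL + M + BR + AR) Ω = (E₀ : ℂ) • Ω)
    (hgap : ∀ u, E₀ * ‖u‖ ^ 2 + ε * (‖u‖ ^ 2 - ‖⟪Ω, u⟫‖ ^ 2) ≤
      (⟪u, (AL + BL + M + BR + AR) u⟫).re)
    (hsmall : 16 * g * (7 * Real.exp (7 / 2)) * Real.exp (-t / (2 * g)) < ε) :
    ∃ (pL pR : ℝ[X]) (u₀ : E) (e₀ : ℝ), ‖u₀‖ = 1 ∧
      (aeval AL pL + BL + M + BR + aeval AR pR) u₀ = (e₀ : ℂ) • u₀ ∧ e₀ ≤ E₀ ∧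
      (∀ (q : ℝ[X]) (θ : ℝ), 0 ≤ θ → (∀ x, E₀ + ε / 4 ≤ x →
          x ≤ E₀ + ε / 4 + (2 * t + 2 * m + 4 * g) → |q.eval x| ≤ θ) → ∀ v, ⟪u₀, v⟫ = 0 →
          ⟪u₀, aeval (aeval AL pL + BL + M + BR + aeval AR pR) q v⟫ = 0 ∧
          ‖aeval (aeval AL pL + BL + M + BR + aeval AR pR) q v‖ ≤ θ * ‖v‖) ∧
      ‖Ω - ⟪u₀, Ω⟫ • u₀‖ ^ 2 ≤
        256 * g ^ 2 * (7 * Real.exp (7 / 2)) * Real.exp (-t / (2 * g)) / ε ^ 2 := by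
  obtain ⟨bL, xL, hbL⟩ := exists_eigenbasis hAL
  obtain ⟨bR, xR, hbR⟩ := exists_eigenbasis hAR
  -- The cutoffs of the spectra at height t above the minimum, as polynomials in the operators of
  -- the ends.
  obtain ⟨pL, hpL⟩ := exists_polynomial_eval xL fun x => min x (eL + t)
  obtain ⟨pR, hpR⟩ := exists_polynomial_eval xR fun x => min x (eR + t)
  have hxL : ∀ i, eL ≤ xL i := fun i => by
    rw [eigenvalue_eq_re_inner bL hbL]; simpa using heL (bL i)
  have hxR : ∀ i, eR ≤ xR i := fun i => by
    rw [eigenvalue_eq_re_inner bR hbR]; simpa using heR (bR i)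
  set FL := aeval AL pL with hFL
  set FR := aeval AR pR with hFR
  have hfL : ∀ i, FL (bL i) = ((min (xL i) (eL + t) : ℝ) : ℂ) • bL i := fun i => by
    rw [hFL, aeval_apply_eigen (hbL i), hpL]
  have hfR : ∀ i, FR (bR i) = ((min (xR i) (eR + t) : ℝ) : ℂ) • bR i := fun i => by
    rw [hFR, aeval_apply_eigen (hbR i), hpR]
  have ht0 : 0 ≤ t := by linarith
  have hFLge := le_re_inner_of_eigenvalues bL hfL (c := eL) fun i => le_min (hxL i) (by linarith)
  have hFRge := le_re_inner_of_eigenvalues bR hfR (c := eR) fun i => le_min (hxR i) (by linarith)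
  have hFLle := re_inner_le_of_eigenvalues bL hfL fun i => min_le_right _ _
  have hFRle := re_inner_le_of_eigenvalues bR hfR fun i => min_le_right _ _
  set C : ℝ := 7 * Real.exp (7 / 2) with hC
  set η := Real.exp (-t / (2 * g)) with hη
  have hFLsa : IsSelfAdjoint FL := isSelfAdjoint_aeval hAL pL
  have hFRsa : IsSelfAdjoint FR := isSelfAdjoint_aeval hAR pR
  set H := AL + BL + M + BR + AR with hH
  set T := FL + BL + M + BR + FR with hT
  have hTsa : IsSelfAdjoint T := (((hFLsa.add hBL).add hM).add hBR).add hFRsa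
  have hHT : ∀ v, H v = T v + (AL - FL) v + (AR - FR) v := fun v => by
    have : H = T + (AL - FL) + (AR - FR) := by rw [hH, hT]; abel
    rw [this]; rfl
  have hinner : ∀ v, (⟪v, H v⟫).re =
      (⟪v, T v⟫).re + (⟪v, (AL - FL) v⟫).re + (⟪v, (AR - FR) v⟫).re := fun v => by
    rw [hHT, inner_add_right, inner_add_right, Complex.add_re, Complex.add_re]
  have hgapL : ∀ i, min (xL i) (eL + 7 * g) ≤ min (xL i) (eL + t) := fun i =>
    min_le_min_left _ (by linarith)
  have hgapR : ∀ i, min (xR i) (eR + 7 * g) ≤ min (xR i) (eR + t) := fun i =>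
    min_le_min_left _ (by linarith)
  -- truncation errors for low-lying eigenvectors of the truncated operator and for the ground state
  have errT : ∀ (u : E) (en : ℝ), ‖u‖ = 1 → T u = (en : ℂ) • u → en ≤ E₀ + g →
      (⟪u, (AL - FL) u⟫).re ≤ 2 * g * C * η ∧ (⟪u, (AR - FR) u⟫).re ≤ 2 * g * C * η := by
    intro u en hu hTu hen
    have h1 := sum_exp_mul_le_of_chain bL (F' := FR) hbL hfL hg hALM hALBR
      (commute_aeval hALAR.symm pR).symm hxL hgapL heM hnR hFRge (by linarith) hcL hu hTu
    have h2 := sum_exp_mul_le_of_chain bR (F' := FL) (B' := BL) (M := M) (B := BR) (F := FR)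
      (en := en) hbR hfR hg hARM hARBL (commute_aeval hALAR pL).symm hxR hgapR heM hnL hFLge
      (by linarith) hcR hu (by rw [← hTu, hT]; congr 1; abel)
    exact ⟨(truncation_error bL hbL hfL hg (fun i => rfl) h1).1,
      (truncation_error bR hbR hfR hg (fun i => rfl) h2).1⟩
  have errH : ‖(AL - FL) Ω‖ ^ 2 ≤ 4 * g ^ 2 * C * η ∧ ‖(AR - FR) Ω‖ ^ 2 ≤ 4 * g ^ 2 * C * η := by
    have h1 := sum_exp_mul_le_of_chain bL (F' := AR) hbL hbL hg hALM hALBR hALAR hxL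
      (fun i => min_le_left _ _) heM hnR heR (by linarith) hcL hΩ hΩE
    have h2 := sum_exp_mul_le_of_chain bR (F' := AL) (B' := BL) (M := M) (B := BR) (F := AR)
      (en := E₀) hbR hbR hg hARM hARBL hALAR.symm hxR (fun i => min_le_left _ _) heM hnL heL
      (by linarith) hcR hΩ (by rw [← hΩE, hH]; congr 1; abel)
    exact ⟨(truncation_error bL hbL hfL hg (fun i => rfl) h1).2,
      (truncation_error bR hbR hfR hg (fun i => rfl) h2).2⟩
  obtain ⟨b, x, hb⟩ := exists_eigenbasis hTsa
  have hΩsum : ∑ i, ‖⟪b i, Ω⟫‖ ^ 2 = 1 := by rw [b.sum_sq_norm_inner_right, hΩ, one_pow]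
  have hne : Nonempty (Fin (Module.finrank ℂ E)) := by
    by_contra hc
    rw [not_nonempty_iff] at hc
    rw [Fintype.sum_empty] at hΩsum
    exact zero_ne_one hΩsum
  obtain ⟨i₀, hi₀⟩ := Finite.exists_min x
  have hdiff : ∀ v, 0 ≤ (⟪v, (AL - FL) v⟫).re ∧ 0 ≤ (⟪v, (AR - FR) v⟫).re := fun v => by
    have h1 : ∀ i, (AL - FL) (bL i) = ((xL i - min (xL i) (eL + t) : ℝ) : ℂ) • bL i := fun i => by
      change AL (bL i) - FL (bL i) = _
      rw [hbL, hfL, ← sub_smul]; push_cast; rfl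
    have h2 : ∀ i, (AR - FR) (bR i) = ((xR i - min (xR i) (eR + t) : ℝ) : ℂ) • bR i := fun i => by
      change AR (bR i) - FR (bR i) = _
      rw [hbR, hfR, ← sub_smul]; push_cast; rfl
    have h3 := le_re_inner_of_eigenvalues bL h1 (c := 0)
      (fun i => sub_nonneg.2 (min_le_left _ _)) v
    have h4 := le_re_inner_of_eigenvalues bR h2 (c := 0)
      (fun i => sub_nonneg.2 (min_le_left _ _)) v
    rw [zero_mul] at h3 h4
    exact ⟨h3, h4⟩
  have hx₀ : x i₀ ≤ E₀ := by
    have h1 := le_re_inner_of_eigenvalues b hb hi₀ Ω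
    have h2 := hinner Ω
    rw [hΩE, re_inner_smul_self, hΩ] at h2
    rw [hΩ] at h1
    linarith [(hdiff Ω).1, (hdiff Ω).2]
  -- Undoing the truncation costs less than ε/4 by `hsmall`, so the mean of `H` in such an
  -- eigenvector is below E₀ + ε/2, and the gap of `H` forces more than half of its weight onto Ω.
  have hov : ∀ i, x i ≤ E₀ + ε / 4 → 1 / 2 < ‖⟪b i, Ω⟫‖ ^ 2 := fun i hi => by
    have h1 := errT (b i) (x i) (b.norm_eq_one i) (hb i) (by linarith)
    have h2 := hgap (b i)
    rw [hinner, ← eigenvalue_eq_re_inner b hb, b.norm_eq_one, norm_inner_symm] at h2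
    by_contra! hc
    have : ε * ‖⟪b i, Ω⟫‖ ^ 2 ≤ ε * (1 / 2) := by gcongr
    linarith [h1.1, h1.2]
  -- Two orthogonal unit vectors cannot both carry more than half of the weight of Ω.
  have hgapT : ∀ i, i ≠ i₀ → E₀ + ε / 4 < x i := fun i hi => by
    by_contra! hc
    have h1 := hov i hc
    have h2 := hov i₀ (by linarith)
    have h3 : ∑ j ∈ {i, i₀}, ‖⟪b j, Ω⟫‖ ^ 2 ≤ ∑ j, ‖⟪b j, Ω⟫‖ ^ 2 :=
      Finset.sum_le_sum_of_subset_of_nonneg (Finset.subset_univ _) fun _ _ _ => sq_nonneg _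
    rw [Finset.sum_pair hi, hΩsum] at h3
    linarith
  have hup : ∀ i, x i ≤ E₀ + ε / 4 + (2 * t + 2 * m + 4 * g) := fun i => by
    have h1 : x i ≤ eL + eR + 2 * t + m + 2 * g := by
      rw [eigenvalue_eq_re_inner b hb]
      have e : (⟪b i, T (b i)⟫).re = (⟪b i, FL (b i)⟫).re + (⟪b i, BL (b i)⟫).re +
          (⟪b i, M (b i)⟫).re + (⟪b i, BR (b i)⟫).re + (⟪b i, FR (b i)⟫).re := by
        rw [← Complex.add_re, ← inner_add_right, ← Complex.add_re, ← inner_add_right,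
          ← Complex.add_re, ← inner_add_right, ← Complex.add_re, ← inner_add_right]
        rfl
      have a1 := hFLle (b i)
      have a2 := hFRle (b i)
      have a3 := (abs_le.1 (abs_re_inner_apply_le hnL (b i))).2
      have a4 := (abs_le.1 (abs_re_inner_apply_le hnR (b i))).2
      have a5 := (abs_le.1 (abs_re_inner_apply_le hnM (b i))).2
      rw [b.norm_eq_one] at a1 a2 a3 a4 a5
      linarith
    have h2 : eL + eR - m - 2 * g ≤ E₀ := by
      have e : (⟪Ω, H Ω⟫).re = (⟪Ω, AL Ω⟫).re + (⟪Ω, BL Ω⟫).re +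
          (⟪Ω, M Ω⟫).re + (⟪Ω, BR Ω⟫).re + (⟪Ω, AR Ω⟫).re := by
        rw [← Complex.add_re, ← inner_add_right, ← Complex.add_re, ← inner_add_right,
          ← Complex.add_re, ← inner_add_right, ← Complex.add_re, ← inner_add_right]
        rfl
      rw [hΩE, re_inner_smul_self] at e
      have a1 := heL Ω
      have a2 := heR Ω
      have a3 := (abs_le.1 (abs_re_inner_apply_le hnL Ω)).1
      have a4 := (abs_le.1 (abs_re_inner_apply_le hnR Ω)).1
      have a5 := (abs_le.1 (abs_re_inner_apply_le hnM Ω)).1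
      rw [hΩ] at a1 a2 a3 a4 a5 e
      linarith
    linarith
  refine ⟨pL, pR, b i₀, x i₀, b.norm_eq_one i₀, hb i₀, hx₀, fun q θ hθ hq v hv => ?_, ?_⟩
  · have hqb : ∀ i, aeval T q (b i) = ((q.eval (x i) : ℝ) : ℂ) • b i := fun i =>
      aeval_apply_eigen (hb i) q
    refine ⟨by rw [inner_apply_eigenbasis b hqb, hv, mul_zero], ?_⟩
    rw [← sq_le_sq₀ (norm_nonneg _) (by positivity), norm_sq_apply_eigenbasis b hqb, mul_pow,
      ← b.sum_sq_norm_inner_right v, Finset.mul_sum]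
    refine Finset.sum_le_sum fun i _ => ?_
    by_cases hi : i = i₀
    · rw [hi, hv]; simp
    · refine mul_le_mul_of_nonneg_right ?_ (sq_nonneg _)
      rw [← sq_abs]
      exact pow_le_pow_left₀ (abs_nonneg _) (hq _ (hgapT i hi).le (hup i)) 2
  -- (T - E₀)Ω consists of truncation errors only, while |x i - E₀| ≥ ε/4 off u₀; this bounds the
  -- part of Ω orthogonal to u₀.
  · have hTE : ∀ i, (T - (E₀ : ℂ) • (1 : E →L[ℂ] E)) (b i) = ((x i - E₀ : ℝ) : ℂ) • b i := fun i => by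
      change T (b i) - (E₀ : ℂ) • b i = _
      rw [hb, ← sub_smul]; push_cast; rfl
    have h1 : (T - (E₀ : ℂ) • (1 : E →L[ℂ] E)) Ω = -((AL - FL) Ω + (AR - FR) Ω) := by
      change T Ω - (E₀ : ℂ) • Ω = _
      rw [← hΩE, hHT]; abel
    have h2 : ‖(T - (E₀ : ℂ) • (1 : E →L[ℂ] E)) Ω‖ ^ 2 ≤ 16 * g ^ 2 * C * η := by
      rw [h1, norm_neg]
      have h3 := norm_add_le ((AL - FL) Ω) ((AR - FR) Ω)
      have h4 := sq_nonneg (‖(AL - FL) Ω‖ - ‖(AR - FR) Ω‖)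
      nlinarith [errH.1, errH.2, norm_nonneg ((AL - FL) Ω + (AR - FR) Ω),
        norm_nonneg ((AL - FL) Ω), norm_nonneg ((AR - FR) Ω)]
    rw [norm_sq_apply_eigenbasis b hTE] at h2
    rw [le_div_iff₀ (by positivity), ← b.sum_sq_norm_inner_right, Finset.sum_mul]
    calc ∑ i, ‖⟪b i, Ω - ⟪b i₀, Ω⟫ • b i₀⟫‖ ^ 2 * ε ^ 2
        ≤ ∑ i, 16 * ((x i - E₀) ^ 2 * ‖⟪b i, Ω⟫‖ ^ 2) := by
          refine Finset.sum_le_sum fun i _ => ?_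
          rw [inner_sub_right, inner_smul_right]
          by_cases hi : i = i₀
          · rw [hi, inner_self_eq_norm_sq_to_K, b.norm_eq_one]
            simp
            positivity
          · rw [b.inner_eq_zero hi, mul_zero, sub_zero]
            have h5 := hgapT i hi
            have h6 : ε ^ 2 ≤ 16 * (x i - E₀) ^ 2 := by nlinarith
            calc _ ≤ ‖⟪b i, Ω⟫‖ ^ 2 * (16 * (x i - E₀) ^ 2) := by gcongr
              _ = _ := by ring
      _ = 16 * ∑ i, (x i - E₀) ^ 2 * ‖⟪b i, Ω⟫‖ ^ 2 := (Finset.mul_sum _ _ _).symm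
      _ ≤ _ := by linarith

end Truncation

end SpinChain

/-! ### Chebyshev polynomials -/

namespace SpinChain

section Chebyshev

open Polynomial

/-- T_l(cosh φ) = cosh(lφ). From exp(δ/2) ≤ 1 + δ ≤ cosh φ ≤ exp(φ²/2) one gets φ ≥ √δ. -/
theorem exp_mul_sqrt_le_eval_chebyshev {δ y : ℝ} (hδ0 : 0 ≤ δ) (hδ1 : δ ≤ 1) (hy : 1 + δ ≤ y)
    (l : ℕ) : Real.exp (l * √δ) / 2 ≤ (Chebyshev.T ℝ l).eval y := by
  obtain ⟨φ, hφ0, hφ⟩ : ∃ φ : ℝ, 0 ≤ φ ∧ Real.cosh φ = y :=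
    ⟨Real.arcosh y, Real.arcosh_nonneg (by linarith), Real.cosh_arcosh (by linarith)⟩
  have h1 : √δ ≤ φ := by
    refine Real.sqrt_le_iff.2 ⟨hφ0, ?_⟩
    have h2 : Real.exp (δ / 2) ≤ Real.exp (φ ^ 2 / 2) := by
      calc Real.exp (δ / 2) ≤ 1 / (1 - δ / 2) :=
            Real.exp_bound_div_one_sub_of_interval (by linarith) (by linarith)
        _ ≤ 1 + δ := by rw [div_le_iff₀ (by linarith)]; nlinarith
        _ ≤ y := hy
        _ ≤ _ := by rw [← hφ]; exact Real.cosh_le_exp_half_sq φ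
    have := Real.exp_le_exp.1 h2
    linarith
  rw [← hφ, Chebyshev.T_real_cosh, Real.cosh_eq]
  have h3 : Real.exp (l * √δ) ≤ Real.exp (l * φ) :=
    Real.exp_le_exp.2 (mul_le_mul_of_nonneg_left h1 (Nat.cast_nonneg l))
  have := Real.exp_pos (-(((l : ℤ) : ℝ) * φ))
  push_cast at *
  linarith

/-- A polynomial that is small on an interval and `1` at a point below it. -/
theorem exists_polynomial_small_on_interval {a w γ e₀ : ℝ} (hγ : 0 < γ) (hw : 2 * γ ≤ w)
    (he : e₀ ≤ a - γ) (l : ℕ) :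
    ∃ q : ℝ[X], q.natDegree ≤ l ∧ q.eval e₀ = 1 ∧
      ∀ x, a ≤ x → x ≤ a + w → |q.eval x| ≤ 2 * Real.exp (-(l * √(2 * γ / w))) := by
  have hw0 : 0 < w := by linarith
  -- The affine map that takes [a, a + w] to [-1, 1] reversing the order; points at or below a - γ
  -- go to 1 + 2γ/w or beyond.
  set y : ℝ[X] := C ((2 * a + w) / w) - C (2 / w) * X with hy
  have hye : ∀ x, y.eval x = (2 * a + w - 2 * x) / w := fun x => by
    rw [hy]; simp; ring
  set τ := (Chebyshev.T ℝ l).eval (y.eval e₀) with hτ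
  have hτ1 : Real.exp (l * √(2 * γ / w)) / 2 ≤ τ := by
    refine exp_mul_sqrt_le_eval_chebyshev (by positivity) ((div_le_one hw0).2 hw) ?_ l
    rw [hye, le_div_iff₀ hw0, add_mul, div_mul_cancel₀ _ hw0.ne']
    linarith
  have hτ0 : 0 < τ := lt_of_lt_of_le (by positivity) hτ1
  refine ⟨C τ⁻¹ * (Chebyshev.T ℝ l).comp y, ?_, ?_, fun x hx1 hx2 => ?_⟩
  · refine (natDegree_C_mul_le _ _).trans (natDegree_comp_le.trans ?_)
    have h1 : (Chebyshev.T ℝ l).natDegree ≤ l := by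
      have := Chebyshev.natDegree_T ℝ (l : ℤ)
      simp only [Int.natAbs_natCast] at this
      exact this.le
    have h2 : y.natDegree ≤ 1 := by
      rw [hy]
      refine (natDegree_sub_le _ _).trans (max_le (by simp) ?_)
      exact (natDegree_C_mul_le _ _).trans natDegree_X_le
    calc _ ≤ l * 1 := Nat.mul_le_mul h1 h2
      _ = l := mul_one l
  · rw [eval_mul, eval_C, eval_comp, ← hτ, inv_mul_cancel₀ hτ0.ne']
  · rw [eval_mul, eval_C, eval_comp, abs_mul, abs_of_pos (inv_pos.2 hτ0)]
    have h1 : |(Chebyshev.T ℝ l).eval (y.eval x)| ≤ 1 := by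
      refine Chebyshev.abs_eval_T_real_le_one _ ?_
      rw [hye, abs_le, le_div_iff₀ hw0, div_le_iff₀ hw0]
      constructor <;> linarith
    calc τ⁻¹ * _ ≤ τ⁻¹ * 1 := by gcongr
      _ ≤ (Real.exp (l * √(2 * γ / w)) / 2)⁻¹ * 1 := by gcongr
      _ = _ := by rw [Real.exp_neg, inv_div]; field_simp

end Chebyshev

end SpinChain

/-! ### Operator Schmidt rank across a cut -/

namespace SpinChain

section OperatorRank

variable {N d : ℕ} {X : Finset (Fin N)} {O O' : Obs N d} {r r' : ℕ}

/-- `O` is a sum of at most `r` products of observables on `X` and off `X`. -/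
def OpRank (X : Finset (Fin N)) (r : ℕ) (O : Obs N d) : Prop :=
  ∃ (ι : Type) (_ : Fintype ι) (A B : ι → Obs N d), Fintype.card ι ≤ r ∧ (∀ i, A i ∈ supp X) ∧
    (∀ i, B i ∈ supp Xᶜ) ∧ O = ∑ i, A i * B i

theorem OpRank.mono (h : OpRank X r O) (hr : r ≤ r') : OpRank X r' O := by
  obtain ⟨ι, _, A, B, hc, hA, hB, rfl⟩ := h
  exact ⟨ι, _, A, B, hc.trans hr, hA, hB, rfl⟩

theorem opRank_mul_mem {A B : Obs N d} (hA : A ∈ supp X) (hB : B ∈ supp Xᶜ) :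
    OpRank X 1 (A * B) :=
  ⟨Unit, inferInstance, fun _ => A, fun _ => B, by simp, fun _ => hA, fun _ => hB, by simp⟩

theorem opRank_zero : OpRank (d := d) X r 0 :=
  ⟨Empty, inferInstance, fun _ => 0, fun _ => 0, by simp, by simp, by simp, by simp⟩

theorem OpRank.smul (h : OpRank X r O) (c : ℂ) : OpRank X r (c • O) := by
  obtain ⟨ι, _, A, B, hc, hA, hB, rfl⟩ := h
  exact ⟨ι, _, fun i => c • A i, B, hc, fun i => (supp X).smul_mem (hA i) c, hB, by
    simp [Finset.smul_sum]⟩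

theorem OpRank.sum {κ : Type} (s : Finset κ) {O : κ → Obs N d} (h : ∀ k ∈ s, OpRank X r (O k)) :
    OpRank X (s.card * r) (∑ k ∈ s, O k) := by
  classical
  have h' : ∀ k : s, OpRank X r (O k) := fun k => h k k.2
  choose ι hι A B hc hA hB hO using h'
  refine ⟨Σ k, ι k, inferInstance, fun p => A p.1 p.2, fun p => B p.1 p.2, ?_,
    fun p => hA _ _, fun p => hB _ _, ?_⟩
  · rw [Fintype.card_sigma]
    calc _ ≤ ∑ _ : s, r := Finset.sum_le_sum fun k _ => hc k
      _ = _ := by simp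
  · rw [← Finset.sum_coe_sort, Fintype.sum_sigma]
    exact Finset.sum_congr rfl fun k _ => hO k

theorem OpRank.mul (h : OpRank X r O) (h' : OpRank X r' O') : OpRank X (r * r') (O * O') := by
  obtain ⟨ι, _, A, B, hc, hA, hB, rfl⟩ := h
  obtain ⟨κ, _, A', B', hc', hA', hB', rfl⟩ := h'
  refine ⟨ι × κ, inferInstance, fun p => A p.1 * A' p.2, fun p => B p.1 * B' p.2, ?_,
    fun p => (supp X).mul_mem (hA _) (hA' _), fun p => (supp Xᶜ).mul_mem (hB _) (hB' _), ?_⟩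
  · rw [Fintype.card_prod]
    exact Nat.mul_le_mul hc hc'
  · rw [Fintype.sum_mul_sum, Fintype.sum_prod_type]
    refine Finset.sum_congr rfl fun i _ => Finset.sum_congr rfl fun j _ => ?_
    have hcomm : A' j * B i = B i * A' j :=
      (commute_of_disjoint (Finset.disjoint_left.2 fun x hx hx' => by simp [hx] at hx')
        (hA' j) (hB i)).eq
    calc A i * B i * (A' j * B' j) = A i * (B i * A' j) * B' j := by noncomm_ring
      _ = A i * (A' j * B i) * B' j := by rw [hcomm]
      _ = _ := by noncomm_ring

theorem card_config_prod (Z : Finset (Fin N)) :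
    Fintype.card (Config Z d × Config Z d) = d ^ (2 * Z.card) := by
  rw [Fintype.card_prod, Fintype.card_fun, Fintype.card_fin, Fintype.card_coe, ← pow_add]
  ring_nf

/-- Expand in the matrix units of the sites of `T` inside `X`; there are at most d^(2n) of them. -/
theorem opRank_of_mem_supp {T : Finset (Fin N)} (hd : 1 ≤ d) (hO : O ∈ supp T) {n : ℕ}
    (hn : (T ∩ X).card ≤ n) : OpRank X (d ^ (2 * n)) O := by
  have hT : O ∈ supp (T ∩ X ∪ T \ X) := by
    rwa [Finset.union_comm, Finset.sdiff_union_inter]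
  obtain ⟨P, Q, hP, hQ, hO⟩ := exists_sum_mul_of_mem_supp_union
    (Finset.disjoint_left.2 fun i hi hi' => (Finset.mem_sdiff.1 hi').2 (Finset.mem_inter.1 hi).2) hT
  refine ⟨_, inferInstance, P, Q, ?_, fun k => supp_mono Finset.inter_subset_right (hP k),
    fun k => supp_mono (fun i hi => Finset.mem_compl.2 (Finset.mem_sdiff.1 hi).2) (hQ k), hO⟩
  rw [card_config_prod]
  exact Nat.pow_le_pow_right hd (by omega)

/-- Moving the cut to a larger set. -/
theorem OpRank.of_subset {X' : Finset (Fin N)} (hd : 1 ≤ d) (h : OpRank X r O) (hX : X ⊆ X')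
    {n : ℕ} (hn : (X' \ X).card ≤ n) : OpRank X' (r * d ^ (2 * n)) O := by
  obtain ⟨ι, _, A, B, hc, hA, hB, rfl⟩ := h
  refine OpRank.mono (OpRank.sum Finset.univ (r := 1 * d ^ (2 * n)) fun i _ => ?_)
    (by rw [one_mul]; exact Nat.mul_le_mul_right _ hc)
  refine OpRank.mul ?_ (opRank_of_mem_supp hd (hB i) (le_trans (Finset.card_le_card ?_) hn))
  · rw [← mul_one (A i)]
    exact opRank_mul_mem (supp_mono hX (hA i)) (supp _).one_mem
  · intro j hj
    rw [Finset.mem_inter, Finset.mem_compl] at hj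
    exact Finset.mem_sdiff.2 ⟨hj.2, hj.1⟩

theorem OpRank.compl (h : OpRank X r O) : OpRank Xᶜ r O := by
  obtain ⟨ι, _, A, B, hc, hA, hB, rfl⟩ := h
  refine ⟨ι, _, B, A, hc, hB, by simpa using hA, Finset.sum_congr rfl fun i _ => ?_⟩
  exact (commute_of_disjoint (Finset.disjoint_left.2 fun x hx hx' => by simp [hx] at hx')
    (hA i) (hB i)).eq

/-- Moving the cut to a smaller set. -/
theorem OpRank.of_superset {X' : Finset (Fin N)} (hd : 1 ≤ d) (h : OpRank X r O) (hX : X' ⊆ X)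
    {n : ℕ} (hn : (X \ X').card ≤ n) : OpRank X' (r * d ^ (2 * n)) O := by
  have := (h.compl.of_subset (X' := X'ᶜ) hd (Finset.compl_subset_compl.2 hX) (n := n) (by
    refine le_trans (Finset.card_le_card fun j hj => ?_) hn
    simp only [Finset.mem_sdiff, Finset.mem_compl, not_not] at hj ⊢
    exact ⟨hj.2, hj.1⟩)).compl
  rwa [compl_compl] at this

end OperatorRank

/-! ### Expanding powers by the occurrences of one bond -/

section BondExpansion

/-- The coefficient of `z ^ k` in `(A + z b) ^ n`. -/
def bondCoeff {R : Type*} [Semiring R] (A b : R) : ℕ → ℕ → R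
  | 0, 0 => 1
  | 0, _ + 1 => 0
  | n + 1, 0 => bondCoeff A b n 0 * A
  | n + 1, k + 1 => bondCoeff A b n (k + 1) * A + bondCoeff A b n k * b

theorem bondCoeff_eq_zero {R : Type*} [Semiring R] (A b : R) {n k : ℕ} (h : n < k) :
    bondCoeff A b n k = 0 := by
  induction n generalizing k with
  | zero =>
    obtain ⟨k, rfl⟩ := Nat.exists_eq_succ_of_ne_zero h.ne'
    rfl
  | succ n ih =>
    obtain ⟨k, rfl⟩ := Nat.exists_eq_succ_of_ne_zero (by omega : k ≠ 0)
    rw [bondCoeff, ih (by omega), ih (by omega), zero_mul, zero_mul, add_zero]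

theorem bondCoeff_zero_right {R : Type*} [Semiring R] (A b : R) (n : ℕ) :
    bondCoeff A b n 0 = A ^ n := by
  induction n with
  | zero => rw [pow_zero, bondCoeff]
  | succ n ih => rw [bondCoeff, ih, pow_succ]

theorem add_smul_pow_eq_sum {R : Type*} [Ring R] [Algebra ℂ R] (A b : R) (z : ℂ) (n : ℕ) :
    (A + z • b) ^ n = ∑ k ∈ Finset.range (n + 1), z ^ k • bondCoeff A b n k := by
  induction n with
  | zero => simp [bondCoeff]
  | succ n ih =>
    rw [pow_succ, ih, Finset.sum_range_succ' _ (n + 1), mul_add, Finset.sum_mul, Finset.sum_mul]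
    have e : ∀ k, z ^ (k + 1) • bondCoeff A b (n + 1) (k + 1) =
        (z ^ (k + 1) • bondCoeff A b n (k + 1)) * A + (z ^ k • bondCoeff A b n k) * (z • b) :=
      fun k => by
        rw [bondCoeff, smul_add, smul_mul_assoc, smul_mul_smul_comm, ← pow_succ]
    simp_rw [e]
    rw [Finset.sum_add_distrib]
    have e2 : ∑ k ∈ Finset.range (n + 1), (z ^ k • bondCoeff A b n k) * A =
        ∑ k ∈ Finset.range (n + 1), (z ^ (k + 1) • bondCoeff A b n (k + 1)) * A +
          bondCoeff A b n 0 * A := by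
      have := Finset.sum_range_succ' (fun k => (z ^ k • bondCoeff A b n k) * A) (n + 1)
      rw [Finset.sum_range_succ, bondCoeff_eq_zero A b (Nat.lt_succ_self n), smul_zero, zero_mul,
        add_zero] at this
      rw [this]; simp
    rw [e2, pow_zero, one_smul, bondCoeff]
    abel

/-- Each word is split at its last factor b. -/
theorem bondCoeff_succ_right {R : Type*} [Semiring R] (A b : R) (n k : ℕ) :
    bondCoeff A b n (k + 1) =
      ∑ m ∈ Finset.range n, bondCoeff A b m k * b * A ^ (n - 1 - m) := by
  induction n with
  | zero => simp [bondCoeff]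
  | succ n ih =>
    rw [bondCoeff, ih, Finset.sum_range_succ, Finset.sum_mul]
    congr 1
    · refine Finset.sum_congr rfl fun m hm => ?_
      have := Finset.mem_range.1 hm
      rw [mul_assoc, ← pow_succ, show n - 1 - m + 1 = n + 1 - 1 - m by omega]
    · simp

variable {N d : ℕ} {X : Finset (Fin N)}

/-- Without a bond across the cut the two sides commute, and the binomial theorem leaves n + 1
products. -/
theorem opRank_pow_add {P Q : Obs N d} (hP : P ∈ supp X) (hQ : Q ∈ supp Xᶜ) (n : ℕ) :
    OpRank X (n + 1) ((P + Q) ^ n) := by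
  have hc : Commute P Q := commute_of_disjoint
    (Finset.disjoint_left.2 fun x hx hx' => by simp [hx] at hx') hP hQ
  rw [hc.add_pow]
  refine OpRank.mono (OpRank.sum _ (r := 1) fun k _ => ?_) (by simp)
  rw [← nsmul_eq_mul', ← Nat.cast_smul_eq_nsmul ℂ]
  exact (opRank_mul_mem ((supp X).pow_mem hP k) ((supp Xᶜ).pow_mem hQ _)).smul _

/-- Between successive occurrences of the bond there are powers of rank at most l + 1. Each further
occurrence costs a factor D for the bond, l + 1 for its position and l + 1 for the power that
follows. -/
theorem opRank_bondCoeff {P Q b : Obs N d} (hP : P ∈ supp X) (hQ : Q ∈ supp Xᶜ) {D l : ℕ}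
    (hb : OpRank X D b) (k : ℕ) : ∀ n ≤ l,
    OpRank X ((l + 1) * ((l + 1) ^ 2 * D) ^ k) (bondCoeff (P + Q) b n k) := by
  induction k with
  | zero =>
    intro n hn
    rw [bondCoeff_zero_right, pow_zero, mul_one]
    exact (opRank_pow_add hP hQ n).mono (by omega)
  | succ k ih =>
    intro n hn
    rw [bondCoeff_succ_right]
    refine OpRank.mono (OpRank.sum _
      (r := (l + 1) * ((l + 1) ^ 2 * D) ^ k * D * (l + 1)) fun m hm => ?_) ?_
    · have := Finset.mem_range.1 hm
      exact ((ih m (by omega)).mul hb).mul ((opRank_pow_add hP hQ _).mono (by omega))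
    · rw [Finset.card_range]
      calc _ ≤ (l + 1) * ((l + 1) * ((l + 1) ^ 2 * D) ^ k * D * (l + 1)) :=
            Nat.mul_le_mul_right _ (by omega)
        _ = _ := by ring

end BondExpansion

end SpinChain

/-! ### Counting the occurrences of several bonds by interpolation -/

namespace SpinChain

section Interpolation

/-- Extraction of the coefficients of a polynomial of degree at most `l` from its values at the
points `0, …, l`. -/
theorem exists_interpolation (l : ℕ) : ∃ w : Fin (l + 1) → Fin (l + 1) → ℂ,
    (∀ k m : Fin (l + 1), ∑ j : Fin (l + 1), w k j * (j : ℂ) ^ (m : ℕ) = if k = m then 1 else 0) ∧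
    ∀ i j : Fin (l + 1), ∑ k : Fin (l + 1), (i : ℂ) ^ (k : ℕ) * w k j = if i = j then 1 else 0 := by
  set V : Matrix (Fin (l + 1)) (Fin (l + 1)) ℂ := Matrix.vandermonde fun j => (j : ℂ) with hV
  have hdet : IsUnit V.det := by
    refine isUnit_iff_ne_zero.2 (Matrix.det_vandermonde_ne_zero_iff.2 fun i j hij => ?_)
    exact Fin.ext (by exact_mod_cast hij)
  refine ⟨fun k j => V⁻¹ k j, fun k m => ?_, fun i j => ?_⟩
  · have := congrFun (congrFun (Matrix.nonsing_inv_mul V hdet) k) m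
    rwa [Matrix.mul_apply, Matrix.one_apply] at this
  · have := congrFun (congrFun (Matrix.mul_nonsing_inv V hdet) i) j
    rwa [Matrix.mul_apply, Matrix.one_apply] at this

variable {R : Type*} [Ring R] [Algebra ℂ R] {S : ℕ}

/-- Only the bound on the total degree matters: it makes the coefficients of monomials of degree
above n vanish. -/
theorem exists_monomial_expansion (A : R) (b : Fin S → R) (n : ℕ) :
    ∃ (ι : Type) (_ : Fintype ι) (m : ι → Fin S → ℕ) (M : ι → R), (∀ a, ∑ i, m a i ≤ n) ∧
      ∀ z : Fin S → ℂ, (A + ∑ i, z i • b i) ^ n = ∑ a, (∏ i, z i ^ m a i) • M a := by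
  induction n with
  | zero => exact ⟨Unit, inferInstance, fun _ _ => 0, fun _ => 1, by simp, by simp⟩
  | succ n ih =>
    obtain ⟨ι, _, m, M, hm, hM⟩ := ih
    refine ⟨ι × Option (Fin S), inferInstance,
      fun p i => m p.1 i + (match p.2 with | none => 0 | some j => if i = j then 1 else 0),
      fun p => M p.1 * (match p.2 with | none => A | some j => b j), fun p => ?_, fun z => ?_⟩
    · obtain ⟨a, _ | j⟩ := p
      · have := hm a
        simp only [add_zero]; omega
      · rw [Finset.sum_add_distrib]
        have := hm a
        simp only [Finset.sum_ite_eq', Finset.mem_univ, if_true]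
        omega
    · rw [pow_succ, hM, Fintype.sum_prod_type, Finset.sum_mul]
      refine Finset.sum_congr rfl fun a _ => ?_
      rw [Fintype.sum_option, mul_add, Finset.mul_sum]
      congr 1
      · simp
      · refine Finset.sum_congr rfl fun j _ => ?_
        rw [smul_mul_smul_comm]
        congr 1
        simp_rw [pow_add]
        rw [Finset.prod_mul_distrib]
        congr 1
        simp [pow_ite]

/-- The terms of `(A + ∑ i, b i) ^ n` that contain `c i` factors `b i`, by interpolation. -/
noncomputable def letterCount {l : ℕ} (w : Fin (l + 1) → Fin (l + 1) → ℂ) (A : R) (b : Fin S → R)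
    (n : ℕ) (c : Fin S → Fin (l + 1)) : R :=
  ∑ z : Fin S → Fin (l + 1), (∏ i, w (c i) (z i)) • (A + ∑ i, ((z i : ℕ) : ℂ) • b i) ^ n

variable {l : ℕ} {w : Fin (l + 1) → Fin (l + 1) → ℂ}

theorem sum_letterCount
    (hw : ∀ i j : Fin (l + 1), ∑ k : Fin (l + 1), (i : ℂ) ^ (k : ℕ) * w k j = if i = j then 1 else 0)
    (hl : 1 ≤ l) (A : R) (b : Fin S → R) (n : ℕ) :
    ∑ c, letterCount w A b n c = (A + ∑ i, b i) ^ n := by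
  -- The sum of the coefficients is the value at the node 1, which is among the nodes because l ≥ 1.
  have h1 : ∀ j : Fin (l + 1), ∑ k, w k j = if (⟨1, by omega⟩ : Fin (l + 1)) = j then 1 else 0 :=
    fun j => by rw [← hw]; simp
  unfold letterCount
  rw [Finset.sum_comm]
  have h2 : ∀ z : Fin S → Fin (l + 1), ∑ c : Fin S → Fin (l + 1), (∏ i, w (c i) (z i)) =
      if (fun _ => ⟨1, by omega⟩) = z then 1 else 0 := fun z => by
    rw [← Fintype.prod_sum fun i k => w k (z i)]
    simp_rw [h1]
    rw [Fintype.prod_ite_zero]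
    simp [funext_iff]
  simp_rw [← Finset.sum_smul, h2, ite_smul, zero_smul, one_smul]
  rw [Finset.sum_ite_eq, if_pos (Finset.mem_univ _)]
  simp

theorem letterCount_eq_zero
    (hw : ∀ k m : Fin (l + 1), ∑ j : Fin (l + 1), w k j * (j : ℂ) ^ (m : ℕ) = if k = m then 1 else 0)
    (A : R) (b : Fin S → R) {n : ℕ} (hn : n ≤ l) {c : Fin S → Fin (l + 1)}
    (hc : n < ∑ i, (c i : ℕ)) : letterCount w A b n c = 0 := by
  obtain ⟨ι, _, m, M, hm, hM⟩ := exists_monomial_expansion A b n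
  unfold letterCount
  simp_rw [hM, Finset.smul_sum, smul_smul]
  rw [Finset.sum_comm]
  refine Finset.sum_eq_zero fun a _ => ?_
  rw [← Finset.sum_smul]
  simp_rw [← Finset.prod_mul_distrib]
  rw [← Fintype.prod_sum fun i k => w (c i) k * ((k : ℕ) : ℂ) ^ m a i]
  have hml : ∀ i, m a i < l + 1 := fun i => by
    have := (Finset.single_le_sum (f := m a) (fun _ _ => Nat.zero_le _) (Finset.mem_univ i)).trans
      (hm a)
    omega
  obtain ⟨i, hi⟩ : ∃ i, (c i : ℕ) ≠ m a i := by
    by_contra! h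
    have := hm a
    rw [Finset.sum_congr rfl fun i _ => h i] at hc
    exact absurd this (not_le.2 hc)
  rw [Finset.prod_eq_zero (Finset.mem_univ i), zero_smul]
  have := hw (c i) ⟨m a i, hml i⟩
  rw [if_neg fun h => hi (congrArg Fin.val h)] at this
  exact this

/-- Interpolation is resolved in the variable of bond i only. The other bonds keep fixed numerical
strengths and merge with `A` into an operator that does not couple the two sides of bond i. -/
theorem letterCount_eq_sum_bondCoeff
    (hw : ∀ k m : Fin (l + 1), ∑ j : Fin (l + 1), w k j * (j : ℂ) ^ (m : ℕ) = if k = m then 1 else 0)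
    (A : R) (b : Fin S → R) {n : ℕ} (hn : n ≤ l) (c : Fin S → Fin (l + 1)) (i : Fin S) :
    letterCount w A b n c = ∑ z : {j // j ≠ i} → Fin (l + 1), (∏ j : {j // j ≠ i}, w (c j) (z j)) •
      bondCoeff (A + ∑ j : {j // j ≠ i}, ((z j : ℕ) : ℂ) • b j) (b i) n (c i) := by
  unfold letterCount
  rw [← (Equiv.funSplitAt i (Fin (l + 1))).symm.sum_comp, Fintype.sum_prod_type, Finset.sum_comm]
  refine Finset.sum_congr rfl fun z _ => ?_
  have hsplit : ∀ (k : Fin (l + 1)) (f : Fin S → Fin (l + 1) → ℂ),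
      ∏ j, f j ((Equiv.funSplitAt i (Fin (l + 1))).symm (k, z) j) =
        f i k * ∏ j : {j // j ≠ i}, f j (z j) := fun k f => by
    rw [Fintype.prod_eq_mul_prod_subtype_ne _ i]
    congr 1
    · simp [Equiv.funSplitAt]
    · refine Finset.prod_congr rfl fun j _ => ?_
      simp [Equiv.funSplitAt, j.2]
  have hsplit' : ∀ k : Fin (l + 1),
      A + ∑ j, (((Equiv.funSplitAt i (Fin (l + 1))).symm (k, z) j : ℕ) : ℂ) • b j =
        (A + ∑ j : {j // j ≠ i}, ((z j : ℕ) : ℂ) • b j) + ((k : ℕ) : ℂ) • b i := fun k => by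
    rw [Fintype.sum_eq_add_sum_subtype_ne _ i, add_assoc,
      add_comm (∑ j : {j // j ≠ i}, ((z j : ℕ) : ℂ) • b j)]
    congr 2
    · simp [Equiv.funSplitAt]
    · refine Finset.sum_congr rfl fun j _ => ?_
      simp [Equiv.funSplitAt, j.2]
  set A' := A + ∑ j : {j // j ≠ i}, ((z j : ℕ) : ℂ) • b j with hA'
  have e1 : ∀ k : Fin (l + 1),
      (∏ j, w (c j) ((Equiv.funSplitAt i (Fin (l + 1))).symm (k, z) j)) •
        (A + ∑ j, (((Equiv.funSplitAt i (Fin (l + 1))).symm (k, z) j : ℕ) : ℂ) • b j) ^ n =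
      (∏ j : {j // j ≠ i}, w (c j) (z j)) • ∑ m ∈ Finset.range (n + 1),
        (w (c i) k * ((k : ℕ) : ℂ) ^ m) • bondCoeff A' (b i) n m := fun k => by
    rw [hsplit k fun j => w (c j), hsplit', add_smul_pow_eq_sum, mul_comm, mul_smul,
      Finset.smul_sum]
    simp_rw [smul_smul]
  simp_rw [e1]
  rw [← Finset.smul_sum, Finset.sum_comm]
  congr 1
  simp_rw [← Finset.sum_smul]
  have e2 : ∀ m ∈ Finset.range (n + 1), (∑ k : Fin (l + 1), w (c i) k * ((k : ℕ) : ℂ) ^ m) •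
      bondCoeff A' (b i) n m = if (c i : ℕ) = m then bondCoeff A' (b i) n m else 0 := fun m hm => by
    have hml : m < l + 1 := by have := Finset.mem_range.1 hm; omega
    have := hw (c i) ⟨m, hml⟩
    simp only at this
    rw [this]
    simp only [Fin.ext_iff, ite_smul, one_smul, zero_smul]
  rw [Finset.sum_congr rfl e2, Finset.sum_ite_eq]
  split_ifs with h
  · rfl
  · rw [bondCoeff_eq_zero]
    rw [Finset.mem_range] at h
    omega

end Interpolation

variable {N d : ℕ}

/-- The operator Schmidt rank of a power of a chain Hamiltonian grows slowly, because in each term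
one of the bonds near the cut occurs rarely. -/
theorem opRank_pow {S l k D D' n : ℕ} {X : Finset (Fin N)} (Y : Fin S → Finset (Fin N))
    {A : Obs N d} {b : Fin S → Obs N d} (hl : 1 ≤ l) (hk : l < S * (k + 1)) (hD : 1 ≤ D)
    (hn : n ≤ l) (hb : ∀ i, OpRank (Y i) D (b i))
    (hsplit : ∀ (i : Fin S) (z : {j // j ≠ i} → ℂ), ∃ P ∈ supp (Y i), ∃ Q ∈ supp (Y i)ᶜ,
      A + ∑ j, z j • b j = P + Q)
    (hmove : ∀ (i : Fin S) (r : ℕ) (O : Obs N d), OpRank (Y i) r O → OpRank X (r * D') O) :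
    OpRank X ((l + 1) ^ S * ((l + 1) ^ S * ((l + 1) * ((l + 1) ^ 2 * D) ^ k * D')))
      ((A + ∑ i, b i) ^ n) := by
  obtain ⟨w, hw1, hw2⟩ := exists_interpolation l
  rw [← sum_letterCount hw2 hl]
  refine OpRank.mono (OpRank.sum _
    (r := (l + 1) ^ S * ((l + 1) * ((l + 1) ^ 2 * D) ^ k * D')) fun c _ => ?_) (by simp)
  by_cases hc : n < ∑ i, (c i : ℕ)
  · rw [letterCount_eq_zero hw1 _ _ hn hc]
    exact opRank_zero
  -- Pigeonhole: n ≤ l < S(k + 1) letters in all, so one of the S bonds occurs at most k times.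
  obtain ⟨i, hi⟩ : ∃ i, (c i : ℕ) ≤ k := by
    by_contra! h
    have : ∑ _i : Fin S, (k + 1) ≤ ∑ i, (c i : ℕ) := Finset.sum_le_sum fun i _ => h i
    rw [Finset.sum_const, Finset.card_univ, Fintype.card_fin, smul_eq_mul] at this
    omega
  rw [letterCount_eq_sum_bondCoeff hw1 _ _ hn c i]
  refine OpRank.mono (OpRank.sum _
    (r := (l + 1) * ((l + 1) ^ 2 * D) ^ k * D') fun z _ => ?_) ?_
  · refine OpRank.smul ?_ _
    obtain ⟨P, hP, Q, hQ, hPQ⟩ := hsplit i fun j => ((z j : ℕ) : ℂ)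
    rw [hPQ]
    -- The rank is estimated at the rare bond, and the cut is then moved back to `X`.
    refine hmove i _ _ ((opRank_bondCoeff hP hQ (hb i) _ n hn).mono ?_)
    exact Nat.mul_le_mul_left _ (Nat.pow_le_pow_right (by positivity) hi)
  · refine Nat.mul_le_mul_right _ ?_
    rw [Finset.card_univ, Fintype.card_fun, Fintype.card_fin]
    refine Nat.pow_le_pow_right (by omega) ?_
    calc _ ≤ Fintype.card (Fin S) := Fintype.card_subtype_le _
      _ = S := Fintype.card_fin S

theorem opRank_aeval {l r : ℕ} {X : Finset (Fin N)} {H : Obs N d}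
    (h : ∀ n ≤ l, OpRank X r (H ^ n)) (q : Polynomial ℝ) (hq : q.natDegree ≤ l) :
    OpRank X ((l + 1) * r) (Polynomial.aeval H q) := by
  rw [Polynomial.aeval_eq_sum_range' (Nat.lt_succ_of_le hq)]
  refine OpRank.mono (OpRank.sum _ (r := r) fun n hn => ?_) (by simp)
  rw [← Complex.coe_smul]
  exact (h n (by have := Finset.mem_range.1 hn; omega)).smul _

end SpinChain

/-! ### Nested commutators and ground states of parts -/

namespace SpinChain

/-- Nested commutators with a sum of terms of which only few fail to commute with a local
observable. -/
theorem norm_adL_pow_le {𝔸 : Type*} [NormedRing 𝔸] [NormedAlgebra ℝ 𝔸] {a : ℕ → 𝔸} {b : 𝔸}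
    {F : ℕ → Subalgebra ℝ 𝔸} {g : ℝ} (hF : Monotone F) (ha : ∀ j, a j ∈ F (j + 1))
    (hcomm : ∀ m j, m < j → ∀ Y ∈ F m, Commute (a j) Y) (hg : ∀ j, ‖a j‖ ≤ g) (hb : b ∈ F 0)
    (hbg : ‖b‖ ≤ g) (K n : ℕ) :
    ‖((adL (∑ j ∈ Finset.range K, a j)) ^ n) b‖ ≤ (2 * g) ^ n * n.factorial * g := by
  have hg0 : 0 ≤ g := (norm_nonneg _).trans hbg
  suffices h : ((adL (∑ j ∈ Finset.range K, a j)) ^ n) b ∈ F n ∧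
      ‖((adL (∑ j ∈ Finset.range K, a j)) ^ n) b‖ ≤ (2 * g) ^ n * n.factorial * g from h.2
  induction n with
  | zero => simpa using ⟨hb, hbg⟩
  | succ n ih =>
    obtain ⟨hm, hle⟩ := ih
    set Y := ((adL (∑ j ∈ Finset.range K, a j)) ^ n) b with hY
    -- After n commutators only a 0, …, a n can fail to commute. The next step therefore costs (n +
    -- 1)·2g, whence the factorial.
    have hstep : ((adL (∑ j ∈ Finset.range K, a j)) ^ (n + 1)) b =
        ∑ j ∈ (Finset.range K).filter (· ≤ n), (a j * Y - Y * a j) := by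
      rw [pow_succ']
      change adL _ Y = _
      rw [adL_apply, Finset.sum_mul, Finset.mul_sum, ← Finset.sum_sub_distrib, Finset.sum_filter]
      refine Finset.sum_congr rfl fun j _ => ?_
      split_ifs with h
      · rfl
      · rw [(hcomm n j (not_le.1 h) Y hm).eq, sub_self]
    rw [hstep]
    constructor
    · refine Subalgebra.sum_mem _ fun j hj => ?_
      have hjn : F (j + 1) ≤ F (n + 1) :=
        hF (Nat.succ_le_succ (Finset.mem_filter.1 hj).2)
      have hYn := hF n.le_succ hm
      exact Subalgebra.sub_mem _ (Subalgebra.mul_mem _ (hjn (ha j)) hYn)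
        (Subalgebra.mul_mem _ hYn (hjn (ha j)))
    · have hterm : ∀ j, ‖a j * Y - Y * a j‖ ≤ 2 * g * ‖Y‖ := fun j => by
        have h1 := (norm_mul_le (a j) Y).trans (mul_le_mul_of_nonneg_right (hg j) (norm_nonneg _))
        have h2 := (norm_mul_le Y (a j)).trans (mul_le_mul_of_nonneg_left (hg j) (norm_nonneg _))
        have := norm_sub_le (a j * Y) (Y * a j)
        linarith
      have hcard : (((Finset.range K).filter (· ≤ n)).card : ℝ) ≤ n + 1 := by
        have : ((Finset.range K).filter (· ≤ n)).card ≤ (Finset.range (n + 1)).card :=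
          Finset.card_le_card fun j hj => by
            have := (Finset.mem_filter.1 hj).2
            exact Finset.mem_range.2 (by omega)
        rw [Finset.card_range] at this
        exact_mod_cast this
      refine (norm_sum_le_of_le _ fun j _ => hterm j).trans ?_
      rw [Finset.sum_const, nsmul_eq_mul, Nat.factorial_succ]
      push_cast
      calc _ ≤ ((n : ℝ) + 1) * (2 * g * ((2 * g) ^ n * n.factorial * g)) := by gcongr
        _ = _ := by ring

variable {N d : ℕ}

/-- The operator on the Hilbert space that is given by a matrix. -/
noncomputable def toOp : Obs N d →ₐ[ℝ] (State N d →L[ℂ] State N d) :=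
  AlgHom.restrictScalars ℝ
    (AlgHomClass.toAlgHom (Matrix.toEuclideanCLM (n := Config (Fin N) d) (𝕜 := ℂ)))

theorem norm_toOp (A : Obs N d) : ‖toOp A‖ = ‖A‖ := rfl

theorem toOp_injective : Function.Injective (toOp (N := N) (d := d)) :=
  (Matrix.toEuclideanCLM (n := Config (Fin N) d) (𝕜 := ℂ)).injective

theorem toOp_smul (c : ℂ) (A : Obs N d) : toOp (c • A) = c • toOp A :=
  map_smul (Matrix.toEuclideanCLM (n := Config (Fin N) d) (𝕜 := ℂ)) c A

theorem isSelfAdjoint_toOp {A : Obs N d} (hA : A.IsHermitian) : IsSelfAdjoint (toOp A) :=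
  IsSelfAdjoint.map (show IsSelfAdjoint A from hA)
    (Matrix.toEuclideanCLM (n := Config (Fin N) d) (𝕜 := ℂ))

theorem commute_toOp {A B : Obs N d} (h : Commute A B) : Commute (toOp A) (toOp B) :=
  h.map toOp

theorem aeval_mem_supp {X : Finset (Fin N)} {A : Obs N d} (hA : A ∈ supp X)
    (p : Polynomial ℝ) : Polynomial.aeval A p ∈ supp X := by
  rw [Polynomial.aeval_eq_sum_range]
  refine Subalgebra.sum_mem _ fun n _ => ?_
  rw [← Complex.coe_smul]
  exact Subalgebra.smul_mem _ (Subalgebra.pow_mem _ hA n) _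

/-- The lowest energy of a Hermitian observable, and a nonzero observable with the same support
that maps into its ground space. -/
theorem exists_ground_projection [Nonempty (Config (Fin N) d)] {X : Finset (Fin N)} {A : Obs N d}
    (hA : A.IsHermitian) (hX : A ∈ supp X) : ∃ (e : ℝ) (P : Obs N d), P ∈ supp X ∧ P ≠ 0 ∧
      A * P = (e : ℂ) • P ∧ ∀ v, e * ‖v‖ ^ 2 ≤ (inner ℂ v (toOp A v)).re := by
  obtain ⟨b, x, hb⟩ := exists_eigenbasis (isSelfAdjoint_toOp hA)
  have hpos : 0 < Module.finrank ℂ (State N d) := by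
    rw [finrank_euclideanSpace]; exact Fintype.card_pos
  have : Nonempty (Fin (Module.finrank ℂ (State N d))) := ⟨⟨0, hpos⟩⟩
  obtain ⟨i₀, hi₀⟩ := Finite.exists_min x
  -- The spectral projection of the lowest level, as a polynomial in `A`.
  obtain ⟨p, hp⟩ := exists_polynomial_eval x fun y => if y = x i₀ then 1 else 0
  refine ⟨x i₀, Polynomial.aeval A p, aeval_mem_supp hX p, fun h => ?_, ?_,
    le_re_inner_of_eigenvalues b hb hi₀⟩
  · have h1 := aeval_apply_eigen (hb i₀) p
    rw [hp, if_pos rfl, Polynomial.aeval_algHom_apply, h] at h1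
    have h2 := b.norm_eq_one i₀
    rw [show b i₀ = 0 by simpa using h1.symm, norm_zero] at h2
    exact zero_ne_one h2
  · apply toOp_injective
    rw [map_mul, toOp_smul, ← Polynomial.aeval_algHom_apply]
    refine ContinuousLinearMap.coe_injective (b.toBasis.ext fun i => ?_)
    have h1 := aeval_apply_eigen (hb i) p
    simp only [OrthonormalBasis.coe_toBasis, ContinuousLinearMap.coe_coe,
      mul_apply_eq_comp, smul_apply, h1, map_smul, hb, hp]
    split_ifs with h
    · rw [h]; simp
    · simp

end SpinChain

/-! ### Layered Hamiltonians -/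

namespace SpinChain

variable {N d : ℕ}

/-- The sites of the layers in `s`. -/
noncomputable def layers (lay : Fin N → ℤ) (s : Set ℤ) : Finset (Fin N) :=
  open scoped Classical in Finset.univ.filter fun j => lay j ∈ s

theorem mem_layers {lay : Fin N → ℤ} {s : Set ℤ} {j : Fin N} : j ∈ layers lay s ↔ lay j ∈ s := by
  simp [layers]

theorem layers_mono {lay : Fin N → ℤ} {s t : Set ℤ} (h : s ⊆ t) : layers lay s ⊆ layers lay t :=
  fun _ hj => mem_layers.2 (h (mem_layers.1 hj))

theorem layers_compl (lay : Fin N → ℤ) (s : Set ℤ) : (layers lay s)ᶜ = layers lay sᶜ := by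
  ext j; simp [mem_layers]

theorem disjoint_layers {lay : Fin N → ℤ} {s t : Set ℤ} (h : Disjoint s t) :
    Disjoint (layers lay s) (layers lay t) :=
  Finset.disjoint_left.2 fun _ hj hj' => Set.disjoint_left.1 h (mem_layers.1 hj) (mem_layers.1 hj')

theorem card_layers_Ioc_le {lay : Fin N → ℤ} {c : ℕ} (hcard : ∀ k, (layers lay {k}).card ≤ c)
    (n : ℕ) : (layers lay (Set.Ioc 0 (n : ℤ))).card ≤ c * n := by
  induction n with
  | zero => simp [layers]
  | succ n ih =>
    have : layers lay (Set.Ioc 0 ((n + 1 : ℕ) : ℤ)) ⊆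
        layers lay (Set.Ioc 0 (n : ℤ)) ∪ layers lay {(n : ℤ) + 1} := fun j hj => by
      simp only [Finset.mem_union, mem_layers, Set.mem_Ioc, Set.mem_singleton_iff] at hj ⊢
      push_cast at hj
      omega
    calc _ ≤ _ := Finset.card_le_card this
      _ ≤ _ := Finset.card_union_le _ _
      _ ≤ c * n + c := Nat.add_le_add ih (hcard _)
      _ = _ := by ring

/-- `B k` acts on the layers `k - 1` and `k`. -/
structure IsLayered (lay : Fin N → ℤ) (g : ℝ) (B : ℤ → Obs N d) : Prop where
  isHermitian : ∀ k, (B k).IsHermitian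
  mem_supp : ∀ k, B k ∈ supp (layers lay {k - 1, k})
  norm_le : ∀ k, ‖B k‖ ≤ g

variable {lay : Fin N → ℤ} {g : ℝ} {B : ℤ → Obs N d}

theorem IsLayered.mem_supp_of_mem (hB : IsLayered lay g B) {s : Set ℤ} {k : ℤ} (h1 : k - 1 ∈ s)
    (h2 : k ∈ s) : B k ∈ supp (layers lay s) :=
  supp_mono (layers_mono (Set.insert_subset h1 (Set.singleton_subset_iff.2 h2))) (hB.mem_supp k)

theorem commute_of_mem_layers {s t : Set ℤ} {A A' : Obs N d} (hA : A ∈ supp (layers lay s))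
    (hA' : A' ∈ supp (layers lay t)) (h : Disjoint s t) : Commute A A' :=
  commute_of_disjoint (disjoint_layers h) hA hA'

/-- The terms of the left end are numbered away from the coupling `B 1`. Observables on layers ≥ -m
play the role of `F m`: `B (-j)` commutes with them for j > m and extends them by one layer for j =
m. -/
theorem IsLayered.norm_exp_conj_left_le (hB : IsLayered lay g B) (hg : 0 < g) (K : ℕ) :
    ‖NormedSpace.exp ((4 * g)⁻¹ • toOp (∑ j ∈ Finset.range K, B (-(j : ℤ)))) * toOp (B 1) *
      NormedSpace.exp (-((4 * g)⁻¹ • toOp (∑ j ∈ Finset.range K, B (-(j : ℤ)))))‖ ≤ 2 * g := by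
  refine norm_exp_conj_le hg fun n => ?_
  rw [map_sum]
  refine norm_adL_pow_le (F := fun m => ((supp (layers lay (Set.Ici (-(m : ℤ))))).restrictScalars
    ℝ).map toOp) (fun m m' h => Subalgebra.map_mono (supp_mono (layers_mono
      (Set.Ici_subset_Ici.2 (by omega))))) (fun j => ?_) (fun m j hmj Y hY => ?_)
    (fun j => hB.norm_le _) ?_ (hB.norm_le _) K n
  · exact Subalgebra.mem_map.2 ⟨_, hB.mem_supp_of_mem (by simp) (by simp), rfl⟩
  · obtain ⟨Z, hZ, rfl⟩ := Subalgebra.mem_map.1 hY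
    refine commute_toOp (commute_of_mem_layers (hB.mem_supp _) hZ ?_)
    rw [Set.disjoint_left]
    simp
    omega
  · exact Subalgebra.mem_map.2 ⟨_, hB.mem_supp_of_mem (by simp) (by simp), rfl⟩

theorem IsLayered.norm_exp_conj_right_le (hB : IsLayered lay g B) (hg : 0 < g) (S : ℤ) (K : ℕ) :
    ‖NormedSpace.exp ((4 * g)⁻¹ • toOp (∑ j ∈ Finset.range K, B (S + 1 + j))) * toOp (B S) *
      NormedSpace.exp (-((4 * g)⁻¹ • toOp (∑ j ∈ Finset.range K, B (S + 1 + j))))‖ ≤ 2 * g := by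
  refine norm_exp_conj_le hg fun n => ?_
  rw [map_sum]
  refine norm_adL_pow_le (F := fun m => ((supp (layers lay (Set.Iic (S + m)))).restrictScalars
    ℝ).map toOp) (fun m m' h => Subalgebra.map_mono (supp_mono (layers_mono
      (Set.Iic_subset_Iic.2 (by omega))))) (fun j => ?_) (fun m j hmj Y hY => ?_)
    (fun j => hB.norm_le _) ?_ (hB.norm_le _) K n
  · exact Subalgebra.mem_map.2 ⟨_, hB.mem_supp_of_mem (by simp; omega) (by simp; omega), rfl⟩
  · obtain ⟨Z, hZ, rfl⟩ := Subalgebra.mem_map.1 hY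
    refine commute_toOp (commute_of_mem_layers (hB.mem_supp _) hZ ?_)
    rw [Set.disjoint_left]
    simp
    omega
  · exact Subalgebra.mem_map.2 ⟨_, hB.mem_supp_of_mem (by simp) (by simp), rfl⟩

/-- Observables on three disjoint sets have a common ground state. -/
theorem exists_common_ground_state [Nonempty (Config (Fin N) d)] {X Y Z : Finset (Fin N)}
    {A A' A'' : Obs N d} (hA : A.IsHermitian) (hA' : A'.IsHermitian) (hA'' : A''.IsHermitian)
    (hX : A ∈ supp X) (hY : A' ∈ supp Y) (hZ : A'' ∈ supp Z) (hXY : Disjoint X Y)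
    (hXZ : Disjoint X Z) (hYZ : Disjoint Y Z) : ∃ (e e' e'' : ℝ) (u : State N d),
      (∀ v, e * ‖v‖ ^ 2 ≤ (inner ℂ v (toOp A v)).re) ∧
      (∀ v, e' * ‖v‖ ^ 2 ≤ (inner ℂ v (toOp A' v)).re) ∧
      (∀ v, e'' * ‖v‖ ^ 2 ≤ (inner ℂ v (toOp A'' v)).re) ∧ ‖u‖ = 1 ∧
      toOp A u = (e : ℂ) • u ∧ toOp A' u = (e' : ℂ) • u ∧ toOp A'' u = (e'' : ℂ) • u := by
  obtain ⟨e, P, hP, hP0, hPA, he⟩ := exists_ground_projection hA hX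
  obtain ⟨e', P', hP', hP0', hPA', he'⟩ := exists_ground_projection hA' hY
  obtain ⟨e'', P'', hP'', hP0'', hPA'', he''⟩ := exists_ground_projection hA'' hZ
  -- The product of the three ground projections is nonzero, and any nonzero vector in its range is
  -- a common ground state.
  have h1 := mul_ne_zero_of_disjoint hXY hP hP' hP0 hP0'
  have h2 : P * P' * P'' ≠ 0 := mul_ne_zero_of_disjoint (X := X ∪ Y)
    (Finset.disjoint_union_left.2 ⟨hXZ, hYZ⟩)
    (Subalgebra.mul_mem _ (supp_mono Finset.subset_union_left hP)
      (supp_mono Finset.subset_union_right hP')) hP'' h1 hP0''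
  obtain ⟨v, hv⟩ : ∃ v, toOp (P * P' * P'') v ≠ 0 := by
    by_contra! h
    exact h2 (toOp_injective (by ext1 v; rw [h v, map_zero]; rfl))
  set u := toOp (P * P' * P'') v with hu
  have hn : ‖u‖ ≠ 0 := norm_ne_zero_iff.2 hv
  have key : ∀ {T : Obs N d} {x : ℝ}, T * (P * P' * P'') = (x : ℂ) • (P * P' * P'') →
      toOp T (((‖u‖⁻¹ : ℝ) : ℂ) • u) = (x : ℂ) • ((‖u‖⁻¹ : ℝ) : ℂ) • u := fun {T x} h => by
    rw [map_smul, smul_comm, hu]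
    congr 1
    change (toOp T * toOp (P * P' * P'') : State N d →L[ℂ] State N d) v = _
    rw [← map_mul, h, toOp_smul]
    rfl
  have c1 : A' * P = P * A' := (commute_of_disjoint hXY hP hY).eq.symm
  have c2 : A'' * P = P * A'' := (commute_of_disjoint hXZ hP hZ).eq.symm
  have c3 : A'' * P' = P' * A'' := (commute_of_disjoint hYZ hP' hZ).eq.symm
  refine ⟨e, e', e'', ((‖u‖⁻¹ : ℝ) : ℂ) • u, he, he', he'', ?_, key ?_, key ?_, key ?_⟩
  · rw [norm_smul, Complex.norm_real, norm_inv, norm_norm, inv_mul_cancel₀ hn]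
  · rw [← mul_assoc, ← mul_assoc, hPA, smul_mul_assoc, smul_mul_assoc]
  · rw [← mul_assoc, ← mul_assoc, c1, mul_assoc P, hPA', mul_smul_comm, smul_mul_assoc]
  · rw [← mul_assoc, ← mul_assoc, c2, mul_assoc P, c3, ← mul_assoc, mul_assoc (P * P'), hPA'',
      mul_smul_comm]

end SpinChain

/-! ### Approximate ground state projections -/

namespace SpinChain

local notation "⟪" x ", " y "⟫" => inner ℂ x y

variable {N d : ℕ} {lay : Fin N → ℤ} {g : ℝ} {B : ℤ → Obs N d}

theorem IsLayered.sum_mem_supp (hB : IsLayered lay g B) {ι : Type*} {t : Finset ι} {f : ι → ℤ}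
    {s : Set ℤ} (h1 : ∀ i ∈ t, f i - 1 ∈ s) (h2 : ∀ i ∈ t, f i ∈ s) :
    ∑ i ∈ t, B (f i) ∈ supp (layers lay s) :=
  Subalgebra.sum_mem _ fun i hi => hB.mem_supp_of_mem (h1 i hi) (h2 i hi)

/-- The i-th cut runs after layer i and is crossed by `B (i + 1)` alone. Two sites per layer give
this bond the rank d^4, and moving the cut to layer 0 passes at most 2S sites, which costs d^(4S).
-/
theorem IsLayered.opRank_pow (hB : IsLayered lay g B) (hd : 1 ≤ d)
    (hcard : ∀ k, (layers lay {k}).card ≤ 2) {S l k n : ℕ} (hl : 1 ≤ l) (hk : l < S * (k + 1))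
    (hn : n ≤ l) {FL FR : Obs N d} (hFL : FL ∈ supp (layers lay (Set.Iic 0)))
    (hFR : FR ∈ supp (layers lay (Set.Ici (S : ℤ)))) :
    OpRank (layers lay (Set.Iic 0)) ((l + 1) ^ S * ((l + 1) ^ S *
        ((l + 1) * ((l + 1) ^ 2 * d ^ 4) ^ k * d ^ (4 * S))))
      ((FL + FR + ∑ i : Fin S, B ((i : ℤ) + 1)) ^ n) := by
  refine SpinChain.opRank_pow (fun i => layers lay (Set.Iic (i : ℤ))) hl hk (Nat.one_le_pow _ _ hd)
    hn (fun i => ?_) (fun i z => ?_) (fun i r O hO => ?_)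
  · refine opRank_of_mem_supp (n := 2) hd (hB.mem_supp _)
      (le_trans (Finset.card_le_card fun j hj => ?_) (hcard i))
    simp only [Finset.mem_inter, mem_layers, Set.mem_insert_iff, Set.mem_singleton_iff,
      Set.mem_Iic] at hj ⊢
    omega
  · have hS := i.2
    refine ⟨FL + ∑ j ∈ Finset.univ.filter (fun j : {j // j ≠ i} => j.1 < i), z j • B ((j : ℤ) + 1),
      Subalgebra.add_mem _ (supp_mono (layers_mono (Set.Iic_subset_Iic.2 (by omega))) hFL)
        (Subalgebra.sum_mem _ fun j hj => Subalgebra.smul_mem _ (hB.mem_supp_of_mem ?_ ?_) _),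
      FR + ∑ j ∈ Finset.univ.filter (fun j : {j // j ≠ i} => ¬ j.1 < i), z j • B ((j : ℤ) + 1),
      ?_, ?_⟩
    · have := (Finset.mem_filter.1 hj).2
      simp only [Set.mem_Iic]
      omega
    · have := (Finset.mem_filter.1 hj).2
      simp only [Set.mem_Iic]
      omega
    · rw [layers_compl, Set.compl_Iic]
      refine Subalgebra.add_mem _ (supp_mono (layers_mono fun x hx => ?_) hFR)
        (Subalgebra.sum_mem _ fun j hj => Subalgebra.smul_mem _ (hB.mem_supp_of_mem ?_ ?_) _)
      · simp only [Set.mem_Ici, Set.mem_Ioi] at hx ⊢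
        omega
      · have := (Finset.mem_filter.1 hj).2
        have hj' : (j.1 : ℕ) ≠ i := fun h => j.2 (Fin.ext h)
        simp only [Set.mem_Ioi]
        omega
      · have := (Finset.mem_filter.1 hj).2
        simp only [Set.mem_Ioi]
        omega
    · rw [← Finset.sum_filter_add_sum_filter_not Finset.univ fun j : {j // j ≠ i} => j.1 < i]
      abel
  · have := hO.of_superset (X' := layers lay (Set.Iic 0)) hd
      (layers_mono (Set.Iic_subset_Iic.2 (by omega))) (n := 2 * S) (by
        refine (Finset.card_le_card (t := layers lay (Set.Ioc 0 (S : ℤ))) fun j hj => ?_).trans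
          (card_layers_Ioc_le hcard S)
        have hS := i.2
        simp only [Finset.mem_sdiff, mem_layers, Set.mem_Iic, Set.mem_Ioc] at hj ⊢
        omega)
    rwa [← mul_assoc, show 2 * 2 = 4 from rfl] at this

/-- The factor that bounds the operator Schmidt rank of an approximate ground state projection. -/
def agspRank (d S l k : ℕ) : ℕ :=
  (l + 1) * ((l + 1) ^ S * ((l + 1) ^ S * ((l + 1) * ((l + 1) ^ 2 * d ^ 4) ^ k * d ^ (4 * S))))

/-- Approximate ground state projections of a gapped chain. -/
theorem IsLayered.exists_agsp (hB : IsLayered lay g B) (hd : 1 ≤ d)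
    (hcard : ∀ k, (layers lay {k}).card ≤ 2) {S l k K : ℕ} (hS : 2 ≤ S) (hl : 1 ≤ l)
    (hk : l < S * (k + 1)) {H : Obs N d}
    (hH : H = ∑ j ∈ Finset.range K, B (-(j : ℤ)) + ∑ j ∈ Finset.range K, B ((S : ℤ) + 1 + j) +
      ∑ i : Fin S, B ((i : ℤ) + 1))
    {ε t E₀ : ℝ} {Ω : State N d} (hg : 0 < g) (hε : 0 < ε) (hεg : ε ≤ g) (ht : 7 * g ≤ t)
    (hΩ : ‖Ω‖ = 1) (hΩE : toOp H Ω = (E₀ : ℂ) • Ω)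
    (hgap : ∀ u, E₀ * ‖u‖ ^ 2 + ε * (‖u‖ ^ 2 - ‖⟪Ω, u⟫‖ ^ 2) ≤ (⟪u, toOp H u⟫).re)
    (hsmall : 16 * g * (7 * Real.exp (7 / 2)) * Real.exp (-t / (2 * g)) < ε) :
    ∃ (T : Obs N d) (u₀ : State N d), ‖u₀‖ = 1 ∧ toOp T u₀ = u₀ ∧
      (∀ v, ⟪u₀, v⟫ = 0 → ⟪u₀, toOp T v⟫ = 0 ∧
        ‖toOp T v‖ ≤ 2 * Real.exp (-(l * √(2 * (ε / 4) / (2 * t + 2 * S * g)))) * ‖v‖) ∧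
      ‖Ω - ⟪u₀, Ω⟫ • u₀‖ ^ 2 ≤
        256 * g ^ 2 * (7 * Real.exp (7 / 2)) * Real.exp (-t / (2 * g)) / ε ^ 2 ∧
      OpRank (layers lay (Set.Iic 0)) (agspRank d S l k) T := by
  -- The first and the last of the S bonds couple the ends; the n bonds between them form the middle
  -- part `M`.
  obtain ⟨n, rfl⟩ : ∃ n, S = n + 2 := ⟨S - 2, by omega⟩
  have : Nonempty (Config (Fin N) d) := ⟨fun _ => ⟨0, hd⟩⟩
  set AL := ∑ j ∈ Finset.range K, B (-(j : ℤ)) with hAL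
  set AR := ∑ j ∈ Finset.range K, B (((n + 2 : ℕ) : ℤ) + 1 + j) with hAR
  set M := ∑ i ∈ Finset.range n, B ((i : ℤ) + 2) with hM
  have hbonds : ∑ i : Fin (n + 2), B ((i : ℤ) + 1) = B 1 + M + B ((n + 2 : ℕ) : ℤ) := by
    rw [Fin.sum_univ_eq_sum_range (fun i : ℕ => B ((i : ℤ) + 1)), Finset.sum_range_succ,
      Finset.sum_range_succ', add_comm (∑ i ∈ Finset.range n, _)]
    congr 1
  have hALs : AL ∈ supp (layers lay (Set.Iic 0)) :=
    hB.sum_mem_supp (fun i _ => by simp only [Set.mem_Iic]; omega) fun i _ => by simp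
  have hARs : AR ∈ supp (layers lay (Set.Ici ((n + 2 : ℕ) : ℤ))) :=
    hB.sum_mem_supp (fun i _ => by simp only [Set.mem_Ici]; omega)
      fun i _ => by simp only [Set.mem_Ici]; omega
  have hMs : M ∈ supp (layers lay (Set.Ioo 0 ((n + 2 : ℕ) : ℤ))) :=
    hB.sum_mem_supp (fun i hi => by have := Finset.mem_range.1 hi; simp only [Set.mem_Ioo]; omega)
      fun i hi => by have := Finset.mem_range.1 hi; simp only [Set.mem_Ioo]; omega
  have hBLs := hB.mem_supp 1
  have hBRs := hB.mem_supp ((n + 2 : ℕ) : ℤ)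
  have d1 : Disjoint (Set.Iic 0) (Set.Ioo 0 ((n + 2 : ℕ) : ℤ)) :=
    Set.disjoint_left.2 fun x hx hx' => by simp only [Set.mem_Iic, Set.mem_Ioo] at hx hx'; omega
  have d2 : Disjoint (Set.Iic 0) (Set.Ici ((n + 2 : ℕ) : ℤ)) :=
    Set.disjoint_left.2 fun x hx hx' => by simp only [Set.mem_Iic, Set.mem_Ici] at hx hx'; omega
  have d3 : Disjoint (Set.Ioo 0 ((n + 2 : ℕ) : ℤ)) (Set.Ici ((n + 2 : ℕ) : ℤ)) :=
    Set.disjoint_left.2 fun x hx hx' => by simp only [Set.mem_Ioo, Set.mem_Ici] at hx hx'; omega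
  have d4 : Disjoint (Set.Iic 0) {((n + 2 : ℕ) : ℤ) - 1, ((n + 2 : ℕ) : ℤ)} :=
    Set.disjoint_left.2 fun x hx hx' => by
      simp only [Set.mem_Iic, Set.mem_insert_iff, Set.mem_singleton_iff] at hx hx'; omega
  have d5 : Disjoint (Set.Ici ((n + 2 : ℕ) : ℤ)) {(1 : ℤ) - 1, 1} :=
    Set.disjoint_left.2 fun x hx hx' => by
      simp only [Set.mem_Ici, Set.mem_insert_iff, Set.mem_singleton_iff] at hx hx'; omega
  have hALh : AL.IsHermitian := isHermitian_sum fun j _ => hB.isHermitian _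
  have hARh : AR.IsHermitian := isHermitian_sum fun j _ => hB.isHermitian _
  have hMh : M.IsHermitian := isHermitian_sum fun j _ => hB.isHermitian _
  have hHeq : toOp H = toOp AL + toOp (B 1) + toOp M + toOp (B ((n + 2 : ℕ) : ℤ)) + toOp AR := by
    rw [hH, hbonds]; simp only [map_add]; abel
  have hnM : ‖toOp M‖ ≤ n * g := by
    rw [norm_toOp]
    refine (norm_sum_le_of_le _ fun i _ => hB.norm_le _).trans ?_
    simp
  obtain ⟨eL, eM, eR, u, heL, heM, heR, hu, huL, huM, huR⟩ :=
    exists_common_ground_state hALh hMh hARh hALs hMs hARs (disjoint_layers d1)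
      (disjoint_layers d2) (disjoint_layers d3)
  -- The common ground state of the three decoupled parts is the trial state; each coupling adds at
  -- most g.
  have hE : E₀ ≤ eL + eM + eR + 2 * g := by
    have h1 := hgap u
    have h2 := (abs_le.1 (abs_re_inner_apply_le (T := toOp (B 1)) (hB.norm_le 1) u)).2
    have h3 := (abs_le.1 (abs_re_inner_apply_le (T := toOp (B ((n + 2 : ℕ) : ℤ)))
      (hB.norm_le _) u)).2
    have h4 : ‖⟪Ω, u⟫‖ ≤ 1 := (norm_inner_le_norm Ω u).trans (by rw [hΩ, hu, one_mul])
    have h5 : ‖⟪Ω, u⟫‖ ^ 2 ≤ 1 := pow_le_one₀ (norm_nonneg _) h4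
    have h6 : (⟪u, toOp H u⟫).re = (⟪u, toOp AL u⟫).re + (⟪u, toOp (B 1) u⟫).re +
        (⟪u, toOp M u⟫).re + (⟪u, toOp (B ((n + 2 : ℕ) : ℤ)) u⟫).re + (⟪u, toOp AR u⟫).re := by
      rw [hHeq]
      simp only [add_apply, inner_add_right, Complex.add_re]
    rw [h6, huL, huM, huR, re_inner_smul_self, re_inner_smul_self, re_inner_smul_self] at h1
    rw [hu] at h1 h2 h3
    nlinarith [mul_nonneg hε.le (sub_nonneg.2 h5)]
  rw [hHeq] at hΩE hgap
  obtain ⟨pL, pR, u₀, e₀, hu₀, hue, he₀, hq, hdist⟩ := exists_truncation (isSelfAdjoint_toOp hALh)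
    (isSelfAdjoint_toOp (hB.isHermitian 1)) (isSelfAdjoint_toOp hMh)
    (isSelfAdjoint_toOp (hB.isHermitian ((n + 2 : ℕ) : ℤ))) (isSelfAdjoint_toOp hARh) hg hε hεg ht
    (commute_toOp (commute_of_mem_layers hALs hMs d1))
    (commute_toOp (commute_of_mem_layers hALs hBRs d4))
    (commute_toOp (commute_of_mem_layers hALs hARs d2))
    (commute_toOp (commute_of_mem_layers hARs hMs d3.symm))
    (commute_toOp (commute_of_mem_layers hARs hBLs d5))
    (hB.norm_exp_conj_left_le hg K) (hB.norm_exp_conj_right_le hg ((n + 2 : ℕ) : ℤ) K)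
    (hB.norm_le _) (hB.norm_le _) hnM heL heM heR hE hΩ hΩE hgap hsmall
  set FL := Polynomial.aeval AL pL with hFL
  set FR := Polynomial.aeval AR pR with hFR
  set HT := FL + FR + ∑ i : Fin (n + 2), B ((i : ℤ) + 1) with hHT
  have hHTeq : Polynomial.aeval (toOp AL) pL + toOp (B 1) + toOp M + toOp (B ((n + 2 : ℕ) : ℤ)) +
      Polynomial.aeval (toOp AR) pR = toOp HT := by
    rw [hHT, hbonds, Polynomial.aeval_algHom_apply, Polynomial.aeval_algHom_apply]
    simp only [map_add]
    abel
  rw [hHTeq] at hue hq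
  have hw : 2 * t + 2 * (n * g) + 4 * g = 2 * t + 2 * ((n + 2 : ℕ) : ℝ) * g := by push_cast; ring
  rw [hw] at hq
  have hn0 : (0 : ℝ) ≤ n * g := by positivity
  -- The ground energy e₀ ≤ E₀ lies at least ε/4 below the other levels, which start at E₀ + ε/4.
  obtain ⟨q, hql, hqe, hqs⟩ := exists_polynomial_small_on_interval (a := E₀ + ε / 4)
    (w := 2 * t + 2 * ((n + 2 : ℕ) : ℝ) * g) (γ := ε / 4) (e₀ := e₀) (by linarith)
    (by rw [← hw]; linarith) (by linarith) l
  refine ⟨Polynomial.aeval HT q, u₀, hu₀, ?_, fun v hv => ?_, hdist, opRank_aeval (fun m hm =>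
    hB.opRank_pow hd hcard hl hk hm (aeval_mem_supp hALs pL) (aeval_mem_supp hARs pR)) q hql⟩
  · rw [← Polynomial.aeval_algHom_apply, aeval_apply_eigen hue, hqe]
    simp
  · rw [← Polynomial.aeval_algHom_apply]
    exact hq q _ (by positivity) (fun x h1 h2 => hqs x h1 h2) v hv

end SpinChain

/-! ### Variational form of the gap -/

namespace SpinChain

local notation "⟪" x ", " y "⟫" => inner ℂ x y

theorem sum_Icc_eq_sum_range {M : Type*} [AddCommMonoid M] (f : ℤ → M) (K S : ℕ) :
    ∑ k ∈ Finset.Icc (-(K : ℤ) + 1) (S + K), f k = ∑ j ∈ Finset.range K, f (-(j : ℤ)) +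
      ∑ j ∈ Finset.range K, f ((S : ℤ) + 1 + j) + ∑ i : Fin S, f ((i : ℤ) + 1) := by
  have h1 : ∑ k ∈ Finset.Icc (-(K : ℤ) + 1) (S + K), f k =
      ∑ n ∈ Finset.range (K + S + K), f ((n : ℤ) + (-K + 1)) := by
    rw [show K + S + K = ((S : ℤ) + K + 1 - (-K + 1)).toNat by omega, Int.Icc_eq_finset_map,
      Finset.sum_map]
    exact Finset.sum_congr rfl fun n _ => congrArg f (add_comm _ _)
  rw [h1, Finset.sum_range_add, Finset.sum_range_add, ← Finset.sum_range_reflect,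
    Fin.sum_univ_eq_sum_range (fun i : ℕ => f ((i : ℤ) + 1)), add_right_comm]
  congr 1
  · congr 1
    · refine Finset.sum_congr rfl fun j hj => congrArg f ?_
      have := Finset.mem_range.1 hj
      omega
    · refine Finset.sum_congr rfl fun j _ => congrArg f ?_
      push_cast; ring
  · refine Finset.sum_congr rfl fun j _ => congrArg f ?_
    push_cast; ring

variable {N d : ℕ} {H : Obs N d} {ψ : State N d} {ΔE : ℝ}

/-- For d ≤ 1 the Hilbert space has dimension at most one and no second level. This gives ln d ≥ ln
2 later. -/
theorem IsGappedGroundState.two_le (h : IsGappedGroundState H ψ ΔE) (hN : 0 < N) : 2 ≤ d := by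
  obtain ⟨hψ, E₀, -, hspan, hE₁⟩ := h
  have hψ0 : ψ ≠ 0 := norm_ne_zero_iff.1 (by rw [hψ]; exact one_ne_zero)
  by_contra hd
  obtain ⟨hE₁, hne⟩ := hE₁.1
  obtain ⟨w, hw⟩ := hE₁.exists_hasEigenvector
  have hle : Module.finrank ℂ (State N d) ≤ 1 := by
    rw [finrank_euclideanSpace, Fintype.card_fun, Fintype.card_fin, Fintype.card_fin]
    interval_cases d
    · rw [zero_pow hN.ne']; exact zero_le_one
    · rw [one_pow]
  have h1 : Module.finrank ℂ (State N d) = 1 := le_antisymm hle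
    (Module.finrank_pos_iff_exists_ne_zero.2 ⟨ψ, hψ0⟩)
  obtain ⟨c, hc⟩ := (finrank_eq_one_iff_of_nonzero' ψ hψ0).1 h1 w
  have h2 : w ∈ Module.End.eigenspace (Matrix.toEuclideanLin H) (E₀ : ℂ) := by
    rw [hspan]; exact Submodule.mem_span_singleton.2 ⟨c, hc⟩
  have h3 := Module.End.mem_eigenspace_iff.1 h2
  rw [hw.apply_eq_smul] at h3
  exact hne (by exact_mod_cast smul_left_injective ℂ hw.2 h3)

/-- A quadratic form inequality is what survives in trial states. It allows any ε ≤ ΔE, because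
truncation needs ε at most the strength of a layer term. -/
theorem IsGappedGroundState.exists_gap_form (h : IsGappedGroundState H ψ ΔE)
    (hH : H.IsHermitian) : 0 < ΔE ∧ ∃ E₀ : ℝ, toOp H ψ = (E₀ : ℂ) • ψ ∧ ∀ ε, 0 ≤ ε → ε ≤ ΔE → ∀ u,
      E₀ * ‖u‖ ^ 2 + ε * (‖u‖ ^ 2 - ‖⟪ψ, u⟫‖ ^ 2) ≤ (⟪u, toOp H u⟫).re := by
  obtain ⟨hψ, E₀, hE₀, hspan, hE₁⟩ := h
  have hΔ : 0 < ΔE := by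
    have h1 := hE₀.2 hE₁.1.1
    have h2 := hE₁.1.2
    rcases lt_or_eq_of_le h1 with h | h
    · linarith
    · exact absurd h.symm h2
  have hψE : ψ ∈ Module.End.eigenspace (Matrix.toEuclideanLin H) (E₀ : ℂ) := by
    rw [hspan]; exact Submodule.mem_span_singleton_self ψ
  refine ⟨hΔ, E₀, Module.End.mem_eigenspace_iff.1 hψE, fun ε hε hεΔ u => ?_⟩
  obtain ⟨b, x, hb⟩ := exists_eigenbasis (isSelfAdjoint_toOp hH)
  have hbne : ∀ i, b i ≠ 0 := fun i => norm_ne_zero_iff.1 (by rw [b.norm_eq_one]; exact one_ne_zero)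
  have heig : ∀ i, Module.End.HasEigenvalue (Matrix.toEuclideanLin H) (x i : ℂ) := fun i =>
    Module.End.hasEigenvalue_of_hasEigenvector ⟨Module.End.mem_eigenspace_iff.2 (hb i), hbne i⟩
  set s := Finset.univ.filter fun i => x i = E₀ with hs
  have hsc : ∀ i ∈ s, ∃ c : ℂ, ‖c‖ = 1 ∧ b i = c • ψ := fun i hi => by
    have h1 := (Finset.mem_filter.1 hi).2
    have h2 : b i ∈ Module.End.eigenspace (Matrix.toEuclideanLin H) (E₀ : ℂ) :=
      Module.End.mem_eigenspace_iff.2 (by rw [← h1]; exact hb i)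
    rw [hspan] at h2
    obtain ⟨c, hc⟩ := Submodule.mem_span_singleton.1 h2
    refine ⟨c, ?_, hc.symm⟩
    have := b.norm_eq_one i
    rwa [← hc, norm_smul, hψ, mul_one] at this
  have hsum : ∑ i ∈ s, ‖⟪b i, u⟫‖ ^ 2 ≤ ‖⟪ψ, u⟫‖ ^ 2 := by
    have hcard : s.card ≤ 1 := Finset.card_le_one.2 fun i hi j hj => by
      obtain ⟨c, hc, hic⟩ := hsc i hi
      obtain ⟨c', hc', hjc⟩ := hsc j hj
      by_contra hij
      have h0 : ⟪b i, b j⟫ = 0 := b.orthonormal.2 hij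
      rw [hic, hjc, inner_smul_left, inner_smul_right, inner_self_eq_norm_sq_to_K, hψ] at h0
      have := congrArg norm h0
      simp [hc, hc'] at this
    rcases s.eq_empty_or_nonempty with h0 | ⟨i, hi⟩
    · rw [h0, Finset.sum_empty]; positivity
    · obtain ⟨c, hc, hic⟩ := hsc i hi
      rw [Finset.eq_singleton_iff_unique_mem.2 ⟨hi, fun j hj => Finset.card_le_one.1 hcard j hj i hi⟩,
        Finset.sum_singleton, hic, inner_smul_left, norm_mul, RCLike.norm_conj, hc, one_mul]
  have hx : ∀ i, i ∉ s → E₀ + ΔE ≤ x i := fun i hi =>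
    hE₁.2 ⟨heig i, fun h => hi (Finset.mem_filter.2 ⟨Finset.mem_univ _, h⟩)⟩
  have hterm : ∀ i, (E₀ + ε) * ‖⟪b i, u⟫‖ ^ 2 - (if i ∈ s then ε * ‖⟪b i, u⟫‖ ^ 2 else 0) ≤
      x i * ‖⟪b i, u⟫‖ ^ 2 := fun i => by
    split_ifs with hi
    · rw [(Finset.mem_filter.1 hi).2]; linarith
    · rw [sub_zero]
      exact mul_le_mul_of_nonneg_right (by linarith [hx i hi]) (sq_nonneg _)
  have htot := Finset.sum_le_sum fun i (_ : i ∈ Finset.univ) => hterm i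
  rw [Finset.sum_sub_distrib, ← Finset.mul_sum, b.sum_sq_norm_inner_right, ← Finset.sum_filter,
    Finset.filter_mem_eq_inter, Finset.univ_inter, ← Finset.mul_sum,
    ← re_inner_apply_eigenbasis b hb] at htot
  have := mul_le_mul_of_nonneg_left hsum hε
  linarith

/-- Approximate ground state projections for the ground state of a gapped chain and the cuts at the
two ends of a block. -/
theorem exists_agsp_of_isGappedGroundState [NeZero N] {bc : Boundary} {J : ℝ} {h : Fin N → Obs N d}
    (hh : IsNearestNeighbour bc J h) (hψ : IsGappedGroundState (hamiltonian h) ψ ΔE) {a m : ℕ}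
    (ha : a < N) (hm : a + m ≤ N) {S l k : ℕ} (hS : 2 ≤ S) (hl : 1 ≤ l)
    (hk : l < S * (k + 1)) {ε t : ℝ} (hε : 0 < ε) (hεΔ : ε ≤ ΔE) (hεg : ε ≤ 4 * J)
    (ht : 7 * (4 * J) ≤ t)
    (hsmall : 16 * (4 * J) * (7 * Real.exp (7 / 2)) * Real.exp (-t / (2 * (4 * J))) < ε) :
    ∃ (T : Obs N d) (u₀ : State N d), ‖u₀‖ = 1 ∧ toOp T u₀ = u₀ ∧
      (∀ v, ⟪u₀, v⟫ = 0 → ⟪u₀, toOp T v⟫ = 0 ∧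
        ‖toOp T v‖ ≤ 2 * Real.exp (-(l * √(2 * (ε / 4) / (2 * t + 2 * S * (4 * J))))) * ‖v‖) ∧
      ‖ψ - ⟪u₀, ψ⟫ • u₀‖ ^ 2 ≤
        256 * (4 * J) ^ 2 * (7 * Real.exp (7 / 2)) * Real.exp (-t / (2 * (4 * J))) / ε ^ 2 ∧
      OpRank (block N a m) (agspRank d S l k) T := by
  -- The layers of the ring serve both boundary conditions: an open chain is a ring whose last bond
  -- carries the term 0. The block is exactly the union of the layers ≤ 0, so both its ends form one
  -- cut.
  set lay := ringLayer N a m with hlay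
  have hfib : ∀ k, (Finset.univ.filter fun j => lay j = k).card ≤ 2 := card_ringLayer_fiber_le ha hm
  have hB : IsLayered lay (4 * J) (layerTerm lay h) :=
    ⟨layerTerm_isHermitian hh.isHermitian, fun k => supp_mono (fun j hj => mem_layers.2
      (by simpa using hj)) (layerTerm_mem_supp hh.supported
        (fun j => Or.inr (abs_ringLayer_sub_le ha hm j)) k),
      fun k => norm_layerTerm_le hh.pos.le hh.norm_le (hfib k)⟩
  have hcard : ∀ k, (layers lay {k}).card ≤ 2 := fun k =>
    (Finset.card_le_card fun j hj => by simpa [mem_layers] using hj).trans (hfib k)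
  obtain ⟨K, hK⟩ := exists_layer_bounds lay
  have hH := sum_layerTerm (h := h) (lay := lay) (lo := -((K + 1 : ℕ) : ℤ) + 1)
    (hi := S + (K + 1 : ℕ)) (fun j => by have := hK j; push_cast; omega)
    fun j => by have := hK j; push_cast; omega
  rw [sum_Icc_eq_sum_range] at hH
  have hX : layers lay (Set.Iic 0) = block N a m := by
    ext j
    rw [mem_layers, Set.mem_Iic]
    exact ringLayer_nonpos_iff ha hm j
  obtain ⟨-, E₀, hE, hgap⟩ := hψ.exists_gap_form (isHermitian_sum fun j _ => hh.isHermitian j)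
  have hd := hψ.two_le (Nat.pos_of_ne_zero (NeZero.ne N))
  have := hB.exists_agsp (by omega) hcard hS hl hk hH.symm (by linarith [hh.pos]) hε hεg ht hψ.1 hE
    (hgap ε hε.le hεΔ) hsmall
  rwa [hX] at this

end SpinChain

/-! ### Schmidt rank of states -/

namespace SpinChain

local notation "⟪" x ", " y "⟫" => inner ℂ x y

variable {N d : ℕ} {X : Finset (Fin N)}

/-- The states of `X` that belong to the configurations off `X`. -/
def slice (X : Finset (Fin N)) (o : Config {i // i ∉ X} d) :
    State N d →ₗ[ℂ] EuclideanSpace ℂ (Config X d) where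
  toFun φ := WithLp.toLp 2 fun s => φ (glue X s o)
  map_add' _ _ := rfl
  map_smul' _ _ := rfl

theorem slice_apply (o : Config {i // i ∉ X} d) (φ : State N d) (s : Config X d) :
    slice X o φ s = φ (glue X s o) := rfl

theorem sum_config_eq (X : Finset (Fin N)) {M : Type*} [AddCommMonoid M]
    (f : Config (Fin N) d → M) : ∑ s, f s = ∑ o, ∑ s, f (glue X s o) := by
  rw [← (splitEquiv X).symm.sum_comp f, Fintype.sum_prod_type, Finset.sum_comm]
  rfl

theorem inner_eq_sum_slice (X : Finset (Fin N)) (φ χ : State N d) :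
    ⟪φ, χ⟫ = ∑ o, ⟪slice X o φ, slice X o χ⟫ := by
  simp only [PiLp.inner_apply, slice_apply]
  exact sum_config_eq X _

theorem norm_sq_eq_sum_slice (X : Finset (Fin N)) (φ : State N d) :
    ‖φ‖ ^ 2 = ∑ o, ‖slice X o φ‖ ^ 2 := by
  simp only [EuclideanSpace.norm_sq_eq, slice_apply]
  exact sum_config_eq X _

theorem tensor_glue (a : Matrix (Config X d) (Config X d) ℂ)
    (b : Matrix (Config {i // i ∉ X} d) (Config {i // i ∉ X} d) ℂ) (s t : Config X d)
    (o u : Config {i // i ∉ X} d) : tensor X a b (glue X s o) (glue X t u) = a s t * b o u := by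
  rw [← splitEquiv_symm_apply X (s, o), ← splitEquiv_symm_apply X (t, u)]
  simp only [tensor, Matrix.submatrix_apply, Equiv.apply_symm_apply]
  rfl

theorem slice_toOp_of_mem_supp_compl {B : Obs N d} (hB : B ∈ supp Xᶜ) :
    ∃ b : Config {i // i ∉ X} d → Config {i // i ∉ X} d → ℂ, ∀ φ o,
      slice X o (toOp B φ) = ∑ o', b o o' • slice X o' φ := by
  obtain ⟨b, rfl⟩ := mem_supp_compl_iff.1 hB
  refine ⟨b, fun φ o => ?_⟩
  ext s
  rw [slice_apply, WithLp.ofLp_sum, Finset.sum_apply]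
  change ∑ t, tensor X 1 b (glue X s o) t * φ t = _
  rw [sum_config_eq X]
  refine Finset.sum_congr rfl fun o' _ => ?_
  simp [tensor_glue, Matrix.one_apply, slice_apply]

theorem slice_toOp_of_mem_supp {A : Obs N d} (hA : A ∈ supp X) :
    ∃ a : EuclideanSpace ℂ (Config X d) →ₗ[ℂ] EuclideanSpace ℂ (Config X d), ∀ φ o,
      slice X o (toOp A φ) = a (slice X o φ) := by
  obtain ⟨a, rfl⟩ := supportedOn_iff_tensor.1 hA
  refine ⟨Matrix.toEuclideanLin a, fun φ o => ?_⟩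
  ext s
  rw [slice_apply]
  change ∑ t, tensor X a 1 (glue X s o) t * φ t = ∑ t, a s t * φ (glue X t o)
  rw [sum_config_eq X, Finset.sum_comm]
  refine Finset.sum_congr rfl fun t _ => ?_
  simp [tensor_glue, Matrix.one_apply]

/-- The Schmidt rank of `φ` with respect to `X` and its complement is at most `r`. -/
def SchmidtRankLE (X : Finset (Fin N)) (r : ℕ) (φ : State N d) : Prop :=
  ∃ V : Submodule ℂ (EuclideanSpace ℂ (Config X d)), Module.finrank ℂ V ≤ r ∧ ∀ o, slice X o φ ∈ V

theorem SchmidtRankLE.smul {r : ℕ} {φ : State N d} (h : SchmidtRankLE X r φ) (c : ℂ) :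
    SchmidtRankLE X r (c • φ) := by
  obtain ⟨V, hV, h⟩ := h
  exact ⟨V, hV, fun o => by rw [map_smul]; exact V.smul_mem c (h o)⟩

theorem finrank_iSup_le_card_mul {ι E : Type*} [Fintype ι] [AddCommGroup E] [Module ℂ E]
    [FiniteDimensional ℂ E] {r : ℕ} (V : ι → Submodule ℂ E) (h : ∀ i, Module.finrank ℂ (V i) ≤ r) :
    Module.finrank ℂ (⨆ i, V i : Submodule ℂ E) ≤ Fintype.card ι * r := by
  classical
  have key : ∀ s : Finset ι, Module.finrank ℂ (⨆ i ∈ s, V i : Submodule ℂ E) ≤ s.card * r :=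
    fun s => by
      induction s using Finset.induction_on with
      | empty => simp
      | insert i s hi ih =>
        rw [Finset.iSup_insert, Finset.card_insert_of_notMem hi]
        have := Submodule.finrank_add_le_finrank_add_finrank (V i) (⨆ i ∈ s, V i)
        have := h i
        nlinarith
  rw [← show ⨆ i ∈ Finset.univ, V i = ⨆ i, V i by simp]
  exact key Finset.univ

/-- A factor off `X` only mixes slices and stays in their span `V`. A factor on `X` applies one
linear map to all slices, so each product contributes one image of `V`. -/
theorem OpRank.schmidtRankLE {D r : ℕ} {T : Obs N d} (hT : OpRank X D T) {φ : State N d}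
    (h : SchmidtRankLE X r φ) : SchmidtRankLE X (D * r) (toOp T φ) := by
  obtain ⟨ι, _, A, B, hc, hA, hB, rfl⟩ := hT
  obtain ⟨V, hV, h⟩ := h
  choose a ha using fun i => slice_toOp_of_mem_supp (hA i)
  choose b hb using fun i => slice_toOp_of_mem_supp_compl (hB i)
  refine ⟨⨆ i, V.map (a i), (finrank_iSup_le_card_mul _ fun i =>
    (Submodule.finrank_map_le _ _).trans hV).trans (Nat.mul_le_mul_right _ hc), fun o => ?_⟩
  rw [map_sum, sum_apply, map_sum]
  refine Submodule.sum_mem _ fun i _ => Submodule.mem_iSup_of_mem i ?_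
  rw [map_mul, mul_apply_eq_comp, ha, hb]
  exact Submodule.mem_map_of_mem (Submodule.sum_mem _ fun o' _ => V.smul_mem _ (h o'))

theorem isHermitian_reducedState (ψ : State N d) (X : Finset (Fin N)) :
    (reducedState ψ X).IsHermitian := by
  ext s t
  simp [reducedState, Matrix.conjTranspose_apply, mul_comm]

/-- The reduced state is the sum of the rank one operators of the slices of ψ. -/
theorem inner_reducedState (ψ : State N d) (X : Finset (Fin N))
    (u : EuclideanSpace ℂ (Config X d)) :
    ⟪u, Matrix.toEuclideanCLM (n := Config X d) (𝕜 := ℂ) (reducedState ψ X) u⟫.re =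
      ∑ o, ‖⟪u, slice X o ψ⟫‖ ^ 2 := by
  have h : ⟪u, Matrix.toEuclideanCLM (n := Config X d) (𝕜 := ℂ) (reducedState ψ X) u⟫ =
      ∑ o, ((‖⟪u, slice X o ψ⟫‖ ^ 2 : ℝ) : ℂ) := by
    have h1 : ∀ o, ((‖⟪u, slice X o ψ⟫‖ ^ 2 : ℝ) : ℂ) =
        ∑ s, ∑ t, star (u s) * (ψ (glue X s o) * star (ψ (glue X t o)) * u t) := fun o => by
      push_cast
      rw [← Complex.mul_conj', inner_conj_symm, PiLp.inner_apply, PiLp.inner_apply,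
        Finset.sum_mul_sum]
      refine Finset.sum_congr rfl fun s _ => Finset.sum_congr rfl fun t _ => ?_
      simp only [RCLike.inner_apply, slice_apply, starRingEnd_apply]
      ring
    simp_rw [h1]
    rw [PiLp.inner_apply, Finset.sum_comm]
    refine Finset.sum_congr rfl fun s _ => ?_
    rw [Finset.sum_comm]
    simp only [RCLike.inner_apply, Matrix.ofLp_toEuclideanCLM, Matrix.mulVec, dotProduct,
      reducedState, Finset.sum_mul, starRingEnd_apply]
    refine Finset.sum_congr rfl fun t _ => Finset.sum_congr rfl fun o _ => ?_
    ring
  rw [h, ← Complex.ofReal_sum, Complex.ofReal_re]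

end SpinChain

/-! ### Overlaps with states of small Schmidt rank -/

namespace SpinChain

local notation "⟪" x ", " y "⟫" => inner ℂ x y

variable {N d : ℕ} {X : Finset (Fin N)}

section

variable {ι : Type*} [Fintype ι] {ψ : State N d}
  {b : OrthonormalBasis ι ℂ (EuclideanSpace ℂ (Config X d))} {p : ι → ℝ}

theorem sum_norm_inner_slice_sq (hb : ∀ i, Matrix.toEuclideanCLM (n := Config X d) (𝕜 := ℂ)
    (reducedState ψ X) (b i) = (p i : ℂ) • b i) (u : EuclideanSpace ℂ (Config X d)) :
    ∑ o, ‖⟪u, slice X o ψ⟫‖ ^ 2 = ∑ i, p i * ‖⟪b i, u⟫‖ ^ 2 := by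
  rw [← inner_reducedState, re_inner_apply_eigenbasis b hb]

theorem eigenvalue_reducedState (hb : ∀ i, Matrix.toEuclideanCLM (n := Config X d) (𝕜 := ℂ)
    (reducedState ψ X) (b i) = (p i : ℂ) • b i) (i : ι) :
    p i = ∑ o, ‖⟪b i, slice X o ψ⟫‖ ^ 2 := by
  rw [← inner_reducedState, hb, re_inner_smul_self, b.norm_eq_one]
  ring

theorem sum_eigenvalue_reducedState (hb : ∀ i, Matrix.toEuclideanCLM (n := Config X d) (𝕜 := ℂ)
    (reducedState ψ X) (b i) = (p i : ℂ) • b i) : ∑ i, p i = ‖ψ‖ ^ 2 := by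
  simp_rw [eigenvalue_reducedState hb]
  rw [Finset.sum_comm, norm_sq_eq_sum_slice X]
  exact Finset.sum_congr rfl fun o _ => b.sum_sq_norm_inner_right _

/-- A state of small Schmidt rank close to `ψ` shows that the reduced state of `ψ` is concentrated
on a subspace of small dimension. -/
theorem SchmidtRankLE.exists_weights (hb : ∀ i, Matrix.toEuclideanCLM (n := Config X d) (𝕜 := ℂ)
    (reducedState ψ X) (b i) = (p i : ℂ) • b i) {r : ℕ} {φ : State N d}
    (hφ : SchmidtRankLE X r φ) :
    ∃ w : ι → ℝ, (∀ i, 0 ≤ w i) ∧ (∀ i, w i ≤ 1) ∧ ∑ i, w i ≤ r ∧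
      ∑ i, p i * (1 - w i) ≤ ‖ψ - φ‖ ^ 2 := by
  obtain ⟨V, hV, hφ⟩ := hφ
  -- The weight `w i` is the squared length of the projection of `b i` to `V`. The remaining mass is
  -- that of the projections of the slices of ψ to `Vᗮ`, where φ contributes nothing.
  set u := stdOrthonormalBasis ℂ Vᗮ with hu
  have hon : Orthonormal ℂ fun k => (u k : EuclideanSpace ℂ (Config X d)) :=
    u.orthonormal.comp_linearIsometry Vᗮ.subtypeₗᵢ
  refine ⟨fun i => 1 - ∑ k, ‖⟪(u k : EuclideanSpace ℂ (Config X d)), b i⟫‖ ^ 2, fun i => ?_,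
    fun i => ?_, ?_, ?_⟩
  · have := hon.sum_inner_products_le (b i) (s := Finset.univ)
    rw [b.norm_eq_one] at this
    linarith
  · have : 0 ≤ ∑ k, ‖⟪(u k : EuclideanSpace ℂ (Config X d)), b i⟫‖ ^ 2 :=
      Finset.sum_nonneg fun _ _ => sq_nonneg _
    linarith
  · rw [Finset.sum_sub_distrib, Finset.sum_comm]
    have h1 : ∀ k, ∑ i, ‖⟪(u k : EuclideanSpace ℂ (Config X d)), b i⟫‖ ^ 2 = 1 := fun k => by
      rw [b.sum_sq_norm_inner_left, hon.1 k, one_pow]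
    simp_rw [h1]
    have h2 := Submodule.finrank_add_finrank_orthogonal V
    have h3 : Fintype.card ι = Module.finrank ℂ (EuclideanSpace ℂ (Config X d)) :=
      (Module.finrank_eq_card_basis b.toBasis).symm
    simp only [Finset.sum_const, Finset.card_univ, Fintype.card_fin, nsmul_eq_mul, mul_one]
    rw [h3, ← h2]
    push_cast
    have : (Module.finrank ℂ V : ℝ) ≤ r := by exact_mod_cast hV
    linarith
  · simp only [sub_sub_cancel]
    have h1 : ∑ i, p i * ∑ k, ‖⟪(u k : EuclideanSpace ℂ (Config X d)), b i⟫‖ ^ 2 =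
        ∑ o, ∑ k, ‖⟪(u k : EuclideanSpace ℂ (Config X d)), slice X o ψ⟫‖ ^ 2 := by
      rw [Finset.sum_comm]
      simp_rw [sum_norm_inner_slice_sq hb, Finset.mul_sum]
      rw [Finset.sum_comm]
      simp_rw [norm_inner_symm]
    rw [h1, norm_sq_eq_sum_slice X]
    refine Finset.sum_le_sum fun o _ => ?_
    rw [map_sub]
    refine le_trans (le_of_eq ?_) (hon.sum_inner_products_le _ (s := Finset.univ))
    refine Finset.sum_congr rfl fun k _ => ?_
    rw [inner_sub_right, Submodule.inner_left_of_mem_orthogonal (hφ o) (u k).2, sub_zero]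

end

theorem norm_sub_inner_smul_sq {E : Type*} [NormedAddCommGroup E] [InnerProductSpace ℂ E] {u v : E}
    (hu : ‖u‖ = 1) : ‖v - ⟪u, v⟫ • u‖ ^ 2 = ‖v‖ ^ 2 - ‖⟪u, v⟫‖ ^ 2 := by
  have h0 : ⟪⟪u, v⟫ • u, v - ⟪u, v⟫ • u⟫ = 0 := by
    rw [inner_smul_left, inner_sub_right, inner_smul_right, inner_self_eq_norm_sq_to_K, hu]
    simp
  have h := norm_add_sq_eq_norm_sq_add_norm_sq_of_inner_eq_zero _ _ h0
  rw [add_sub_cancel, norm_smul, hu, mul_one] at h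
  linarith

/-- The product state with the largest overlap with `ψ` bounds the overlaps with states of small
Schmidt rank. -/
theorem exists_product_state_max_overlap {ψ : State N d} (hψ : ‖ψ‖ = 1) (X : Finset (Fin N)) :
    ∃ φ : State N d, SchmidtRankLE X 1 φ ∧ ‖φ‖ = 1 ∧ ∀ (r : ℕ) (χ : State N d),
      SchmidtRankLE X r χ → ‖⟪χ, ψ⟫‖ ^ 2 ≤ r * ‖⟪φ, ψ⟫‖ ^ 2 * ‖χ‖ ^ 2 := by
  obtain ⟨b, p, hb⟩ := exists_eigenbasis (T := Matrix.toEuclideanCLM (n := Config X d) (𝕜 := ℂ)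
    (reducedState ψ X)) (IsSelfAdjoint.map (show IsSelfAdjoint (reducedState ψ X) from
      isHermitian_reducedState ψ X) (Matrix.toEuclideanCLM (n := Config X d) (𝕜 := ℂ)))
  have hsum := sum_eigenvalue_reducedState hb
  rw [hψ, one_pow] at hsum
  have hne : Nonempty (Fin (Module.finrank ℂ (EuclideanSpace ℂ (Config X d)))) := by
    by_contra h
    rw [not_nonempty_iff] at h
    rw [Finset.univ_eq_empty, Finset.sum_empty] at hsum
    exact zero_ne_one hsum
  obtain ⟨i, hi⟩ := Finite.exists_max p
  have hp0 : ∀ j, 0 ≤ p j := fun j => by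
    rw [eigenvalue_reducedState hb]; exact Finset.sum_nonneg fun _ _ => sq_nonneg _
  have hpi : 0 < p i := by
    refine lt_of_le_of_ne (hp0 i) fun h => ?_
    rw [Finset.sum_eq_zero fun j _ => le_antisymm ((hi j).trans h.symm.le) (hp0 j)] at hsum
    exact zero_ne_one hsum
  -- The leading term of the Schmidt decomposition of ψ; its overlap with ψ and its squared norm
  -- both equal the largest eigenvalue.
  set φ' : State N d := WithLp.toLp 2 fun s =>
    ⟪b i, slice X (fun j : {j // j ∉ X} => s j) ψ⟫ * b i (fun j : X => s j) with hφ'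
  have hslice : ∀ o, slice X o φ' = ⟪b i, slice X o ψ⟫ • b i := fun o => by
    ext s
    have h1 : (fun j : X => glue X s o j) = s := funext fun j => by simp [glue]
    have h2 : (fun j : {j // j ∉ X} => glue X s o j) = o := funext fun j => by simp [glue, j.2]
    rw [slice_apply, hφ']
    simp only [h1, h2]
    rfl
  have hin : ⟪φ', ψ⟫ = (p i : ℂ) := by
    rw [inner_eq_sum_slice X, eigenvalue_reducedState hb i]
    push_cast
    refine Finset.sum_congr rfl fun o _ => ?_
    rw [hslice, inner_smul_left, Complex.conj_mul']
  have hnorm : ‖φ'‖ ^ 2 = p i := by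
    rw [norm_sq_eq_sum_slice X, eigenvalue_reducedState hb i]
    refine Finset.sum_congr rfl fun o _ => ?_
    rw [hslice, norm_smul, b.norm_eq_one, mul_one]
  have hnorm0 : ‖φ'‖ ≠ 0 := fun h => by rw [h] at hnorm; norm_num at hnorm; exact hpi.ne hnorm
  have hrank : SchmidtRankLE X 1 φ' := ⟨Submodule.span ℂ {b i}, (finrank_span_le_card _).trans (by simp),
    fun o => by rw [hslice]; exact Submodule.smul_mem _ _ (Submodule.mem_span_singleton_self _)⟩
  refine ⟨((‖φ'‖⁻¹ : ℝ) : ℂ) • φ', hrank.smul _, ?_, fun r χ hχ => ?_⟩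
  · rw [norm_smul, Complex.norm_real, norm_inv, norm_norm, inv_mul_cancel₀ hnorm0]
  · have hov : ‖⟪((‖φ'‖⁻¹ : ℝ) : ℂ) • φ', ψ⟫‖ ^ 2 = p i := by
      rw [inner_smul_left, hin, norm_mul, RCLike.norm_conj, Complex.norm_real, Complex.norm_real,
        norm_inv, norm_norm, mul_pow, inv_pow, hnorm, Real.norm_eq_abs, sq_abs]
      field_simp
    rw [hov]
    rcases eq_or_ne χ 0 with rfl | hχ0
    · simp
    have hn : ‖χ‖ ≠ 0 := norm_ne_zero_iff.2 hχ0
    set e := ((‖χ‖⁻¹ : ℝ) : ℂ) • χ with he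
    have hen : ‖e‖ = 1 := by
      rw [he, norm_smul, Complex.norm_real, norm_inv, norm_norm, inv_mul_cancel₀ hn]
    -- The projection of ψ to the line of χ still has Schmidt rank at most r and squared distance 1
    -- - |⟨e, ψ⟩|² from ψ. Hence |⟨e, ψ⟩|² ≤ ∑ p w ≤ r max p.
    obtain ⟨w, hw0, hw1, hwr, hw⟩ := ((hχ.smul ((‖χ‖⁻¹ : ℝ) : ℂ)).smul ⟪e, ψ⟫).exists_weights hb
    rw [norm_sub_inner_smul_sq hen, hψ] at hw
    simp_rw [mul_sub, mul_one] at hw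
    rw [Finset.sum_sub_distrib, hsum] at hw
    have h1 : ∑ j, p j * w j ≤ p i * r := by
      calc _ ≤ ∑ j, p i * w j :=
            Finset.sum_le_sum fun j _ => mul_le_mul_of_nonneg_right (hi j) (hw0 j)
        _ = p i * ∑ j, w j := by rw [Finset.mul_sum]
        _ ≤ _ := mul_le_mul_of_nonneg_left hwr hpi.le
    have h2 : ‖⟪χ, ψ⟫‖ ^ 2 = ‖⟪e, ψ⟫‖ ^ 2 * ‖χ‖ ^ 2 := by
      rw [he, inner_smul_left, norm_mul, RCLike.norm_conj, Complex.norm_real, norm_inv, norm_norm,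
        mul_pow]
      field_simp
    rw [h2]
    refine mul_le_mul_of_nonneg_right ?_ (sq_nonneg _)
    linarith

theorem schmidtRankLE_finrank (X : Finset (Fin N)) (φ : State N d) :
    SchmidtRankLE X (Module.finrank ℂ (EuclideanSpace ℂ (Config X d))) φ :=
  ⟨⊤, (finrank_top ℂ _).le, fun _ => Submodule.mem_top⟩

/-- An approximate projection onto `u₀` of small operator Schmidt rank yields a product state that
overlaps with `u₀`. -/
theorem exists_product_state_overlap {T : Obs N d} {u₀ : State N d} {r : ℕ} {θ : ℝ}
    (hT : OpRank X r T) (hu₀ : ‖u₀‖ = 1) (hTu : toOp T u₀ = u₀)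
    (hTv : ∀ v, ⟪u₀, v⟫ = 0 → ⟪u₀, toOp T v⟫ = 0 ∧ ‖toOp T v‖ ≤ θ * ‖v‖)
    (hr : 2 * r * θ ^ 2 ≤ 1) :
    ∃ φ : State N d, SchmidtRankLE X 1 φ ∧ ‖φ‖ = 1 ∧ 1 ≤ 2 * r * ‖⟪φ, u₀⟫‖ ^ 2 := by
  obtain ⟨φ, hφ, hφn, hmax⟩ := exists_product_state_max_overlap hu₀ X
  refine ⟨φ, hφ, hφn, ?_⟩
  set μ := ‖⟪φ, u₀⟫‖ with hμ
  have hμ0 : 0 < μ := by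
    refine lt_of_le_of_ne (norm_nonneg _) fun h => ?_
    have := hmax _ u₀ (schmidtRankLE_finrank X u₀)
    rw [← h, inner_self_eq_norm_sq_to_K, hu₀] at this
    norm_num at this
  set c := ⟪u₀, φ⟫ with hc
  have hcμ : ‖c‖ = μ := norm_inner_symm _ _
  set v := φ - c • u₀ with hv
  have huv : ⟪u₀, v⟫ = 0 := by
    rw [hv, inner_sub_right, inner_smul_right, inner_self_eq_norm_sq_to_K, hu₀]
    simp [hc]
  have hvn : ‖v‖ ^ 2 ≤ 1 := by
    rw [hv, norm_sub_inner_smul_sq hu₀, hφn]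
    nlinarith [sq_nonneg ‖⟪u₀, φ⟫‖]
  obtain ⟨h1, h2⟩ := hTv v huv
  have hTφ : toOp T φ = c • u₀ + toOp T v := by
    rw [show φ = c • u₀ + v by rw [hv]; abel, map_add, map_smul, hTu]
  have hin : ‖⟪toOp T φ, u₀⟫‖ = μ := by
    rw [norm_inner_symm, hTφ, inner_add_right, inner_smul_right, inner_self_eq_norm_sq_to_K, hu₀, h1]
    simpa using hcμ
  have hnorm : ‖toOp T φ‖ ^ 2 ≤ μ ^ 2 + θ ^ 2 := by
    have h0 : ⟪c • u₀, toOp T v⟫ = 0 := by rw [inner_smul_left, h1, mul_zero]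
    have := norm_add_sq_eq_norm_sq_add_norm_sq_of_inner_eq_zero _ _ h0
    rw [← hTφ, norm_smul, hu₀, mul_one, hcμ] at this
    have h3 : ‖toOp T v‖ ^ 2 ≤ θ ^ 2 := by
      calc _ ≤ (θ * ‖v‖) ^ 2 := pow_le_pow_left₀ (norm_nonneg _) h2 2
        _ = θ ^ 2 * ‖v‖ ^ 2 := by ring
        _ ≤ _ := mul_le_of_le_one_right (sq_nonneg _) hvn
    nlinarith
  -- The state Tφ has Schmidt rank at most r, the same overlap μ with u₀ as φ, and squared norm at
  -- most μ² + θ². Maximality of φ gives μ² ≤ rμ²(μ² + θ²), and cancelling μ² > 0 leaves 1 ≤ rμ² +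
  -- 1/2.
  have h4 := hmax _ _ (hT.schmidtRankLE hφ)
  rw [hin, mul_one] at h4
  have h5 : μ ^ 2 * 1 ≤ μ ^ 2 * (r * (μ ^ 2 + θ ^ 2)) := by
    calc _ ≤ r * μ ^ 2 * ‖toOp T φ‖ ^ 2 := by rw [mul_one]; exact h4
      _ ≤ r * μ ^ 2 * (μ ^ 2 + θ ^ 2) := mul_le_mul_of_nonneg_left hnorm (by positivity)
      _ = _ := by ring
  have h6 := le_of_mul_le_mul_left h5 (by positivity)
  nlinarith

/-- Approximate projections improve the overlap of a state with `ψ`. -/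
theorem norm_sub_smul_toOp_sq_le {T : Obs N d} {u₀ φ ψ : State N d} {θ δ ν : ℝ}
    (hu₀ : ‖u₀‖ = 1) (hTu : toOp T u₀ = u₀)
    (hTv : ∀ v, ⟪u₀, v⟫ = 0 → ⟪u₀, toOp T v⟫ = 0 ∧ ‖toOp T v‖ ≤ θ * ‖v‖) (hφ : ‖φ‖ = 1)
    (hψ : ‖ψ‖ = 1) (hδ : ‖ψ - ⟪u₀, ψ⟫ • u₀‖ ^ 2 ≤ δ) (hν : 0 < ν) (hφν : ν ≤ ‖⟪φ, u₀⟫‖) :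
    ∃ z : ℂ, ‖ψ - z • toOp T φ‖ ^ 2 ≤ 2 * δ + 2 * θ ^ 2 / ν ^ 2 := by
  set c := ⟪u₀, φ⟫ with hc
  have hcn : ν ≤ ‖c‖ := by rwa [hc, norm_inner_symm]
  have hc0 : c ≠ 0 := norm_pos_iff.1 (hν.trans_le hcn)
  set v := φ - c • u₀ with hv
  have huv : ⟪u₀, v⟫ = 0 := by
    rw [hv, inner_sub_right, inner_smul_right, inner_self_eq_norm_sq_to_K, hu₀]
    simp [hc]
  have hvn : ‖v‖ ^ 2 ≤ 1 := by
    rw [hv, norm_sub_inner_smul_sq hu₀, hφ]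
    nlinarith [sq_nonneg ‖⟪u₀, φ⟫‖]
  have hTφ : toOp T φ = c • u₀ + toOp T v := by
    rw [show φ = c • u₀ + v by rw [hv]; abel, map_add, map_smul, hTu]
  refine ⟨⟪u₀, ψ⟫ / c, ?_⟩
  have heq : ψ - (⟪u₀, ψ⟫ / c) • toOp T φ =
      (ψ - ⟪u₀, ψ⟫ • u₀) - (⟪u₀, ψ⟫ / c) • toOp T v := by
    rw [hTφ, smul_add, smul_smul, div_mul_cancel₀ _ hc0]
    abel
  have ha : ‖⟪u₀, ψ⟫‖ ≤ 1 := (norm_inner_le_norm _ _).trans (by rw [hu₀, hψ, one_mul])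
  have h3 : ‖(⟪u₀, ψ⟫ / c) • toOp T v‖ ^ 2 ≤ θ ^ 2 / ν ^ 2 := by
    rw [norm_smul, norm_div, mul_pow, div_pow]
    have h4 : ‖toOp T v‖ ^ 2 ≤ θ ^ 2 := by
      calc _ ≤ (θ * ‖v‖) ^ 2 := pow_le_pow_left₀ (norm_nonneg _) (hTv v huv).2 2
        _ = θ ^ 2 * ‖v‖ ^ 2 := by ring
        _ ≤ _ := mul_le_of_le_one_right (sq_nonneg _) hvn
    calc _ ≤ 1 / ν ^ 2 * θ ^ 2 := by
          refine mul_le_mul (div_le_div₀ zero_le_one (pow_le_one₀ (norm_nonneg _) ha)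
            (by positivity) (pow_le_pow_left₀ hν.le hcn 2)) h4 (sq_nonneg _) (by positivity)
      _ = _ := by ring
  rw [heq]
  have h5 := norm_sub_le (ψ - ⟪u₀, ψ⟫ • u₀) ((⟪u₀, ψ⟫ / c) • toOp T v)
  have h6 := norm_nonneg ((ψ - ⟪u₀, ψ⟫ • u₀) - (⟪u₀, ψ⟫ / c) • toOp T v)
  rw [mul_div_assoc]
  nlinarith [sq_nonneg (‖ψ - ⟪u₀, ψ⟫ • u₀‖ - ‖(⟪u₀, ψ⟫ / c) • toOp T v‖)]

/-- A vector close to the line of `u` transfers overlaps from `u`, and back. -/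
theorem norm_inner_le_add_of_close {E : Type*} [NormedAddCommGroup E] [InnerProductSpace ℂ E]
    {u ψ φ : E} (hu : ‖u‖ = 1) (hψ : ‖ψ‖ = 1) (hφ : ‖φ‖ = 1) {δ : ℝ}
    (h : ‖ψ - ⟪u, ψ⟫ • u‖ ≤ δ) :
    ‖⟪φ, ψ⟫‖ ≤ ‖⟪φ, u⟫‖ + δ ∧ ‖⟪φ, u⟫‖ * (1 - δ) ≤ ‖⟪φ, ψ⟫‖ + δ := by
  have ha : ‖⟪u, ψ⟫‖ ≤ 1 := (norm_inner_le_norm _ _).trans (by rw [hu, hψ, one_mul])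
  have ha' : 1 - δ ≤ ‖⟪u, ψ⟫‖ := by
    have h1 := norm_sub_norm_le ψ (⟪u, ψ⟫ • u)
    rw [norm_smul, hu, hψ, mul_one] at h1
    linarith
  have h2 : ‖⟪φ, ψ - ⟪u, ψ⟫ • u⟫‖ ≤ δ :=
    (norm_inner_le_norm _ _).trans (by rw [hφ, one_mul]; exact h)
  rw [inner_sub_right, inner_smul_right] at h2
  have h3 := norm_sub_norm_le ⟪φ, ψ⟫ (⟪u, ψ⟫ * ⟪φ, u⟫)
  have h4 := norm_sub_norm_le (⟪u, ψ⟫ * ⟪φ, u⟫) ⟪φ, ψ⟫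
  rw [norm_sub_rev] at h4
  rw [norm_mul] at h3 h4
  have h5 := norm_nonneg ⟪φ, u⟫
  constructor <;> nlinarith

end SpinChain

/-! ### Entropy of concentrated distributions -/

namespace SpinChain

/-- A distribution which is concentrated, up to errors `η m`, on sets of effective size `R m` has
small Shannon entropy. -/
theorem sum_negMulLog_le {ι : Type*} [Fintype ι] {p : ι → ℝ} (hp0 : ∀ i, 0 ≤ p i)
    (hp : ∑ i, p i = 1) {w : ℕ → ι → ℝ} (hw0 : ∀ m i, 0 ≤ w m i) (hw1 : ∀ m i, w m i ≤ 1)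
    {R η : ℕ → ℝ} (hR : ∀ m, 1 ≤ R m) (hwR : ∀ m, ∑ i, w m i ≤ R m)
    (hη : ∀ m, ∑ i, p i * (1 - w m i) ≤ η m) (hη0 : Filter.Tendsto η Filter.atTop (nhds 0)) {C : ℝ}
    (hC : ∀ M : ℕ, ∑ m ∈ Finset.range M,
      2 * η m * (((m : ℝ) + 3) * Real.log 2 + Real.log (R (m + 1))) ≤ C) :
    ∑ i, Real.negMulLog (p i) ≤ 2 * Real.log 2 + Real.log (R 0) + C := by
  classical
  have hlog2 : 0 ≤ Real.log 2 := Real.log_nonneg (by norm_num)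
  set L : ℕ → ℝ := fun m => ((m : ℝ) + 2) * Real.log 2 + Real.log (R m) with hL
  have hL0 : ∀ m, 0 ≤ L m := fun m =>
    add_nonneg (mul_nonneg (by positivity) hlog2) (Real.log_nonneg (hR m))
  have hhalf : ∀ m i, w m i < 1 / 2 → p i / 2 ≤ η m := fun m i h => by
    refine le_trans ?_ ((Finset.single_le_sum (f := fun i => p i * (1 - w m i)) (fun i _ =>
      mul_nonneg (hp0 i) (by linarith [hw1 m i])) (Finset.mem_univ i)).trans (hη m))
    have := hp0 i
    nlinarith
  -- There are finitely many indices, so one scale captures every index of positive probability.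
  obtain ⟨M, hM⟩ : ∃ M, ∀ i, 0 < p i → 1 / 2 ≤ w M i := by
    have h : ∀ i, ∀ᶠ m in Filter.atTop, 0 < p i → 1 / 2 ≤ w m i := fun i => by
      by_cases hi : 0 < p i
      · filter_upwards [hη0.eventually_lt_const (show 0 < p i / 2 by linarith)] with m hm _
        by_contra hc
        linarith [hhalf m i (not_le.1 hc)]
      · exact Filter.Eventually.of_forall fun _ h => absurd h hi
    exact (Filter.eventually_all.2 h).exists
  -- A comparison subprobability that mixes the normalized weights of the scales with factors
  -- 2^(-(m+1)); Gibbs' inequality bounds the entropy by the mean of -log q.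
  set q : ι → ℝ := fun i => ∑ m ∈ Finset.range (M + 1), (1 / 2) ^ (m + 1) * (w m i / R m) with hq
  have hRpos : ∀ m, 0 < R m := fun m => by linarith [hR m]
  have hqterm : ∀ m i, 0 ≤ (1 / 2 : ℝ) ^ (m + 1) * (w m i / R m) := fun m i =>
    mul_nonneg (by positivity) (div_nonneg (hw0 m i) (hRpos m).le)
  have hqsum : ∑ i, q i ≤ 1 := by
    rw [hq, Finset.sum_comm]
    calc _ ≤ ∑ m ∈ Finset.range (M + 1), (1 / 2 : ℝ) ^ (m + 1) := by
          refine Finset.sum_le_sum fun m _ => ?_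
          rw [← Finset.mul_sum, ← Finset.sum_div]
          exact mul_le_of_le_one_right (by positivity) ((div_le_one (hRpos m)).2 (hwR m))
      _ = 1 - (1 / 2) ^ (M + 1) := by
          simp_rw [pow_succ, ← Finset.sum_mul]
          rw [geom_sum_eq (by norm_num)]
          ring
      _ ≤ 1 := by linarith [pow_pos (show (0 : ℝ) < 1 / 2 by norm_num) (M + 1)]
  -- If scale m is the first to capture i, then -log (q i) ≤ L m, and m is 0 or the failure at m - 1
  -- contributes L m to this sum. By Markov's inequality failure at scale m has probability at most
  -- 2 η m.
  set Lb : ι → ℝ := fun i =>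
    L 0 + ∑ m ∈ Finset.range M, if w m i < 1 / 2 then L (m + 1) else 0 with hLb
  have hmain : ∀ i, Real.negMulLog (p i) ≤ p i * Lb i + (q i - p i) := fun i => by
    rcases (hp0 i).eq_or_lt with h0 | hpos
    · rw [← h0, Real.negMulLog_zero, zero_mul, zero_add, sub_zero]
      exact Finset.sum_nonneg fun m _ => hqterm m i
    · have hex : ∃ m, 1 / 2 ≤ w m i := ⟨M, hM i hpos⟩
      set m := Nat.find hex with hm
      have hmw : 1 / 2 ≤ w m i := Nat.find_spec hex
      have hmM : m ≤ M := Nat.find_min' hex (hM i hpos)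
      have hLm : L m ≤ Lb i := by
        have hnn : ∀ k ∈ Finset.range M, 0 ≤ if w k i < 1 / 2 then L (k + 1) else 0 :=
          fun k _ => by split_ifs; exacts [hL0 _, le_rfl]
        rcases Nat.eq_zero_or_pos m with h | h
        · rw [h]; exact le_add_of_nonneg_right (Finset.sum_nonneg hnn)
        · have h1 : w (m - 1) i < 1 / 2 := not_le.1 (Nat.find_min hex (show m - 1 < m by omega))
          have h2 := Finset.single_le_sum hnn (Finset.mem_range.2 (show m - 1 < M by omega))
          rw [if_pos h1, Nat.sub_add_cancel h] at h2
          exact h2.trans (le_add_of_nonneg_left (hL0 0))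
      have hqm : (1 / 2) ^ (m + 2) / R m ≤ q i := by
        refine le_trans ?_ (Finset.single_le_sum (fun k _ => hqterm k i)
          (Finset.mem_range.2 (show m < M + 1 by omega)))
        rw [pow_succ _ (m + 1), mul_div_assoc]
        exact mul_le_mul_of_nonneg_left (div_le_div_of_nonneg_right hmw (hRpos m).le) (by positivity)
      have hqpos : 0 < q i := lt_of_lt_of_le (div_pos (by positivity) (hRpos m)) hqm
      have hlogq : -Real.log (q i) ≤ L m := by
        have := Real.log_le_log (div_pos (by positivity) (hRpos m)) hqm
        rw [Real.log_div (by positivity) (hRpos m).ne', Real.log_pow, one_div, Real.log_inv] at this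
        push_cast at this
        simp only [hL]
        linarith
      have h3 := Real.log_le_sub_one_of_pos (div_pos hqpos hpos)
      rw [Real.log_div hqpos.ne' hpos.ne'] at h3
      have h4 := mul_le_mul_of_nonneg_left h3 hpos.le
      rw [mul_sub, mul_sub, mul_div_cancel₀ _ hpos.ne', mul_one] at h4
      have h5 := mul_le_mul_of_nonneg_left (hlogq.trans hLm) hpos.le
      rw [Real.negMulLog]
      linarith
  have hLbsum : ∑ i, p i * Lb i ≤ L 0 + C := by
    simp_rw [hLb, mul_add, Finset.mul_sum]
    rw [Finset.sum_add_distrib, ← Finset.sum_mul, hp, one_mul, Finset.sum_comm]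
    refine add_le_add_right ((Finset.sum_le_sum fun m _ => ?_).trans (hC M)) _
    have hLm : L (m + 1) = ((m : ℝ) + 3) * Real.log 2 + Real.log (R (m + 1)) := by
      simp only [hL]; push_cast; ring
    rw [← hLm]
    calc _ ≤ ∑ i, 2 * (p i * (1 - w m i)) * L (m + 1) := by
          refine Finset.sum_le_sum fun i _ => ?_
          have h1 := mul_nonneg (hp0 i) (show 0 ≤ 1 - w m i by linarith [hw1 m i])
          split_ifs with h
          · refine mul_le_mul_of_nonneg_right ?_ (hL0 _)
            have := hp0 i
            nlinarith
          · rw [mul_zero]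
            exact mul_nonneg (by linarith) (hL0 _)
      _ = 2 * (∑ i, p i * (1 - w m i)) * L (m + 1) := by
          rw [← Finset.sum_mul, ← Finset.mul_sum]
      _ ≤ _ := mul_le_mul_of_nonneg_right (by linarith [hη m]) (hL0 _)
  have htot := Finset.sum_le_sum fun i (_ : i ∈ Finset.univ) => hmain i
  rw [Finset.sum_add_distrib, Finset.sum_sub_distrib, hp] at htot
  have hL0' : L 0 = 2 * Real.log 2 + Real.log (R 0) := by simp [hL]
  linarith

theorem entropy_eq_sum {n : Type} [Fintype n] [DecidableEq n] {ρ : Matrix n n ℂ}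
    (hρ : ρ.IsHermitian) :
    entropy ρ = (∑ i, Real.negMulLog (hρ.eigenvalues i)) / Real.log 2 := by
  have h1 : ρ * cfc (Real.logb 2) ρ =
      (hρ.eigenvectorUnitary : Matrix n n ℂ) *
        Matrix.diagonal (fun i => ((hρ.eigenvalues i * Real.logb 2 (hρ.eigenvalues i) : ℝ) : ℂ)) *
        (star hρ.eigenvectorUnitary : Matrix n n ℂ) := by
    refine (congrArg₂ (· * ·) hρ.spectral_theorem (hρ.cfc_eq (Real.logb 2))).trans ?_
    rw [Matrix.IsHermitian.cfc, Unitary.conjStarAlgAut_apply, Unitary.conjStarAlgAut_apply]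
    set U : Matrix n n ℂ := hρ.eigenvectorUnitary.1 with hU
    have hUU : star U * U = 1 := Unitary.coe_star_mul_self hρ.eigenvectorUnitary
    set D := Matrix.diagonal (RCLike.ofReal ∘ hρ.eigenvalues : n → ℂ) with hD
    set D' := Matrix.diagonal (RCLike.ofReal ∘ Real.logb 2 ∘ hρ.eigenvalues : n → ℂ) with hD'
    have hDD : D * D' = Matrix.diagonal
        (fun i => ((hρ.eigenvalues i * Real.logb 2 (hρ.eigenvalues i) : ℝ) : ℂ)) := by
      rw [hD, hD', Matrix.diagonal_mul_diagonal]
      congr 1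
      funext i
      simp
    rw [← hDD]
    calc U * D * star U * (U * D' * star U) = U * D * (star U * U) * D' * star U := by noncomm_ring
      _ = U * (D * D') * star U := by rw [hUU]; noncomm_ring
  rw [entropy, h1, Matrix.trace_mul_cycle, Unitary.coe_star_mul_self, one_mul,
    Matrix.trace_diagonal, Complex.re_sum, ← Finset.sum_neg_distrib, Finset.sum_div]
  refine Finset.sum_congr rfl fun i _ => ?_
  rw [Complex.ofReal_re, Real.negMulLog, Real.logb]
  ring

/-- Approximations of small Schmidt rank bound the entropy of the reduced state. -/
theorem entropy_reducedState_le {N d : ℕ} {X : Finset (Fin N)} {ψ : State N d} (hψ : ‖ψ‖ = 1)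
    {R : ℕ → ℕ} (hR : ∀ m, 1 ≤ R m) {η : ℕ → ℝ} {φ : ℕ → State N d}
    (hφ : ∀ m, SchmidtRankLE X (R m) (φ m)) (hη : ∀ m, ‖ψ - φ m‖ ^ 2 ≤ η m)
    (hη0 : Filter.Tendsto η Filter.atTop (nhds 0)) {C : ℝ}
    (hC : ∀ M : ℕ, ∑ m ∈ Finset.range M,
      2 * η m * (((m : ℝ) + 3) * Real.log 2 + Real.log (R (m + 1))) ≤ C) :
    entropy (reducedState ψ X) ≤ (2 * Real.log 2 + Real.log (R 0) + C) / Real.log 2 := by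
  have hρ := isHermitian_reducedState ψ X
  have hb : ∀ i, Matrix.toEuclideanCLM (n := Config X d) (𝕜 := ℂ) (reducedState ψ X)
      (hρ.eigenvectorBasis i) = (hρ.eigenvalues i : ℂ) • hρ.eigenvectorBasis i := fun i => by
    ext s
    rw [Matrix.ofLp_toEuclideanCLM, hρ.mulVec_eigenvectorBasis]
    rfl
  choose w hw0 hw1 hwR hw using fun m => (hφ m).exists_weights hb
  rw [entropy_eq_sum hρ]
  refine div_le_div_of_nonneg_right (sum_negMulLog_le (fun i => ?_) ?_ hw0 hw1
    (fun m => by exact_mod_cast hR m) hwR (fun m => (hw m).trans (hη m)) hη0 hC)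
    (Real.log_nonneg (by norm_num))
  · rw [eigenvalue_reducedState hb]
    exact Finset.sum_nonneg fun _ _ => sq_nonneg _
  · rw [sum_eigenvalue_reducedState hb, hψ, one_pow]

end SpinChain

/-! ### Parameters at scale y -/

namespace SpinChain

theorem one_le_agspRank {d : ℕ} (hd : 1 ≤ d) (S l k : ℕ) : 1 ≤ agspRank d S l k :=
  Nat.succ_le_of_lt (by unfold agspRank; positivity)

/-- Here S = k = y^8 and l = S², so l < S(k + 1). With l + 1 ≤ exp(16y) and d ≤ exp y every factor
is a power of exp y, of total exponent 72S + 32. -/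
theorem agspRank_le_exp {d y : ℕ} (hy : 1 ≤ y) (hd : (d : ℝ) ≤ Real.exp y) :
    (agspRank d (y ^ 8) ((y ^ 8) ^ 2) (y ^ 8) : ℝ) ≤ Real.exp (135 * (y : ℝ) ^ 9) := by
  set E := Real.exp y with hE
  set S := y ^ 8 with hS
  have hS1 : 1 ≤ S := Nat.one_le_pow _ _ hy
  have hE1 : 1 ≤ E := Real.one_le_exp (Nat.cast_nonneg _)
  have hl : ((S : ℝ) ^ 2 + 1) ≤ E ^ 16 := by
    have h1 : (y : ℝ) + 1 ≤ E := Real.add_one_le_exp _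
    have h2 : (S : ℝ) ^ 2 + 1 ≤ ((y : ℝ) + 1) ^ 16 := by
      rw [hS]; push_cast
      have := pow_add_pow_le (Nat.cast_nonneg (α := ℝ) y) zero_le_one (n := 16) (by norm_num)
      calc _ = (y : ℝ) ^ 16 + 1 ^ 16 := by ring
        _ ≤ _ := this
    exact h2.trans (pow_le_pow_left₀ (by positivity) h1 16)
  unfold agspRank
  push_cast
  calc _ ≤ E ^ 16 * ((E ^ 16) ^ S * ((E ^ 16) ^ S * (E ^ 16 * ((E ^ 16) ^ 2 * E ^ 4) ^ S *
        E ^ (4 * S)))) := by gcongr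
    _ = E ^ (72 * S + 32) := by ring
    _ ≤ E ^ (135 * S) := pow_le_pow_right₀ hE1 (by omega)
    _ = _ := by
      rw [hE, ← Real.exp_nat_mul, hS]
      congr 1
      push_cast
      ring

theorem le_exp_eight : (1792 : ℝ) ≤ Real.exp 8 := by
  have h := Real.exp_one_gt_d9
  have : Real.exp 8 = Real.exp 1 ^ 8 := by rw [← Real.exp_nat_mul]; norm_num
  rw [this]
  calc (1792 : ℝ) ≤ 2.7 ^ 8 := by norm_num
    _ ≤ _ := pow_le_pow_left₀ (by norm_num) (by linarith) 8

/-- The cutoff 360gy^9 gives exp(-180y^9); of this 9y^9 pays for the constants and for (g/ε)² ≤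
exp(2y). -/
theorem truncation_error_le {g ε y : ℝ} (hg : 0 < g) (hε : 0 < ε) (hy : 100 ≤ y)
    (hG : g ≤ y * ε) :
    256 * g ^ 2 * (7 * Real.exp (7 / 2)) * Real.exp (-(360 * g * y ^ 9) / (2 * g)) / ε ^ 2 ≤
      Real.exp (-(171 * y ^ 9)) ∧
    16 * g * (7 * Real.exp (7 / 2)) * Real.exp (-(360 * g * y ^ 9) / (2 * g)) < ε := by
  have hexp : -(360 * g * y ^ 9) / (2 * g) = -(180 * y ^ 9) := by field_simp; ring
  have hY : y ≤ y ^ 9 := le_self_pow₀ (by linarith) (by norm_num)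
  have hye : y ≤ Real.exp y := by linarith [Real.add_one_le_exp y]
  have hGe : g ≤ Real.exp y * ε := hG.trans (mul_le_mul_of_nonneg_right hye hε.le)
  rw [hexp]
  constructor
  · rw [div_le_iff₀ (by positivity)]
    calc _ = 1792 * g ^ 2 * (Real.exp (7 / 2) * Real.exp (-(180 * y ^ 9))) := by ring
      _ ≤ Real.exp 8 * (Real.exp y * ε) ^ 2 * (Real.exp (7 / 2) * Real.exp (-(180 * y ^ 9))) := by
          gcongr
          exact le_exp_eight
      _ = Real.exp (8 + y + y + 7 / 2 + -(180 * y ^ 9)) * ε ^ 2 := by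
          rw [Real.exp_add, Real.exp_add, Real.exp_add, Real.exp_add]; ring
      _ ≤ _ := mul_le_mul_of_nonneg_right (Real.exp_le_exp.2 (by linarith)) (by positivity)
  · calc _ = 112 * g * (Real.exp (7 / 2) * Real.exp (-(180 * y ^ 9))) := by ring
      _ ≤ Real.exp 8 * (Real.exp y * ε) * (Real.exp (7 / 2) * Real.exp (-(180 * y ^ 9))) := by
          gcongr
          linarith [le_exp_eight]
      _ = Real.exp (8 + y + 7 / 2 + -(180 * y ^ 9)) * ε := by
          rw [Real.exp_add, Real.exp_add, Real.exp_add]; ring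
      _ < 1 * ε := mul_lt_mul_of_pos_right (Real.exp_lt_one_iff.2 (by linarith)) hε
      _ = ε := one_mul ε

/-- The width over ε is of order y^10, so the square root is of order y^(-5) and the product with l
= y^16 of order y^11. For y ≥ 100 this exceeds 153y^9, which makes θ² about exp(-306y^9), far below
the inverse rank exp(-135y^9). -/
theorem le_mul_sqrt_of_scale {g ε y : ℝ} (hg : 0 < g) (hε : 0 < ε) (hy : 100 ≤ y)
    (hG : g ≤ y * ε) :
    153 * y ^ 9 ≤ (y ^ 8) ^ 2 * √(2 * (ε / 4) / (2 * (360 * g * y ^ 9) + 2 * y ^ 8 * g)) := by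
  have hy0 : 0 < y := by linarith
  have h1 : 153 * y ^ 9 / (y ^ 8) ^ 2 ≤
      √(2 * (ε / 4) / (2 * (360 * g * y ^ 9) + 2 * y ^ 8 * g)) := by
    refine Real.le_sqrt_of_sq_le ?_
    rw [show 153 * y ^ 9 / (y ^ 8) ^ 2 = 153 / y ^ 7 by field_simp, div_pow,
      div_le_div_iff₀ (by positivity) (by positivity)]
    have h4 : (46818 * 721 : ℝ) ≤ y ^ 4 := by
      calc (46818 * 721 : ℝ) ≤ 100 ^ 4 := by norm_num
        _ ≤ _ := pow_le_pow_left₀ (by norm_num) hy 4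
    have h5 : 720 * y + 2 ≤ 721 * y := by linarith
    calc 153 ^ 2 * (2 * (360 * g * y ^ 9) + 2 * y ^ 8 * g)
        = 23409 * y ^ 8 * (g * (720 * y + 2)) := by ring
      _ ≤ 23409 * y ^ 8 * ((y * ε) * (721 * y)) := by gcongr
      _ = (46818 * 721) * (y ^ 10 * ε / 2) := by ring
      _ ≤ y ^ 4 * (y ^ 10 * ε / 2) := by gcongr
      _ = _ := by ring
  rwa [div_le_iff₀' (by positivity)] at h1

local notation "⟪" x ", " y "⟫" => inner ℂ x y

/-- Approximate ground state projections at the length scale `y ^ 8`. -/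
theorem exists_agsp_of_scale {N d : ℕ} [NeZero N] {ψ : State N d} {ΔE : ℝ} {bc : Boundary} {J : ℝ}
    {h : Fin N → Obs N d} (hh : IsNearestNeighbour bc J h)
    (hψ : IsGappedGroundState (hamiltonian h) ψ ΔE) {a m : ℕ} (ha : a < N) (hm : a + m ≤ N)
    {ε : ℝ} (hε : 0 < ε) (hεΔ : ε ≤ ΔE) (hεg : ε ≤ 4 * J) {y : ℕ} (hy : 100 ≤ y)
    (hG : 4 * J ≤ y * ε) (hd : (d : ℝ) ≤ Real.exp y) :
    ∃ (T : Obs N d) (u₀ : State N d) (r : ℕ), 1 ≤ r ∧ (r : ℝ) ≤ Real.exp (135 * (y : ℝ) ^ 9) ∧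
      ‖u₀‖ = 1 ∧ toOp T u₀ = u₀ ∧
      (∀ v, ⟪u₀, v⟫ = 0 → ⟪u₀, toOp T v⟫ = 0 ∧
        ‖toOp T v‖ ≤ 2 * Real.exp (-(153 * (y : ℝ) ^ 9)) * ‖v‖) ∧
      ‖ψ - ⟪u₀, ψ⟫ • u₀‖ ^ 2 ≤ Real.exp (-(171 * (y : ℝ) ^ 9)) ∧
      OpRank (block N a m) r T := by
  have hg : 0 < 4 * J := by linarith [hh.pos]
  have hyR : (100 : ℝ) ≤ y := by exact_mod_cast hy
  have hY : (1 : ℝ) ≤ (y : ℝ) ^ 9 := one_le_pow₀ (by linarith)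
  have hS : 2 ≤ y ^ 8 := hy.trans (Nat.le_self_pow (by norm_num) y) |>.trans' (by norm_num)
  obtain ⟨hδ, hsmall⟩ := truncation_error_le hg hε hyR hG
  obtain ⟨T, u₀, hu₀, hTu, hTv, hdist, hT⟩ := exists_agsp_of_isGappedGroundState hh hψ ha hm hS
    (l := (y ^ 8) ^ 2) (k := y ^ 8) (Nat.one_le_pow _ _ (by omega)) (by rw [sq]; nlinarith) hε hεΔ
    hεg (t := 360 * (4 * J) * (y : ℝ) ^ 9) (by nlinarith) hsmall
  refine ⟨T, u₀, _, one_le_agspRank ((hψ.two_le (Nat.pos_of_ne_zero (NeZero.ne N))).trans'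
    one_le_two) _ _ _, agspRank_le_exp (by omega) hd, hu₀, hTu, fun v hv => ⟨(hTv v hv).1,
    (hTv v hv).2.trans ?_⟩, hdist.trans hδ, hT⟩
  have := le_mul_sqrt_of_scale hg hε hyR hG
  push_cast
  gcongr

end SpinChain

/-! ### Summation over the scales -/

namespace SpinChain

local notation "⟪" x ", " y "⟫" => inner ℂ x y

/-- One term of the entropy sum, with a = (y + k)^9. The factor 512 = 2^9 bounds the growth of a to
the next scale, whose rank enters. -/
theorem two_mul_exp_neg_mul_le {a b : ℝ} {k : ℕ} (ha : 140000 ≤ a) (hk : (k : ℝ) + 3 ≤ a)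
    (hb : b ≤ 135 * (512 * a)) :
    2 * Real.exp (-(165 * a)) * (((k : ℝ) + 3) * Real.log 2 + b) ≤ (1 / 2) ^ (k + 1) := by
  have hae : a ≤ Real.exp a := by linarith [Real.add_one_le_exp a]
  have hlog : Real.log 2 ≤ 1 := by linarith [Real.log_two_lt_d9]
  have hk0 : (0 : ℝ) ≤ k := Nat.cast_nonneg k
  have h1 : ((k : ℝ) + 3) * Real.log 2 + b ≤ 70000 * a := by nlinarith
  have h2 : Real.exp (-1) ≤ 1 / 2 := by
    rw [Real.exp_neg, one_div]
    exact inv_anti₀ two_pos (by linarith [Real.add_one_le_exp 1])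
  calc 2 * Real.exp (-(165 * a)) * (((k : ℝ) + 3) * Real.log 2 + b)
      ≤ 2 * Real.exp (-(165 * a)) * (70000 * a) := by gcongr
    _ = Real.exp (-(165 * a)) * (140000 * a) := by ring
    _ ≤ Real.exp (-(165 * a)) * (Real.exp a * Real.exp a) := by gcongr; exact ha.trans hae
    _ = Real.exp (-(165 * a) + (a + a)) := by rw [Real.exp_add, Real.exp_add a]
    _ ≤ Real.exp ((k + 1 : ℕ) * (-1)) := Real.exp_le_exp.2 (by push_cast; linarith)
    _ = Real.exp (-1) ^ (k + 1) := Real.exp_nat_mul _ _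
    _ ≤ _ := pow_le_pow_left₀ (Real.exp_pos _).le h2 _

/-- The entropy of a block in the ground state of a gapped chain, in terms of a bound `y` on the
inverse relative gap and the logarithm of the local dimension. -/
theorem entropy_le_of_scale {N d : ℕ} [NeZero N] {ψ : State N d} {ΔE : ℝ} {bc : Boundary} {J : ℝ}
    {h : Fin N → Obs N d} (hh : IsNearestNeighbour bc J h)
    (hψ : IsGappedGroundState (hamiltonian h) ψ ΔE) {a m : ℕ} (ha : a < N) (hm : a + m ≤ N)
    {ε : ℝ} (hε : 0 < ε) (hεΔ : ε ≤ ΔE) (hεg : ε ≤ 4 * J) {y : ℕ} (hy : 100 ≤ y)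
    (hG : 4 * J ≤ y * ε) (hd : (d : ℝ) ≤ Real.exp y) :
    entropy (reducedState ψ (block N a m)) ≤ 200 * (y : ℝ) ^ 9 := by
  set Y : ℕ → ℝ := fun k => ((y + k : ℕ) : ℝ) ^ 9 with hY
  have hyR : (100 : ℝ) ≤ y := by exact_mod_cast hy
  have hYk : ∀ k, Y 0 ≤ Y k := fun k => by
    simp only [hY]
    exact pow_le_pow_left₀ (by positivity) (by push_cast; linarith [Nat.cast_nonneg (α := ℝ) k]) 9
  have hYy : ∀ k : ℕ, (y : ℝ) + k ≤ Y k := fun k => by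
    simp only [hY]; push_cast
    exact le_self_pow₀ (by linarith [Nat.cast_nonneg (α := ℝ) k]) (by norm_num)
  have hY0 : 140000 ≤ Y 0 := by
    simp only [hY, add_zero]
    calc (140000 : ℝ) ≤ 100 ^ 9 := by norm_num
      _ ≤ _ := pow_le_pow_left₀ (by norm_num) hyR 9
  have hYs : ∀ k, Y (k + 1) ≤ 512 * Y k := fun k => by
    simp only [hY]; push_cast
    calc _ ≤ (2 * ((y : ℝ) + k)) ^ 9 := pow_le_pow_left₀ (by positivity)
          (by linarith [Nat.cast_nonneg (α := ℝ) k]) 9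
      _ = _ := by ring
  choose T u r hr1 hr hu hTu hTv hδ hT using fun k : ℕ => exists_agsp_of_scale hh hψ ha hm hε hεΔ hεg
    (y := y + k) (by omega)
    (hG.trans (by gcongr; omega))
    (hd.trans (Real.exp_le_exp.2 (by push_cast; linarith [Nat.cast_nonneg (α := ℝ) k])))
  have hr' : ∀ k, (r k : ℝ) ≤ Real.exp (135 * Y k) := hr
  have hδ' : ∀ k, ‖ψ - ⟪u k, ψ⟫ • u k‖ ^ 2 ≤ Real.exp (-(171 * Y k)) := hδ
  have hTv' : ∀ k v, ⟪u k, v⟫ = 0 → ⟪u k, toOp (T k) v⟫ = 0 ∧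
      ‖toOp (T k) v‖ ≤ 2 * Real.exp (-(153 * Y k)) * ‖v‖ := hTv
  have hsq : ∀ x : ℝ, (2 * Real.exp (-(153 * x))) ^ 2 = 4 * Real.exp (-(306 * x)) := fun x => by
    rw [mul_pow, ← Real.exp_nat_mul]
    norm_num
    ring
  have hbig : ∀ x : ℝ, 100 ≤ x → 10 * Real.exp (-x) ≤ 1 := fun x hx => by
    rw [Real.exp_neg, ← div_eq_mul_inv, div_le_one (Real.exp_pos _)]
    linarith [Real.add_one_le_exp x]
  obtain ⟨φ, hφ, hφn, hφu⟩ := exists_product_state_overlap (hT 0) (hu 0) (hTu 0) (hTv' 0) (by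
    rw [hsq]
    calc 2 * (r 0 : ℝ) * (4 * Real.exp (-(306 * Y 0)))
        ≤ 2 * Real.exp (135 * Y 0) * (4 * Real.exp (-(306 * Y 0))) := by
          gcongr; exact hr' 0
      _ = 8 * Real.exp (-(171 * Y 0)) := by
          rw [show -(171 * Y 0) = 135 * Y 0 + -(306 * Y 0) by ring, Real.exp_add]; ring
      _ ≤ 1 := by linarith [hbig (171 * Y 0) (by linarith), Real.exp_pos (-(171 * Y 0))])
  -- A lower bound for the overlap: its square is at least 1/(2r), hence at least exp(-136 Y 0).
  set n := Real.exp (-(68 * Y 0)) with hn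
  have hn0 : 0 < n := Real.exp_pos _
  have hμ : n ≤ ‖⟪φ, u 0⟫‖ := by
    refine le_of_sq_le_sq ?_ (norm_nonneg _)
    have h1 : n ^ 2 * (2 * Real.exp (135 * Y 0)) ≤ 1 := by
      calc _ = 2 * Real.exp (-Y 0) := by
            rw [hn, ← Real.exp_nat_mul,
              show -Y 0 = (2 : ℕ) * -(68 * Y 0) + 135 * Y 0 by push_cast; ring, Real.exp_add]
            ring
        _ ≤ 1 := by linarith [hbig (Y 0) (by linarith), Real.exp_pos (-Y 0)]
    have h2 : 1 ≤ 2 * Real.exp (135 * Y 0) * ‖⟪φ, u 0⟫‖ ^ 2 := hφu.trans (by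
      gcongr; exact hr' 0)
    have h3 : 0 < 2 * Real.exp (135 * Y 0) := by positivity
    nlinarith
  have hclose : ∀ k, ‖ψ - ⟪u k, ψ⟫ • u k‖ ≤ n / 10 := fun k => by
    refine le_of_sq_le_sq ((hδ' k).trans ?_) (by positivity)
    have h1 : 10 * Real.exp (-(17 * Y 0)) ≤ 1 := hbig _ (by linarith)
    calc Real.exp (-(171 * Y k)) ≤ Real.exp (-(170 * Y 0)) :=
          Real.exp_le_exp.2 (by linarith [hYk k])
      _ = (n * Real.exp (-(17 * Y 0))) ^ 2 := by
          rw [hn, ← Real.exp_add, ← Real.exp_nat_mul]; congr 1; push_cast; ring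
      _ ≤ _ := pow_le_pow_left₀ (by positivity) (by nlinarith) 2
  have hn1 : n ≤ 1 := Real.exp_le_one_iff.2 (by linarith)
  -- The product state is chosen at scale 0 and kept. Its overlap passes from `u 0` to ψ and on to
  -- `u k`, both within n/10 of ψ up to a factor.
  have hν : ∀ k, Real.exp (-(69 * Y 0)) ≤ ‖⟪φ, u k⟫‖ := fun k => by
    have h1 := (norm_inner_le_add_of_close (hu 0) hψ.1 hφn (hclose 0)).2
    have h2 := (norm_inner_le_add_of_close (hu k) hψ.1 hφn (hclose k)).1
    have h3 : Real.exp (-(69 * Y 0)) ≤ n * (1 / 2) := by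
      rw [show -(69 * Y 0) = -(68 * Y 0) + -Y 0 by ring, Real.exp_add]
      have := hbig (Y 0) (by linarith)
      gcongr
      linarith
    nlinarith
  choose z hz using fun k => norm_sub_smul_toOp_sq_le (hu k) (hTu k) (hTv' k) hφn hψ.1 (hδ' k)
    (Real.exp_pos _) (hν k)
  -- The contraction exp(-306 Y k) still wins after division by the squared overlap exp(-138 Y 0).
  have hη : ∀ k, ‖ψ - z k • toOp (T k) φ‖ ^ 2 ≤ Real.exp (-(165 * Y k)) := fun k => by
    refine (hz k).trans ?_
    rw [hsq, ← Real.exp_nat_mul]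
    have h1 : 2 * (4 * Real.exp (-(306 * Y k))) / Real.exp ((2 : ℕ) * -(69 * Y 0)) ≤
        8 * Real.exp (-(168 * Y k)) := by
      rw [div_le_iff₀ (Real.exp_pos _), mul_assoc 8, ← Real.exp_add]
      have : Real.exp (-(306 * Y k)) ≤ Real.exp (-(168 * Y k) + (2 : ℕ) * -(69 * Y 0)) :=
        Real.exp_le_exp.2 (by push_cast; linarith [hYk k])
      linarith
    have h2 : Real.exp (-(171 * Y k)) ≤ Real.exp (-(168 * Y k)) :=
      Real.exp_le_exp.2 (by linarith [hYk k])
    have h3 : Real.exp (-(168 * Y k)) = Real.exp (-(165 * Y k)) * Real.exp (-(3 * Y k)) := by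
      rw [← Real.exp_add]; ring_nf
    have h4 := hbig (3 * Y k) (by linarith [hYk k])
    have h5 := Real.exp_pos (-(165 * Y k))
    nlinarith
  have hη0 : Filter.Tendsto (fun k => Real.exp (-(165 * Y k))) Filter.atTop (nhds 0) :=
    squeeze_zero (fun k => (Real.exp_pos _).le)
      (fun k => Real.exp_le_exp.2 (show -(165 * Y k) ≤ -(k : ℝ) by linarith [hYy k, hYk k]))
      (Real.tendsto_exp_neg_atTop_nhds_zero.comp tendsto_natCast_atTop_atTop)
  have hlogr : ∀ k, Real.log (r k) ≤ 135 * Y k := fun k =>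
    (Real.log_le_iff_le_exp (by exact_mod_cast hr1 k)).2 (hr' k)
  have hent := entropy_reducedState_le hψ.1 hr1
    (fun k => by simpa using ((hT k).schmidtRankLE hφ).smul (z k)) hη hη0 (C := 1) fun M => by
      calc _ ≤ ∑ k ∈ Finset.range M, (1 / 2 : ℝ) ^ (k + 1) := by
            refine Finset.sum_le_sum fun k _ => two_mul_exp_neg_mul_le (hY0.trans (hYk k)) ?_ ?_
            · linarith [hYy k]
            · linarith [hlogr (k + 1), hYs k]
        _ = 1 - (1 / 2) ^ M := by
            simp_rw [pow_succ, ← Finset.sum_mul]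
            rw [geom_sum_eq (by norm_num)]
            ring
        _ ≤ 1 := by linarith [pow_pos (show (0 : ℝ) < 1 / 2 by norm_num) M]
  refine hent.trans ?_
  have hlog := Real.log_two_gt_d9
  have hlog' := Real.log_two_lt_d9
  rw [div_le_iff₀ (by linarith)]
  have h0 : Y 0 = (y : ℝ) ^ 9 := by simp [hY]
  rw [← h0]
  nlinarith [hlogr 0]

/-- As 6 ln 2 > 4, the power of 2 is at least exp(4x) with x = ξD, and the ninth Taylor term of
exp(4x) dominates 200K^9 x^8 because x ≥ 690K^9. -/
theorem mul_pow_nine_le {K ξ D y : ℝ} (hK : 1 ≤ K) (hξ : 1000 * K ^ 9 ≤ ξ) (hD : Real.log 2 ≤ D)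
    (hy0 : 0 ≤ y) (hy : y ≤ K * (ξ * D)) :
    200 * y ^ 9 ≤ 1 * ξ * Real.log (6 * ξ) * D * (2 : ℝ) ^ (6 * ξ * D) := by
  have hlog := Real.log_two_gt_d9
  have hK9 : 1 ≤ K ^ 9 := one_le_pow₀ hK
  have hξ1 : 1000 ≤ ξ := by linarith
  set x := ξ * D with hx
  have hD0 : 0 < D := by linarith
  have hx0 : 0 < x := mul_pos (by linarith) hD0
  have hx1 : 690 * K ^ 9 ≤ x := by
    calc _ ≤ (1000 * K ^ 9) * 0.69 := by linarith
      _ ≤ ξ * D := mul_le_mul hξ (by linarith) (by norm_num) (by linarith)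
  have hl : 1 ≤ Real.log (6 * ξ) := by
    rw [Real.le_log_iff_exp_le (by linarith)]
    linarith [Real.exp_one_lt_d9]
  have hpow : Real.exp (4 * x) ≤ (2 : ℝ) ^ (6 * ξ * D) := by
    rw [Real.rpow_def_of_pos two_pos]
    refine Real.exp_le_exp.2 ?_
    rw [show Real.log 2 * (6 * ξ * D) = Real.log 2 * 6 * x by rw [hx]; ring]
    nlinarith
  have hexp : 200 * K ^ 9 * x ^ 8 ≤ Real.exp (4 * x) := by
    refine le_trans ?_ (Real.pow_div_factorial_le_exp (4 * x) (by linarith) 9)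
    rw [show ((Nat.factorial 9 : ℕ) : ℝ) = 362880 by norm_num [Nat.factorial], mul_pow]
    have : 690 * K ^ 9 * x ^ 8 ≤ x * x ^ 8 := mul_le_mul_of_nonneg_right hx1 (by positivity)
    have h8 : 0 < K ^ 9 * x ^ 8 := by positivity
    rw [le_div_iff₀ (by norm_num)]
    nlinarith
  calc 200 * y ^ 9 ≤ 200 * (K * x) ^ 9 := by gcongr
    _ = x * (200 * K ^ 9 * x ^ 8) := by ring
    _ ≤ x * (2 : ℝ) ^ (6 * ξ * D) := by gcongr; exact hexp.trans hpow
    _ ≤ x * Real.log (6 * ξ) * (2 : ℝ) ^ (6 * ξ * D) := by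
        gcongr
        exact le_mul_of_one_le_right hx0.le hl
    _ = _ := by rw [hx]; ring

end SpinChain

/-! ### The theorem -/

theorem mainTheorem1 :
    (∃ κ μ c : ℝ, 0 < κ ∧ 0 < μ ∧ 0 < c ∧
      ∀ (bc : SpinChain.Boundary) (N d : ℕ) [NeZero N] (J : ℝ)
        (h : Fin N → SpinChain.Obs N d),
        SpinChain.IsNearestNeighbour bc J h →
        SpinChain.IsSoundVelocity bc (SpinChain.hamiltonian h) (κ * J) μ c) ∧
    ∃ c₀ : ℝ, 0 < c₀ ∧ ∀ κ μ c : ℝ, 0 < κ → 0 < μ → 0 < c →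
      ∃ ξC : ℝ, 0 < ξC ∧
        ∀ (bc : SpinChain.Boundary) (N d : ℕ) [NeZero N] (J : ℝ)
          (h : Fin N → SpinChain.Obs N d) (v ΔE : ℝ) (ψ : SpinChain.State N d),
          SpinChain.IsNearestNeighbour bc J h →
          κ * J ≤ v →
          SpinChain.IsSoundVelocity bc (SpinChain.hamiltonian h) v μ c →
          SpinChain.IsGappedGroundState (SpinChain.hamiltonian h) ψ ΔE →
          ∀ (a n : ℕ) (ξ : ℝ), ξ = max (2 * v / ΔE) ξC →
            SpinChain.entropy (SpinChain.reducedState ψ (SpinChain.block N a n)) ≤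
              c₀ * ξ * Real.log (6 * ξ) * Real.log d * (2 : ℝ) ^ (6 * ξ * Real.log d) := by
  refine ⟨⟨8 * Real.exp 1, 1, 2, by positivity, one_pos, two_pos, fun bc N d _ J h hh =>
    SpinChain.isSoundVelocity_hamiltonian hh⟩, 1, one_pos, fun κ μ c hκ _ _ => ?_⟩
  have hK : 1 ≤ 205 + 4 / κ := by
    have : 0 < 4 / κ := by positivity
    linarith
  refine ⟨1000 * (205 + 4 / κ) ^ 9, by positivity, ?_⟩
  intro bc N d _ J h v ΔE ψ hh hv _ hψ a n ξ hξ
  have hN : 0 < N := Nat.pos_of_ne_zero (NeZero.ne N)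
  have hJ := hh.pos
  obtain ⟨hΔ, -⟩ := hψ.exists_gap_form (SpinChain.isHermitian_sum fun j _ => hh.isHermitian j)
  have hd2 : (2 : ℝ) ≤ d := by exact_mod_cast hψ.two_le hN
  have hD : Real.log 2 ≤ Real.log d := Real.log_le_log two_pos hd2
  have hlog := Real.log_two_gt_d9
  have hξ1 : 1000 * (205 + 4 / κ) ^ 9 ≤ ξ := by rw [hξ]; exact le_max_right _ _
  have hξ2 : 2 * v / ΔE ≤ ξ := by rw [hξ]; exact le_max_left _ _
  have hξ0 : 1 ≤ ξ := by
    have : 1 ≤ (205 + 4 / κ) ^ 9 := one_le_pow₀ hK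
    linarith
  -- Truncation needs a gap at most the strength 4J of a layer term; a smaller ε is still a valid
  -- gap.
  set ε := min ΔE (4 * J) with hε
  have hε0 : 0 < ε := lt_min hΔ (by linarith)
  -- From v ≥ κJ and ξ ≥ 2v/ΔE follows 4J/ΔE ≤ (2/κ)ξ; the 1 covers ε = 4J.
  have hG : 4 * J / ε ≤ 1 + 2 / κ * ξ := by
    have h1 : 0 ≤ 2 / κ * ξ := by positivity
    rw [div_le_iff₀ hε0]
    rcases min_choice ΔE (4 * J) with h | h
    · rw [hε, h]
      have h2 : 4 * J ≤ 2 / κ * (2 * v) := by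
        rw [div_mul_eq_mul_div, le_div_iff₀ hκ]; linarith
      have h3 : 2 * v ≤ ξ * ΔE := (div_le_iff₀ hΔ).1 hξ2
      have h4 : 2 / κ * (2 * v) ≤ 2 / κ * (ξ * ΔE) := by gcongr
      nlinarith
    · rw [hε, h]
      nlinarith
  have hGpos : 0 < 4 * J / ε := by positivity
  set y := ⌈100 + 4 * J / ε + Real.log d⌉₊ with hy
  have hyle : 100 + 4 * J / ε + Real.log d ≤ y := Nat.le_ceil _
  have hylt : (y : ℝ) < 100 + 4 * J / ε + Real.log d + 1 :=
    Nat.ceil_lt_add_one (by linarith)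
  have hy100 : 100 ≤ y := by
    have : (100 : ℝ) ≤ y := by linarith
    exact_mod_cast this
  rw [SpinChain.block_eq]
  refine (SpinChain.entropy_le_of_scale hh hψ (by omega) (by split_ifs <;> omega) hε0
    (min_le_left _ _) (min_le_right _ _) hy100 ((div_le_iff₀ hε0).1 (by linarith))
    ((Real.log_le_iff_le_exp (by linarith)).1 (by linarith))).trans
    (SpinChain.mul_pow_nine_le hK hξ1 hD (Nat.cast_nonneg _) ?_)
  have h1 : 1 ≤ 2 * Real.log d := by linarith
  have h2 : ξ ≤ 2 * (ξ * Real.log d) := by nlinarith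
  have h3 : Real.log d ≤ ξ * Real.log d := le_mul_of_one_le_left (by linarith) hξ0
  have h4 : 2 / κ * ξ ≤ 2 / κ * (2 * (ξ * Real.log d)) := by gcongr
  -- Origin of K = 205 + 4/κ: the constants 100 + 1 + 1 in y become 204 ξ ln d through 1 ≤ ξ ≤ 2ξ ln
  -- d, the summand ln d adds one more, and (2/κ)ξ gives 4/κ.
  have h5 : (205 + 4 / κ) * (ξ * Real.log d) =
    205 * (ξ * Real.log d) + 2 / κ * (2 * (ξ * Real.log d)) := by ring
  linarith
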